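/- **Setup.** Work over the field $\mathbb{C}(q)$ with $\iota=\sqrt{-1}\in\mathbb{C}$. For $n\in\mathbb{Z}$ and $\mu\in\mathbb{C}(q)^*$ put $[\mu;n]=\dfrac{q^n\mu-q^{-n}\mu^{-1}}{q-q^{-1}}$, and for elements $a,b$ of a $\mathbb{C}(q)$-algebra put $[a,b]_p=ab-p\,ba$. Consider the linear graph $\bar 1\to\bar\diamondsuit\to\diamondsuit\to 1$, whose edges are labelled $1,0,-1$ in this order. Let $U_q(\mathfrak{gl}_4)$ be the quantum group with generators $E_i,F_i$ ($i\in\{1,0,-1\}$) and $D_j^{\pm1}$ ($j$ a vertex), where the $D_j^{\pm 1}$ commute, $K_i=D_{\sigma(i)}D_{\tau(i)}^{-1}$ for $\sigma(i),\tau(i)$ the source and target of the edge $i$, $$D_jE_iD_j^{-1}=q^{\delta_{\sigma(i),j}-\delta_{\tau(i),j}}E_i,\quad D_jF_iD_j^{-1}=q^{-\delta_{\sigma(i),j}+\delta_{\tau(i),j}}F_i,\quad [E_i,F_{i'}]=\delta_{ii'}\frac{K_i-K_i^{-1}}{q-q^{-1}},$$ and the $E_i$ (and likewise the $F_i$) satisfy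 the usual type $A_3$ quantum Serre relations. Let $U_q'\subset U_q(\mathfrak{gl}_4)$ be the subalgebra generated by $$B_{\pm1}=F_{\pm1}+E_{\mp1}K_{\pm1}^{-1},\quad B_0=F_0+q^{-1}E_0K_0^{-1},\quad \hat D_\diamondsuit^{\pm1}=(D_\diamondsuit D_{\bar\diamondsuit})^{\pm1},\quad \hat D_1^{\pm1}=(D_1D_{\bar1})^{\pm1}.$$ Put $X=[B_0,B_1]_{q^{-1}}$, $Y=[B_0,B_{-1}]_{q^{-1}}$, $Z=[B_1,Y]_{q^{-1}}$. Let $U_+'$ be the subalgebra generated by $B_1,X$, and $U_0'$ the (commutative) subalgebra generated by $\hat D_\diamondsuit^{\pm1},\hat D_1^{\pm1},B_0,Z$; a weight vector in a $U_q'$-module is a simultaneous eigenvector for $U_0'$, and a weight basis is a $\mathbb{C}(q)$-basis of weight vectors. For $\kappa_\diamondsuit,\kappa_1\in\mathbb{Z}$ and $\beta,\zeta\in\mathbb{C}(q)$ let $\mathbb{M}(\kappa_\diamondsuit,\kappa_1,\beta,\zeta)=U_q'\otimes_{U_+'U_0'}\mathbb{C}(q)$ be the Verma module induced from the one-dimensional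 $U_+'U_0'$-module on which $B_1,X$ act by $0$ and $\hat D_\diamondsuit,\hat D_1,B_0,Z$ act by $q^{\kappa_\diamondsuit},q^{\kappa_1},\beta,\zeta$. Its highest weight vectors are the nonzero scalar multiples of $1\otimes1$. Put $\kappa=\kappa_\diamondsuit-\kappa_1$. For $\eta\in\mathbb{C}(q)^*$ let $F_+(\eta)=B_{-1}-\eta^{-1}Y$ and $F_-(\eta)=B_{-1}+\eta Y$, and for a highest weight vector $v$ of $\mathbb{M}(\kappa_\diamondsuit,\kappa_1,[\mu;0],\zeta)$ write $$F_+^aF_-^b v=F_+(q^{b-a+1}\mu)\cdots F_+(q^{b-1}\mu)F_+(q^{b}\mu)\;F_-(q^{b-1}\mu)\cdots F_-(q\mu)F_-(\mu)\,v .$$ **Theorem (Good irreducibles).** Let $\kappa_\diamondsuit,\kappa_1\in\mathbb{Z}$, $\zeta\in\mathbb{C}(q)$ and $\mu\in\mathbb{C}(q)^*$ with $\mu\neq\pm q^l\iota$ for all $l\in\mathbb{Z}$, and let $\mathbb{M}=\mathbb{M}(\kappa_\diamondsuit,\kappa_1,[\mu;0],\zeta)$ (a good Verma module). Then $\mathbb{M}$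 has a finite-dimensional irreducible quotient if and only if $$\zeta=[\mu;\kappa-2i]-q^{-\kappa}[\mu;0]\qquad\text{for some integer } i \text{ with } 0\le i\le\kappa. \tag{$*$}$$ If $(*)$ holds for $i$, then the finite-dimensional irreducible quotient $L$ is unique (there is exactly one submodule $N\subset\mathbb{M}$ such that $\mathbb{M}/N$ is irreducible and finite-dimensional), and for every highest weight vector $v$ of $\mathbb{M}$ the images in $L$ of the vectors $$F_+^aF_-^b v\qquad(0\le a\le i,\ 0\le b\le\kappa-i),$$ indexed by the pairs $(a,b)$, form a weight basis of $L$. -/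

import Mathlib

noncomputable section

namespace QSP

/-! ## The ground field and quantum integers -/

/-- The ground field `ℂ(q)` of rational functions. -/
abbrev Cq : Type := RatFunc ℂ

/-- The variable `q ∈ ℂ(q)`. -/
def q : Cq := RatFunc.X

/-- The root `ι = √-1 ∈ ℂ ⊆ ℂ(q)`. -/
def iota : Cq := RatFunc.C Complex.I

/-- `[μ;n] = (q^n μ - q^{-n} μ⁻¹) / (q - q⁻¹)` for `μ ∈ ℂ(q)^*`. -/
def qBr (μ : Cq) (n : ℤ) : Cq := (q ^ n * μ - q ^ (-n) * μ⁻¹) / (q - q⁻¹)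

/-- The quantum integer `[n] = (q^n - q^{-n}) / (q - q⁻¹)`. -/
def qInt (n : ℤ) : Cq := (q ^ n - q ^ (-n)) / (q - q⁻¹)

/-! ## The quantum group `U_q(𝔤𝔩₄)`

The linear graph has the four vertices `-1 → -♦ → ♦ → 1`, encoded in this order as `0, 1, 2, 3` in
`Fin 4`. Its three edges are labelled (in this order) by `1, 0, -1`, encoded as `0, 1, 2` in `Fin 3`,
so the edge `i : Fin 3` has source `i.castSucc` and target `i.succ`. In both cases the sign change
of labels is the reversal `Fin.rev`. -/

/-- Generators of `U_q(𝔤𝔩₄)`; `Dinv j` stands for `D_j⁻¹`. -/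
inductive Gen : Type
  | E (i : Fin 3)
  | F (i : Fin 3)
  | D (j : Fin 4)
  | Dinv (j : Fin 4)

namespace Gen

/-- A generator as an element of the free algebra. -/
abbrev ι (x : Gen) : FreeAlgebra Cq Gen := FreeAlgebra.ι Cq x

/-- `K_i = D_{source i} D_{target i}⁻¹` in the free algebra. -/
abbrev K (i : Fin 3) : FreeAlgebra Cq Gen := (D i.castSucc).ι * (Dinv i.succ).ι

/-- `K_i⁻¹ = D_{source i}⁻¹ D_{target i}` in the free algebra. -/
abbrev Kinv (i : Fin 3) : FreeAlgebra Cq Gen := (Dinv i.castSucc).ι * (D i.succ).ι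

end Gen

/-- The exponent `δ_{source i, j} - δ_{target i, j}`. -/
def wt (i : Fin 3) (j : Fin 4) : ℤ :=
  (if i.castSucc = j then 1 else 0) - (if i.succ = j then 1 else 0)

/-- Two edges are adjacent if they share a vertex (and are distinct). -/
def Adjacent (i i' : Fin 3) : Prop := i.succ = i'.castSucc ∨ i'.succ = i.castSucc

/-- Defining relations of `U_q(𝔤𝔩₄)`. -/
inductive GLRel : FreeAlgebra Cq Gen → FreeAlgebra Cq Gen → Prop
  | D_mul_Dinv (j : Fin 4) : GLRel ((Gen.D j).ι * (Gen.Dinv j).ι) 1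
  | Dinv_mul_D (j : Fin 4) : GLRel ((Gen.Dinv j).ι * (Gen.D j).ι) 1
  | D_comm (j k : Fin 4) : GLRel ((Gen.D j).ι * (Gen.D k).ι) ((Gen.D k).ι * (Gen.D j).ι)
  | D_E (i : Fin 3) (j : Fin 4) :
      GLRel ((Gen.D j).ι * (Gen.E i).ι * (Gen.Dinv j).ι) (q ^ wt i j • (Gen.E i).ι)
  | D_F (i : Fin 3) (j : Fin 4) :
      GLRel ((Gen.D j).ι * (Gen.F i).ι * (Gen.Dinv j).ι) (q ^ (-wt i j) • (Gen.F i).ι)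
  | E_F_same (i : Fin 3) :
      GLRel ((Gen.E i).ι * (Gen.F i).ι - (Gen.F i).ι * (Gen.E i).ι)
        ((q - q⁻¹)⁻¹ • (Gen.K i - Gen.Kinv i))
  | E_F_ne (i i' : Fin 3) (h : i ≠ i') :
      GLRel ((Gen.E i).ι * (Gen.F i').ι - (Gen.F i').ι * (Gen.E i).ι) 0
  | E_comm (i i' : Fin 3) (h : ¬ Adjacent i i') :
      GLRel ((Gen.E i).ι * (Gen.E i').ι) ((Gen.E i').ι * (Gen.E i).ι)
  | F_comm (i i' : Fin 3) (h : ¬ Adjacent i i') :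
      GLRel ((Gen.F i).ι * (Gen.F i').ι) ((Gen.F i').ι * (Gen.F i).ι)
  | E_serre (i i' : Fin 3) (h : Adjacent i i') :
      GLRel ((Gen.E i).ι ^ 2 * (Gen.E i').ι
        - qInt 2 • ((Gen.E i).ι * (Gen.E i').ι * (Gen.E i).ι)
        + (Gen.E i').ι * (Gen.E i).ι ^ 2) 0
  | F_serre (i i' : Fin 3) (h : Adjacent i i') :
      GLRel ((Gen.F i).ι ^ 2 * (Gen.F i').ι
        - qInt 2 • ((Gen.F i).ι * (Gen.F i').ι * (Gen.F i).ι)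
        + (Gen.F i').ι * (Gen.F i).ι ^ 2) 0

/-- The quantum group `U_q(𝔤𝔩₄)` over `ℂ(q)`. -/
def UqGL : Type := RingQuot GLRel

instance : Ring UqGL := inferInstanceAs (Ring (RingQuot GLRel))

instance : Algebra Cq UqGL := inferInstanceAs (Algebra Cq (RingQuot GLRel))

namespace UqGL

/-- The image of a generator in `U_q(𝔤𝔩₄)`. -/
def gen (x : Gen) : UqGL := RingQuot.mkAlgHom Cq GLRel x.ι

def E (i : Fin 3) : UqGL := gen (Gen.E i)

def F (i : Fin 3) : UqGL := gen (Gen.F i)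

def D (j : Fin 4) : UqGL := gen (Gen.D j)

/-- `D_j⁻¹`. -/
def Dinv (j : Fin 4) : UqGL := gen (Gen.Dinv j)

/-- `K_i⁻¹ = D_{source i}⁻¹ D_{target i}`. -/
def Kinv (i : Fin 3) : UqGL := Dinv i.castSucc * D i.succ

/-! ### Generators of the coideal subalgebra -/

/-- `B_i = F_i + E_{-i} K_i⁻¹`, to be used for the labels `i = 1` (edge `0`) and `i = -1`
(edge `2`). -/
def B (i : Fin 3) : UqGL := F i + E i.rev * Kinv i

/-- `B_0 = F_0 + q⁻¹ E_0 K_0⁻¹`; the label `0` is the edge `1`. -/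
def Bzero : UqGL := F 1 + q⁻¹ • (E 1 * Kinv 1)

/-- `D̂_j = D_j D_{-j}`. -/
def Dhat (j : Fin 4) : UqGL := D j * D j.rev

/-- `D̂_j⁻¹`. -/
def DhatInv (j : Fin 4) : UqGL := Dinv j.rev * Dinv j

end UqGL

/-! ## The coideal subalgebra `U_q'` -/

/-- The quantum symmetric pair coideal subalgebra `U_q' = U_q'(𝔤𝔩₂ × 𝔤𝔩₂)` of `U_q(𝔤𝔩₄)`, the
subalgebra generated by `B_1`, `B_{-1}`, `B_0` and all `D̂_j^{±1}`. -/
def Uq' : Subalgebra Cq UqGL :=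
  Algebra.adjoin Cq
    ({UqGL.B 0, UqGL.B 2, UqGL.Bzero} ∪ Set.range UqGL.Dhat ∪ Set.range UqGL.DhatInv)

/-- `B_1 ∈ U_q'`. -/
def B1 : Uq' := ⟨UqGL.B 0, Algebra.subset_adjoin (by simp)⟩

/-- `B_{-1} ∈ U_q'`. -/
def Bm1 : Uq' := ⟨UqGL.B 2, Algebra.subset_adjoin (by simp)⟩

/-- `B_0 ∈ U_q'`. -/
def B0 : Uq' := ⟨UqGL.Bzero, Algebra.subset_adjoin (by simp)⟩

/-- `D̂_♦ = D_♦ D_{-♦} ∈ U_q'`. -/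
def Dd : Uq' := ⟨UqGL.Dhat 2, Algebra.subset_adjoin (Or.inl (Or.inr ⟨2, rfl⟩))⟩

/-- `D̂_1 = D_1 D_{-1} ∈ U_q'`. -/
def D1 : Uq' := ⟨UqGL.Dhat 3, Algebra.subset_adjoin (Or.inl (Or.inr ⟨3, rfl⟩))⟩

/-- `D̂_♦⁻¹ ∈ U_q'`. -/
def DdInv : Uq' := ⟨UqGL.DhatInv 2, Algebra.subset_adjoin (Or.inr ⟨2, rfl⟩)⟩

/-- `D̂_1⁻¹ ∈ U_q'`. -/
def D1Inv : Uq' := ⟨UqGL.DhatInv 3, Algebra.subset_adjoin (Or.inr ⟨3, rfl⟩)⟩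

/-- The `p`-commutator `[a,b]_p = ab - p ba`. -/
def qComm (p : Cq) (a b : Uq') : Uq' := a * b - p • (b * a)

/-- `X = [B_0, B_1]_{q⁻¹}`. -/
def X : Uq' := qComm q⁻¹ B0 B1

/-- `Y = [B_0, B_{-1}]_{q⁻¹}`. -/
def Y : Uq' := qComm q⁻¹ B0 Bm1

/-- `Z = [B_1, Y]_{q⁻¹}`. -/
def Z : Uq' := qComm q⁻¹ B1 Y

/-- The Cartan subalgebra `U_0'`, generated by `D̂_♦^{±1}`, `D̂_1^{±1}`, `B_0` and `Z`. -/
def U0' : Subalgebra Cq Uq' := Algebra.adjoin Cq {Dd, DdInv, D1, D1Inv, B0, Z}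

/-- A weight vector of a `U_q'`-module: a simultaneous eigenvector for `U_0'`. -/
def IsWeightVector {M : Type*} [AddCommGroup M] [Module Cq M] [Module Uq' M] (w : M) : Prop :=
  w ≠ 0 ∧ ∀ u ∈ U0', ∃ c : Cq, u • w = c • w

/-- A family of vectors is a weight basis if it is a `ℂ(q)`-basis consisting of weight vectors. -/
def IsWeightBasis {M : Type*} [AddCommGroup M] [Module Cq M] [Module Uq' M]
    {I : Type*} (w : I → M) : Prop :=
  LinearIndependent Cq w ∧ Submodule.span Cq (Set.range w) = ⊤ ∧ ∀ i, IsWeightVector (w i)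

/-! ## Verma modules -/

/-- The left ideal of `U_q'` generated by `B_1`, `X`, `D̂_♦ - q^{κ_♦}`, `D̂_1 - q^{κ_1}`, `B_0 - β`
and `Z - ζ`. -/
def vermaIdeal (κd κ1 : ℤ) (β ζ : Cq) : Submodule Uq' Uq' :=
  Submodule.span Uq'
    {B1, X, Dd - algebraMap Cq Uq' (q ^ κd), D1 - algebraMap Cq Uq' (q ^ κ1),
      B0 - algebraMap Cq Uq' β, Z - algebraMap Cq Uq' ζ}

/-- The Verma module `𝕄(κ_♦, κ_1, β, ζ)`, i.e. the module induced from the one-dimensional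
`U_+' U_0'`-module `ℂ(q) · 1` on which `B_1`, `X` act by zero and `D̂_♦`, `D̂_1`, `B_0`, `Z` act by
`q^{κ_♦}`, `q^{κ_1}`, `β`, `ζ`. Inducing this cyclic module amounts to dividing `U_q'` by the left
ideal generated by the annihilator of its generator `1`; the vector `1 ⊗ 1` is the class of `1`. -/
abbrev Verma (κd κ1 : ℤ) (β ζ : Cq) : Type := Uq' ⧸ vermaIdeal κd κ1 β ζ

/-- The canonical generator `1 ⊗ 1` of the Verma module. -/
def vermaGen (κd κ1 : ℤ) (β ζ : Cq) : Verma κd κ1 β ζ :=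
  Submodule.Quotient.mk (p := vermaIdeal κd κ1 β ζ) 1

/-- The highest weight vectors of a Verma module are the nonzero multiples of `1 ⊗ 1`. -/
def IsHighestWeightVector {κd κ1 : ℤ} {β ζ : Cq} (v : Verma κd κ1 β ζ) : Prop :=
  ∃ c : Cq, c ≠ 0 ∧ v = c • vermaGen κd κ1 β ζ

/-- The quotient of the `U_q'`-module `M` by `N` is a finite dimensional irreducible module. -/
def IsFDIrreducibleQuotient {M : Type*} [AddCommGroup M] [Module Cq M] [Module Uq' M]
    [IsScalarTower Cq Uq' M] (N : Submodule Uq' M) : Prop :=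
  IsSimpleModule Uq' (M ⧸ N) ∧ FiniteDimensional Cq (M ⧸ N)

/-- The condition `μ ≠ ± q^l ι` for all `l ∈ ℤ` (with `μ ∈ ℂ(q)^*`), which defines the good Verma
modules `𝕄(κ_♦, κ_1, [μ;0], ζ)`. -/
def IsGood (μ : Cq) : Prop :=
  μ ≠ 0 ∧ ∀ l : ℤ, μ ≠ q ^ l * iota ∧ μ ≠ -(q ^ l * iota)

/-! ## Magical operators -/

/-- `F_+(η) = B_{-1} - η⁻¹ Y`. -/
def Fplus (η : Cq) : Uq' := Bm1 - η⁻¹ • Y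

/-- `F_-(η) = B_{-1} + η Y`. -/
def Fminus (η : Cq) : Uq' := Bm1 + η • Y

/-- The power `F_+^a` on vectors of `B_0`-weight `[η;0]`. As `F_+(η)` maps the `B_0`-weight `[η;0]`
to `[q⁻¹η;0]`, it is `F_+(q^{-(a-1)} η) ⋯ F_+(q⁻¹ η) F_+(η)`. -/
def FplusPow (η : Cq) : ℕ → Uq'
  | 0 => 1
  | a + 1 => Fplus (q ^ (-(a : ℤ)) * η) * FplusPow η a

/-- The power `F_-^b` on vectors of `B_0`-weight `[η;0]`. As `F_-(η)` maps the `B_0`-weight `[η;0]`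
to `[qη;0]`, it is `F_-(q^{b-1} η) ⋯ F_-(q η) F_-(η)`. -/
def FminusPow (η : Cq) : ℕ → Uq'
  | 0 => 1
  | b + 1 => Fminus (q ^ (b : ℤ) * η) * FminusPow η b

/-- The vector `F_+^a F_-^b v` for a vector `v` of `B_0`-weight `[μ;0]`; here `F_-^b v` has
`B_0`-weight `[q^b μ;0]`. -/
def FFvec {M : Type*} [AddCommGroup M] [Module Uq' M] (μ : Cq) (v : M) (a b : ℕ) : M :=
  FplusPow (q ^ (b : ℤ) * μ) a • FminusPow μ b • v

end QSP

end

set_option linter.unusedSimpArgs false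

noncomputable section

namespace QSP

/-! On a vector m with B_0 m = [c;0] m, the operator B_0 acts on the pair B_{-1} m, Y m through a
2×2 matrix with diagonal entries q⁻¹[c;0], q[c;0] and off-diagonal entries 1. Its eigenvectors are
F_-(c) m and F_+(c) m, of parameters qc and q⁻¹c. They are weight vectors for Z as well, the two
kinds of operators commute up to a shift of parameters, and the symmetry c ↦ -c⁻¹, which fixes
[c;0], exchanges them. Goodness means (q^l μ)² ≠ -1 for all l. Hence B_{-1} and Y can be recovered
from F_+ and F_-, the vectors F_+^a F_-^b v span the Verma module (`lowerSpan_eq_top`), and their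
weights are distinct: D̂_♦ sees a + b and B_0 sees b - a (`FFvec_separating`). A proper submodule
therefore has no component along v, so there is at most one maximal submodule
(`IsHW.maximal_unique`).

For the raising operators E(c) = B_1 + cX, E(q^b μ) kills F_-^b v, while E(-(q^b μ)⁻¹) sends F_-^b v
to an explicit multiple `raiseCoeff` of F_-^{b-1} v. In a finite-dimensional module there is a first
vanishing F_-^{B+1} v, and the vanishing of its coefficient determines ζ in terms of B. The
symmetric argument for F_+ determines ζ in terms of some A, and comparison gives A + B = κ: this is
(*) with i = A. Conversely, under (*) the vectors F_-^{κ-i+1} v and F_+^{i+1} v are singular, hence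
zero in an irreducible quotient, whereas raising shows that F_+^a F_-^b v is nonzero inside the
rectangle; distinct weights make these vectors a basis.

Existence under (*) is by construction. U_q' is a coideal, so tensoring a U_q'-module W with the
vector representation V of U_q(gl_4) gives a U_q'-module. If v in W is a highest weight vector of
parameter c, then (0, v, cv, 0) is one of parameter qc, with κ and i both increased by one
(`Tens.isHW`); the symmetry c ↦ -c⁻¹ gives a second step, which increases κ alone and turns c into
q⁻¹c. It remains to treat κ = 0, that is, to find one-dimensional modules on which B_0 acts by an
arbitrary scalar. For infinitely many scalars there are vectors spanning such a module inside
iterated tensor products; since the action is polynomial in the scalar, the multiplicative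
identities extend to all scalars (`sphericalChar`). -/

/-! ### The ground field. -/

theorem q_ne_zero : q ≠ 0 := RatFunc.X_ne_zero

theorem q_zpow_ne_one {n : ℤ} (hn : n ≠ 0) : q ^ n ≠ 1 := by
  have key : ∀ m : ℕ, m ≠ 0 → q ^ m ≠ 1 := by
    intro m hm h
    have : (algebraMap (Polynomial ℂ) Cq) (Polynomial.X ^ m) = algebraMap (Polynomial ℂ) Cq 1 := by
      rw [map_pow, map_one, RatFunc.algebraMap_X]; exact h
    have h2 := RatFunc.algebraMap_injective ℂ this
    have h3 := congrArg Polynomial.natDegree h2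
    rw [Polynomial.natDegree_X_pow, Polynomial.natDegree_one] at h3
    exact hm h3
  rcases Int.eq_nat_or_neg n with ⟨m, rfl | rfl⟩
  · rw [zpow_natCast]; exact key m (by simpa using hn)
  · rw [zpow_neg, zpow_natCast, inv_ne_one]; exact key m (by simpa using hn)

theorem q_sq_ne_one : q ^ 2 ≠ 1 := q_zpow_ne_one (n := 2) (by norm_num)

theorem q_sq_sub_one_ne_zero : q ^ 2 - 1 ≠ 0 := sub_ne_zero.2 q_sq_ne_one

theorem q_sq_add_one_ne_zero : q ^ 2 + 1 ≠ 0 := by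
  intro h
  have : q ^ 4 = 1 := by linear_combination (q ^ 2 - 1) * h
  exact q_zpow_ne_one (n := 4) (by norm_num) this

theorem q_sub_inv_ne_zero : q - q⁻¹ ≠ 0 := by
  have h := q_sq_sub_one_ne_zero
  have h0 := q_ne_zero
  intro h1
  apply h
  linear_combination q * h1 + mul_inv_cancel₀ h0

theorem qInt_two : qInt 2 = q + q⁻¹ := by
  have h := q_sub_inv_ne_zero
  have h0 := q_ne_zero
  rw [qInt, div_eq_iff h, zpow_neg]
  field_simp
  ring

/-! ### Relations of U_q(gl_4) as commutation rules. -/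

namespace UqGL

/-- `K_i = D_{source i} D_{target i}⁻¹`. -/
def K (i : Fin 3) : UqGL := D i.castSucc * Dinv i.succ

/-- The projection of the free algebra onto `U_q(𝔤𝔩₄)`. -/
def mk : FreeAlgebra Cq Gen →ₐ[Cq] UqGL := RingQuot.mkAlgHom Cq GLRel

theorem mk_E (i : Fin 3) : mk (Gen.E i).ι = E i := rfl

theorem mk_F (i : Fin 3) : mk (Gen.F i).ι = F i := rfl

theorem mk_D (j : Fin 4) : mk (Gen.D j).ι = D j := rfl

theorem mk_Dinv (j : Fin 4) : mk (Gen.Dinv j).ι = Dinv j := rfl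

theorem mk_K (i : Fin 3) : mk (Gen.K i) = K i := map_mul mk _ _

theorem mk_Kinv (i : Fin 3) : mk (Gen.Kinv i) = Kinv i := map_mul mk _ _

theorem gen_rel {a b : FreeAlgebra Cq Gen} (h : GLRel a b) : mk a = mk b :=
  RingQuot.mkAlgHom_rel Cq h

theorem D_mul_Dinv (j : Fin 4) : D j * Dinv j = 1 := by
  simpa only [mk_E, mk_F, mk_D, mk_Dinv, mk_K, mk_Kinv, map_mul, map_one] using gen_rel (GLRel.D_mul_Dinv j)

theorem Dinv_mul_D (j : Fin 4) : Dinv j * D j = 1 := by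
  simpa only [mk_E, mk_F, mk_D, mk_Dinv, mk_K, mk_Kinv, map_mul, map_one] using gen_rel (GLRel.Dinv_mul_D j)

theorem D_comm (j k : Fin 4) : D j * D k = D k * D j := by
  simpa only [mk_E, mk_F, mk_D, mk_Dinv, mk_K, mk_Kinv, map_mul, map_one] using gen_rel (GLRel.D_comm j k)

theorem D_mul_E (i : Fin 3) (j : Fin 4) : D j * E i = q ^ wt i j • (E i * D j) := by
  have h : D j * E i * Dinv j = q ^ wt i j • E i := by
    simpa only [mk_E, mk_F, mk_D, mk_Dinv, map_mul, map_smul] using gen_rel (GLRel.D_E i j)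
  have h2 := congrArg (· * D j) h
  simpa only [mul_assoc, Dinv_mul_D, mul_one, smul_mul_assoc] using h2

theorem D_mul_F (i : Fin 3) (j : Fin 4) : D j * F i = q ^ (-wt i j) • (F i * D j) := by
  have h : D j * F i * Dinv j = q ^ (-wt i j) • F i := by
    simpa only [mk_E, mk_F, mk_D, mk_Dinv, map_mul, map_smul] using gen_rel (GLRel.D_F i j)
  have h2 := congrArg (· * D j) h
  simpa only [mul_assoc, Dinv_mul_D, mul_one, smul_mul_assoc] using h2

end UqGL

/-- Moving the inverse of `d` past `x`, if `d` and `x` commute up to a scalar. -/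
theorem inv_mul_of_mul {A : Type*} [Ring A] [Algebra Cq A] {d d' x : A} {n : ℤ}
    (h1 : d * d' = 1) (h2 : d' * d = 1) (h : d * x = q ^ n • (x * d)) :
    d' * x = q ^ (-n) • (x * d') := by
  have h0 := zpow_ne_zero n q_ne_zero
  have h3 : d' * (d * x) * d' = q ^ n • (d' * x) := by
    rw [h, mul_smul_comm, smul_mul_assoc, mul_assoc, mul_assoc, h1, mul_one]
  rw [← mul_assoc, h2, one_mul] at h3
  rw [h3, smul_smul, zpow_neg, inv_mul_cancel₀ h0, one_smul]

namespace UqGL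

theorem Dinv_mul_E (i : Fin 3) (j : Fin 4) : Dinv j * E i = q ^ (-wt i j) • (E i * Dinv j) :=
  inv_mul_of_mul (D_mul_Dinv j) (Dinv_mul_D j) (D_mul_E i j)

theorem Dinv_mul_F (i : Fin 3) (j : Fin 4) : Dinv j * F i = q ^ (wt i j) • (F i * Dinv j) := by
  simpa using inv_mul_of_mul (D_mul_Dinv j) (Dinv_mul_D j) (D_mul_F i j)

theorem D_Dinv_comm (j k : Fin 4) : Dinv j * D k = D k * Dinv j := by
  have := inv_mul_of_mul (n := 0) (D_mul_Dinv j) (Dinv_mul_D j) (x := D k) (by simpa using D_comm j k)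
  simpa using this

theorem Dinv_comm (j k : Fin 4) : Dinv j * Dinv k = Dinv k * Dinv j := by
  have := inv_mul_of_mul (n := 0) (D_mul_Dinv j) (Dinv_mul_D j) (x := Dinv k)
    (by simpa using (D_Dinv_comm k j).symm)
  simpa using this

theorem K_mul_Kinv (i : Fin 3) : K i * Kinv i = 1 := by
  rw [K, Kinv, mul_assoc, ← mul_assoc (Dinv i.succ), Dinv_comm, mul_assoc, Dinv_mul_D, mul_one,
    D_mul_Dinv]

theorem Kinv_mul_K (i : Fin 3) : Kinv i * K i = 1 := by
  rw [K, Kinv, mul_assoc, ← mul_assoc (D i.succ), D_comm, mul_assoc, D_mul_Dinv, mul_one,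
    Dinv_mul_D]

theorem Kinv_mul_E (i j : Fin 3) :
    Kinv i * E j = q ^ (wt j i.succ - wt j i.castSucc) • (E j * Kinv i) := by
  rw [Kinv, mul_assoc, D_mul_E, mul_smul_comm, ← mul_assoc, Dinv_mul_E, smul_mul_assoc, smul_smul,
    ← zpow_add₀ q_ne_zero, mul_assoc, sub_eq_add_neg]

theorem Kinv_mul_F (i j : Fin 3) :
    Kinv i * F j = q ^ (wt j i.castSucc - wt j i.succ) • (F j * Kinv i) := by
  rw [Kinv, mul_assoc, D_mul_F, mul_smul_comm, ← mul_assoc, Dinv_mul_F, smul_mul_assoc, smul_smul,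
    ← zpow_add₀ q_ne_zero, mul_assoc, neg_add_eq_sub]

theorem K_mul_E (i j : Fin 3) :
    K i * E j = q ^ (wt j i.castSucc - wt j i.succ) • (E j * K i) := by
  simpa using inv_mul_of_mul (Kinv_mul_K i) (K_mul_Kinv i) (Kinv_mul_E i j)

theorem K_mul_F (i j : Fin 3) :
    K i * F j = q ^ (wt j i.succ - wt j i.castSucc) • (F j * K i) := by
  simpa using inv_mul_of_mul (Kinv_mul_K i) (K_mul_Kinv i) (Kinv_mul_F i j)

theorem Kinv_comm (i j : Fin 3) : Kinv i * Kinv j = Kinv j * Kinv i := by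
  have h (a b c d : UqGL) (h1 : a * c = c * a) (h2 : a * d = d * a) (h3 : b * c = c * b)
      (h4 : b * d = d * b) : a * b * (c * d) = c * d * (a * b) := by
    exact Commute.mul_left (Commute.mul_right h1 h2) (Commute.mul_right h3 h4)
  exact h _ _ _ _ (Dinv_comm _ _) (D_Dinv_comm _ _) (D_Dinv_comm _ _).symm (D_comm _ _)

theorem K_Kinv_comm (i j : Fin 3) : K i * Kinv j = Kinv j * K i := by
  have := inv_mul_of_mul (n := 0) (Kinv_mul_K i) (K_mul_Kinv i) (x := Kinv j)
    (by simpa using Kinv_comm i j)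
  simpa using this

theorem K_comm (i j : Fin 3) : K i * K j = K j * K i := by
  have := inv_mul_of_mul (n := 0) (Kinv_mul_K i) (K_mul_Kinv i) (x := K j)
    (by simpa using (K_Kinv_comm j i).symm)
  simpa using this

theorem E_mul_F_same (i : Fin 3) :
    E i * F i = F i * E i + (q - q⁻¹)⁻¹ • (K i - Kinv i) := by
  rw [← sub_eq_iff_eq_add', K, Kinv]
  simpa only [mk_E, mk_F, mk_D, mk_Dinv, map_sub, map_mul, map_smul] using gen_rel (GLRel.E_F_same i)

theorem E_mul_F_ne {i j : Fin 3} (h : i ≠ j) : E i * F j = F j * E i := by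
  rw [← sub_eq_zero]
  simpa only [mk_E, mk_F, mk_D, mk_Dinv, mk_K, mk_Kinv, map_sub, map_mul, map_zero] using gen_rel (GLRel.E_F_ne i j h)

theorem E_comm {i j : Fin 3} (h : ¬ Adjacent i j) : E i * E j = E j * E i := by
  simpa only [mk_E, mk_F, mk_D, mk_Dinv, mk_K, mk_Kinv, map_mul] using gen_rel (GLRel.E_comm i j h)

theorem F_comm {i j : Fin 3} (h : ¬ Adjacent i j) : F i * F j = F j * F i := by
  simpa only [mk_E, mk_F, mk_D, mk_Dinv, mk_K, mk_Kinv, map_mul] using gen_rel (GLRel.F_comm i j h)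

theorem E_serre {i j : Fin 3} (h : Adjacent i j) :
    E i * (E i * E j) - (q + q⁻¹) • (E i * (E j * E i)) + E j * (E i * E i) = 0 := by
  rw [← qInt_two]
  simpa only [mk_E, mk_F, mk_D, mk_Dinv, mk_K, mk_Kinv, map_mul, map_smul, map_sub, map_add, map_pow, map_zero, sq, mul_assoc]
    using gen_rel (GLRel.E_serre i j h)

theorem F_serre {i j : Fin 3} (h : Adjacent i j) :
    F i * (F i * F j) - (q + q⁻¹) • (F i * (F j * F i)) + F j * (F i * F i) = 0 := by
  rw [← qInt_two]
  simpa only [mk_E, mk_F, mk_D, mk_Dinv, mk_K, mk_Kinv, map_mul, map_smul, map_sub, map_add, map_pow, map_zero, sq, mul_assoc]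
    using gen_rel (GLRel.F_serre i j h)

end UqGL

/-! ### Serre-type relations of the coideal generators. -/

section CoidealSerre

variable {𝕜 : Type*} [Field 𝕜] {A : Type*} [Ring A] [Algebra 𝕜 A] {q : 𝕜} {f e k g h l : A}

/-- The Serre relation of `B = f + e k` and `B₀ = g + q⁻¹ h l` that is quadratic in `B`. -/
theorem coideal_serre_left (h0 : q ≠ 0)
    (hef : e * f = f * e) (heg : e * g = g * e) (hhf : h * f = f * h)
    (hkf : k * f = q ^ (2 : ℤ) • (f * k)) (hkg : k * g = q ^ (-1 : ℤ) • (g * k))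
    (hke : k * e = e * k) (hkh : k * h = q ^ (1 : ℤ) • (h * k))
    (hlf : l * f = q ^ (-1 : ℤ) • (f * l)) (hle : l * e = q ^ (1 : ℤ) • (e * l))
    (hkl : l * k = k * l)
    (hF : f * (f * g) - (q + q⁻¹) • (f * (g * f)) + g * (f * f) = 0)
    (hE : e * (e * h) - (q + q⁻¹) • (e * (h * e)) + h * (e * e) = 0) :
    (f + e * k) * ((f + e * k) * (g + q⁻¹ • (h * l)))
      - (q + q⁻¹) • ((f + e * k) * ((g + q⁻¹ • (h * l)) * (f + e * k)))
      + (g + q⁻¹ • (h * l)) * ((f + e * k) * (f + e * k)) = 0 := by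
  have R {x y : A} {z : A} (c : A) (hxy : x * y = z) : x * (y * c) = z * c := by
    rw [← mul_assoc, hxy]
  simp only [mul_add, add_mul, mul_assoc, smul_mul_assoc, mul_smul_comm, smul_smul, smul_add,
    hef, heg, hhf, hkf, hkg, hke, hkh, hlf, hle, hkl,
    R _ hef, R _ heg, R _ hhf, R _ hkf, R _ hkg, R _ hke, R _ hkh, R _ hlf, R _ hle, R _ hkl]
  -- After normal ordering the mixed terms cancel. Those in f, g alone form `hF`; those in e, h
  -- alone form `hE` times k k l, with a common factor q² from moving k and l to the right.
  have hE' := congrArg (fun x => q⁻¹ • (x * (k * (k * l)))) hE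
  simp only [sub_mul, add_mul, smul_mul_assoc, mul_assoc, zero_mul, smul_zero] at hE'
  simp only [zpow_neg, zpow_one, zpow_ofNat]
  linear_combination (norm := skip) hF + q^2 • hE'
  match_scalars <;> field_simp <;> ring

/-- The Serre relation of `B₀ = g + q⁻¹ h l` and `B = f + e k` that is quadratic in `B₀`. -/
theorem coideal_serre_right {K : A} (h0 : q ≠ 0) (h1 : q ^ 2 - 1 ≠ 0)
    (heg : e * g = g * e) (hhf : h * f = f * h)
    (hhg : h * g = g * h + (q - q⁻¹)⁻¹ • (K - l)) (hlK : K * l = 1)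
    (hkg : k * g = q ^ (-1 : ℤ) • (g * k)) (hkh : k * h = q ^ (1 : ℤ) • (h * k))
    (hlf : l * f = q ^ (-1 : ℤ) • (f * l)) (hle : l * e = q ^ (1 : ℤ) • (e * l))
    (hlg : l * g = q ^ (2 : ℤ) • (g * l)) (hlh : l * h = q ^ (-2 : ℤ) • (h * l))
    (hKf : K * f = q ^ (1 : ℤ) • (f * K)) (hKe : K * e = q ^ (-1 : ℤ) • (e * K))
    (hkl : l * k = k * l) (hkK : K * k = k * K)
    (hF : g * (g * f) - (q + q⁻¹) • (g * (f * g)) + f * (g * g) = 0)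
    (hE : h * (h * e) - (q + q⁻¹) • (h * (e * h)) + e * (h * h) = 0) :
    (g + q⁻¹ • (h * l)) * ((g + q⁻¹ • (h * l)) * (f + e * k))
      - (q + q⁻¹) • ((g + q⁻¹ • (h * l)) * ((f + e * k) * (g + q⁻¹ • (h * l))))
      + (f + e * k) * ((g + q⁻¹ • (h * l)) * (g + q⁻¹ • (h * l))) = f + e * k := by
  have R {x y : A} {z : A} (c : A) (hxy : x * y = z) : x * (y * c) = z * c := by
    rw [← mul_assoc, hxy]
  have h2 : q - q⁻¹ ≠ 0 := by
    intro h3; apply h1; linear_combination q * h3 + mul_inv_cancel₀ h0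
  simp only [mul_add, add_mul, mul_assoc, smul_mul_assoc, mul_smul_comm, smul_smul, smul_add,
    mul_sub, sub_mul, smul_sub, mul_one, one_mul,
    heg, hhf, hkg, hkh, hlf, hle, hkl, hhg, hlg, hlh, hlK, hKf, hKe, hkK,
    R _ heg, R _ hhf, R _ hkg, R _ hkh, R _ hlf, R _ hle, R _ hkl,
    R _ hhg, R _ hlg, R _ hlh, R _ hlK, R _ hKf, R _ hKe, R _ hkK]
  -- Again the terms in g, f and in h, e form the two Serre relations. The inhomogeneous right-hand
  -- side is produced by the commutator of h and g: its summand K meets the factor l, and K l = 1.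
  have hE' := congrArg (fun x => x * (k * (l * l))) hE
  simp only [sub_mul, add_mul, smul_mul_assoc, mul_assoc, zero_mul, smul_zero] at hE'
  simp only [zpow_neg, zpow_one, zpow_ofNat, hkl, R _ hkl] at hE' ⊢
  linear_combination (norm := skip) hF + (q ^ 2)⁻¹ • hE'
  match_scalars <;> field_simp <;> ring

end CoidealSerre

/-- The relations between the generators `B₁, B₋₁, B₀, K = D̂_♦ D̂_1⁻¹, K' = K⁻¹` of the coideal
subalgebra and the elements `X, Y, Z`. -/
structure CoidealRelations {𝕜 A : Type*} [Field 𝕜] [Ring A] [Algebra 𝕜 A] (q : 𝕜)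
    (B₁ Bₘ B₀ K K' X Y Z : A) : Prop where
  K_Bₘ : K * Bₘ = (q ^ 2)⁻¹ • (Bₘ * K)
  K'_Bₘ : K' * Bₘ = q ^ 2 • (Bₘ * K')
  K_B₀ : K * B₀ = B₀ * K
  K'_B₀ : K' * B₀ = B₀ * K'
  B₁_Bₘ : B₁ * Bₘ = Bₘ * B₁ + (q - q⁻¹)⁻¹ • (K - K')
  B₀_B₁ : B₀ * B₁ = X + q⁻¹ • (B₁ * B₀)
  B₀_Bₘ : B₀ * Bₘ = Y + q⁻¹ • (Bₘ * B₀)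
  B₁_Y : B₁ * Y = Z + q⁻¹ • (Y * B₁)
  B₀_X : B₀ * X = q • (X * B₀) + B₁
  B₀_Y : B₀ * Y = q • (Y * B₀) + Bₘ
  Y_Bₘ : Y * Bₘ = q • (Bₘ * Y)

/-! ### Reordering rules: lowering operators to the left, raising operators to the right. -/

namespace CoidealRelations

variable {𝕜 A : Type*} [Field 𝕜] [Ring A] [Algebra 𝕜 A] {q : 𝕜} {B₁ Bₘ B₀ K K' X Y Z : A}

theorem K_Y (h : CoidealRelations q B₁ Bₘ B₀ K K' X Y Z) : K * Y = (q ^ 2)⁻¹ • (Y * K) := by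
  have hY : Y = B₀ * Bₘ - q⁻¹ • (Bₘ * B₀) := by rw [h.B₀_Bₘ]; simp
  have R {x y : A} {z : A} (c : A) (hxy : x * y = z) : x * (y * c) = z * c := by
    rw [← mul_assoc, hxy]
  rw [hY]
  simp only [mul_sub, sub_mul, mul_assoc, smul_mul_assoc, mul_smul_comm, h.K_B₀, h.K_Bₘ,
    R _ h.K_B₀, R _ h.K_Bₘ]
  module

theorem K'_Y (h : CoidealRelations q B₁ Bₘ B₀ K K' X Y Z) : K' * Y = q ^ 2 • (Y * K') := by
  have hY : Y = B₀ * Bₘ - q⁻¹ • (Bₘ * B₀) := by rw [h.B₀_Bₘ]; simp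
  have R {x y : A} {z : A} (c : A) (hxy : x * y = z) : x * (y * c) = z * c := by
    rw [← mul_assoc, hxy]
  rw [hY]
  simp only [mul_sub, sub_mul, mul_assoc, smul_mul_assoc, mul_smul_comm, h.K'_B₀, h.K'_Bₘ,
    R _ h.K'_B₀, R _ h.K'_Bₘ]
  module

theorem X_Bₘ (h : CoidealRelations q B₁ Bₘ B₀ K K' X Y Z) :
    X * Bₘ = q⁻¹ • (Bₘ * X) + (1 - (q ^ 2)⁻¹) • (Y * B₁)
      + ((1 - (q ^ 2)⁻¹) * (q - q⁻¹)⁻¹) • (B₀ * (K - K')) - q⁻¹ • Z := by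
  have hX : X = B₀ * B₁ - q⁻¹ • (B₁ * B₀) := by rw [h.B₀_B₁]; simp
  have R {x y : A} {z : A} (c : A) (hxy : x * y = z) : x * (y * c) = z * c := by
    rw [← mul_assoc, hxy]
  have e : X * Bₘ = B₀ * (B₁ * Bₘ) - q⁻¹ • (B₁ * (B₀ * Bₘ)) := by
    nth_rw 1 [hX]; simp only [sub_mul, smul_mul_assoc, mul_assoc]
  rw [e]
  simp only [mul_sub, sub_mul, mul_add, add_mul, mul_assoc, smul_mul_assoc, mul_smul_comm, smul_add,
    smul_sub, smul_smul, h.B₁_Bₘ, h.B₀_Bₘ, h.B₀_B₁, h.B₁_Y, h.K_B₀, h.K'_B₀,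
    R _ h.B₁_Bₘ, R _ h.B₀_Bₘ, R _ h.B₀_B₁, R _ h.B₁_Y]
  module

theorem X_Y_aux (h : CoidealRelations q B₁ Bₘ B₀ K K' X Y Z) (h0 : q ≠ 0) :
    X * Y = Y * X - (q⁻¹ * (q - q⁻¹)⁻¹) • (K - K') - (q ^ 2)⁻¹ • (B₀ * Z - Z * B₀) := by
  have hY : Y = B₀ * Bₘ - q⁻¹ • (Bₘ * B₀) := by rw [h.B₀_Bₘ]; simp
  have hXB : X * B₀ = q⁻¹ • (B₀ * X) - q⁻¹ • B₁ := by
    rw [h.B₀_X, smul_add, smul_smul, inv_mul_cancel₀ h0]; simp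
  have R {x y : A} {z : A} (c : A) (hxy : x * y = z) : x * (y * c) = z * c := by
    rw [← mul_assoc, hxy]
  have e : X * Y = q⁻¹ • (B₀ * (X * Bₘ)) - q⁻¹ • (B₁ * Bₘ) - q⁻¹ • (X * Bₘ * B₀) := by
    nth_rw 1 [hY]
    rw [mul_sub, ← mul_assoc, hXB, sub_mul, smul_mul_assoc, smul_mul_assoc, mul_smul_comm,
      mul_assoc, mul_assoc]
  rw [e, h.X_Bₘ]
  simp only [mul_sub, sub_mul, mul_add, add_mul, mul_assoc, smul_mul_assoc, mul_smul_comm, smul_add,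
    smul_sub, smul_smul, h.B₁_Bₘ, h.B₀_Bₘ, h.B₀_B₁, h.B₀_X, h.B₀_Y, h.K_B₀, h.K'_B₀,
    R _ h.B₁_Bₘ, R _ h.B₀_Bₘ, R _ h.B₀_B₁, R _ h.B₀_X, R _ h.B₀_Y]
  match_scalars <;> field_simp <;> ring

theorem B₀_Z_sub (h : CoidealRelations q B₁ Bₘ B₀ K K' X Y Z) (h0 : q ≠ 0) :
    B₀ * Z - Z * B₀ = X * Y - Y * X + (q⁻¹ * (q - q⁻¹)⁻¹) • (K - K') := by
  have hZ : Z = B₁ * Y - q⁻¹ • (Y * B₁) := by rw [h.B₁_Y]; simp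
  have R {x y : A} {z : A} (c : A) (hxy : x * y = z) : x * (y * c) = z * c := by
    rw [← mul_assoc, hxy]
  have e : B₁ * Bₘ - Bₘ * B₁ = (q - q⁻¹)⁻¹ • (K - K') := by rw [h.B₁_Bₘ]; simp
  rw [mul_smul, ← e, hZ]
  simp only [mul_sub, sub_mul, mul_add, add_mul, mul_assoc, smul_mul_assoc, mul_smul_comm, smul_add,
    smul_sub, smul_smul, h.B₀_Bₘ, h.B₀_B₁, h.B₀_X, h.B₀_Y,
    R _ h.B₀_Bₘ, R _ h.B₀_B₁, R _ h.B₀_X, R _ h.B₀_Y]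
  match_scalars <;> field_simp <;> ring

/-- Expanding Y inside X Y and expanding Z inside B₀ Z - Z B₀ give two relations between X Y - Y X
and B₀ Z - Z B₀. Eliminating the former leaves (1 + q⁻²)(B₀ Z - Z B₀) = 0. -/
theorem B₀_Z (h : CoidealRelations q B₁ Bₘ B₀ K K' X Y Z) (h0 : q ≠ 0) (h2 : q ^ 2 + 1 ≠ 0) :
    B₀ * Z = Z * B₀ := by
  have e := h.B₀_Z_sub h0
  rw [h.X_Y_aux h0] at e
  have e2 : (1 + (q ^ 2)⁻¹) • (B₀ * Z - Z * B₀) = 0 := by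
    rw [add_smul, one_smul]
    nth_rw 1 [e]
    abel
  have h3 : 1 + (q ^ 2)⁻¹ ≠ 0 := by
    intro h4; apply h2; field_simp at h4; simpa using h4
  exact sub_eq_zero.1 ((smul_eq_zero_iff_right h3).1 e2)

theorem X_Y (h : CoidealRelations q B₁ Bₘ B₀ K K' X Y Z) (h0 : q ≠ 0) (h2 : q ^ 2 + 1 ≠ 0) :
    X * Y = Y * X - (q⁻¹ * (q - q⁻¹)⁻¹) • (K - K') := by
  rw [h.X_Y_aux h0, h.B₀_Z h0 h2, sub_self, smul_zero, sub_zero]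

theorem Z_Bₘ (h : CoidealRelations q B₁ Bₘ B₀ K K' X Y Z) (h0 : q ≠ 0) (h1 : q ^ 2 - 1 ≠ 0) :
    Z * Bₘ = q • (Bₘ * Z) - (q ^ 2 + 1) • (Y * K') := by
  have hZ : Z = B₁ * Y - q⁻¹ • (Y * B₁) := by rw [h.B₁_Y]; simp
  have h2 : q - q⁻¹ ≠ 0 := by
    intro h3; apply h1; linear_combination q * h3 + mul_inv_cancel₀ h0
  have R {x y : A} {z : A} (c : A) (hxy : x * y = z) : x * (y * c) = z * c := by
    rw [← mul_assoc, hxy]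
  have e : Z * Bₘ = B₁ * (Y * Bₘ) - q⁻¹ • (Y * (B₁ * Bₘ)) := by
    nth_rw 1 [hZ]; simp only [sub_mul, smul_mul_assoc, mul_assoc]
  rw [e]
  simp only [mul_sub, sub_mul, mul_add, add_mul, mul_assoc, smul_mul_assoc, mul_smul_comm, smul_add,
    smul_sub, smul_smul, h.Y_Bₘ, h.B₁_Bₘ, h.B₁_Y, h.K_Y, h.K'_Y,
    R _ h.Y_Bₘ, R _ h.B₁_Bₘ, R _ h.B₁_Y, R _ h.K_Y, R _ h.K'_Y]
  match_scalars <;> field_simp <;> ring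

/-- Z commutes with B₀, so this is the q⁻¹-commutator of B₀ with the relation `Z_Bₘ`. -/
theorem Z_Y (h : CoidealRelations q B₁ Bₘ B₀ K K' X Y Z) (h0 : q ≠ 0) (h1 : q ^ 2 - 1 ≠ 0)
    (h2 : q ^ 2 + 1 ≠ 0) :
    Z * Y = q • (Y * Z) - (q ^ 2 + 1) • (Bₘ * K' + (q - q⁻¹) • (Y * (B₀ * K'))) := by
  have hY : Y = B₀ * Bₘ - q⁻¹ • (Bₘ * B₀) := by rw [h.B₀_Bₘ]; simp
  have R {x y : A} {z : A} (c : A) (hxy : x * y = z) : x * (y * c) = z * c := by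
    rw [← mul_assoc, hxy]
  have e : Z * Y = B₀ * (Z * Bₘ) - q⁻¹ • (Z * Bₘ * B₀) := by
    nth_rw 1 [hY]
    rw [mul_sub, ← mul_assoc, ← h.B₀_Z h0 h2, mul_smul_comm, mul_assoc, mul_assoc]
  rw [e, h.Z_Bₘ h0 h1]
  simp only [mul_sub, sub_mul, mul_add, add_mul, mul_assoc, smul_mul_assoc, mul_smul_comm, smul_add,
    smul_sub, smul_smul, h.B₀_Bₘ, h.B₀_Y, h.K'_B₀, h.B₀_Z h0 h2, R _ h.B₀_Bₘ, R _ h.B₀_Y]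
  match_scalars <;> field_simp <;> ring

end CoidealRelations

/-! ### Verification of the relations in U_q'. -/

namespace UqGL

theorem D_DhatInv_aux (j : Fin 4) : Dhat j * DhatInv j = 1 := by
  rw [Dhat, DhatInv, mul_assoc, ← mul_assoc (D j.rev), D_mul_Dinv, one_mul, D_mul_Dinv]

theorem DhatInv_mul_Dhat (j : Fin 4) : DhatInv j * Dhat j = 1 := by
  rw [Dhat, DhatInv, mul_assoc, ← mul_assoc (Dinv j), Dinv_mul_D, one_mul, Dinv_mul_D]

theorem D_Kinv_comm (j : Fin 4) (i : Fin 3) : D j * Kinv i = Kinv i * D j :=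
  Commute.mul_right (D_Dinv_comm i.castSucc j).symm (D_comm j _)

theorem Dhat_mul_E (j : Fin 4) (i : Fin 3) :
    Dhat j * E i = q ^ (wt i j + wt i j.rev) • (E i * Dhat j) := by
  rw [Dhat, mul_assoc, D_mul_E, mul_smul_comm, ← mul_assoc, D_mul_E, smul_mul_assoc, smul_smul,
    ← zpow_add₀ q_ne_zero, mul_assoc, add_comm]

theorem Dhat_mul_F (j : Fin 4) (i : Fin 3) :
    Dhat j * F i = q ^ (-(wt i j + wt i j.rev)) • (F i * Dhat j) := by
  rw [Dhat, mul_assoc, D_mul_F, mul_smul_comm, ← mul_assoc, D_mul_F, smul_mul_assoc, smul_smul,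
    ← zpow_add₀ q_ne_zero, mul_assoc, neg_add_rev]

theorem Dhat_Kinv_comm (j : Fin 4) (i : Fin 3) : Dhat j * Kinv i = Kinv i * Dhat j :=
  Commute.mul_left (D_Kinv_comm j i) (D_Kinv_comm _ i)

theorem Dhat_mul_B (j : Fin 4) (i : Fin 3) (n : ℤ) (hF : -(wt i j + wt i j.rev) = n)
    (hE : wt i.rev j + wt i.rev j.rev = n) : Dhat j * B i = q ^ n • (B i * Dhat j) := by
  rw [B, mul_add, add_mul, smul_add, Dhat_mul_F, hF, ← mul_assoc, Dhat_mul_E, hE, smul_mul_assoc,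
    mul_assoc, Dhat_Kinv_comm, mul_assoc]

theorem Dhat_mul_Bzero (j : Fin 4) (h : wt 1 j + wt 1 j.rev = 0) :
    Dhat j * Bzero = Bzero * Dhat j := by
  rw [Bzero, mul_add, add_mul, Dhat_mul_F, mul_smul_comm, ← mul_assoc, Dhat_mul_E, h, neg_zero,
    zpow_zero, one_smul, one_smul, mul_assoc, Dhat_Kinv_comm, smul_mul_assoc, mul_assoc]

/-- Only the pairings of E_1 with F_1 and of E_{-1} with F_{-1} contribute. Their commutators are
multiplied by K_{-1}⁻¹ and K_1⁻¹, the products of two inverses cancel, and K_{-1}K_1⁻¹ = D̂_♦ D̂_1⁻¹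
and its inverse remain. -/
theorem B_commutator : B 0 * B 2 = B 2 * B 0
    + (q - q⁻¹)⁻¹ • (Dhat 2 * DhatInv 3 - DhatInv 2 * Dhat 3) := by
  have e1 : Dhat 2 * DhatInv 3 = K 2 * Kinv 0 := by
    change D 2 * D 1 * (Dinv 0 * Dinv 3) = D 2 * Dinv 3 * (Dinv 0 * D 1)
    rw [Dinv_comm 0 3, mul_assoc, mul_assoc, ← mul_assoc (D 1), ← D_Dinv_comm 3 1, mul_assoc,
      D_Dinv_comm 0 1]
  have e2 : DhatInv 2 * Dhat 3 = K 0 * Kinv 2 := by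
    change Dinv 1 * Dinv 2 * (D 3 * D 0) = D 0 * Dinv 1 * (Dinv 2 * D 3)
    rw [← D_Dinv_comm 1 0, D_comm 3 0, mul_assoc, mul_assoc, ← mul_assoc (Dinv 2), D_Dinv_comm 2 0,
      mul_assoc]
  have hr0 : Fin.rev (0 : Fin 3) = 2 := rfl
  have hr2 : Fin.rev (2 : Fin 3) = 0 := rfl
  have R {x y : UqGL} {z : UqGL} (c : UqGL) (hxy : x * y = z) : x * (y * c) = z * c := by
    rw [← mul_assoc, hxy]
  have k02 : Kinv 0 * F 2 = F 2 * Kinv 0 := by rw [Kinv_mul_F]; simp [wt, Fin.ext_iff]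
  have k20 : Kinv 2 * F 0 = F 0 * Kinv 2 := by rw [Kinv_mul_F]; simp [wt, Fin.ext_iff]
  have k00 : Kinv 0 * E 0 = q ^ (-2 : ℤ) • (E 0 * Kinv 0) := by rw [Kinv_mul_E]; rfl
  have k22 : Kinv 2 * E 2 = q ^ (-2 : ℤ) • (E 2 * Kinv 2) := by rw [Kinv_mul_E]; rfl
  have ff : F 0 * F 2 = F 2 * F 0 := F_comm (by simp [Adjacent, Fin.ext_iff])
  have ee : E 0 * E 2 = E 2 * E 0 := E_comm (by simp [Adjacent, Fin.ext_iff])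
  rw [e1, e2, B, B, hr0, hr2]
  simp only [mul_add, add_mul, mul_assoc, smul_mul_assoc, mul_smul_comm, smul_add, smul_sub,
    sub_mul, mul_sub, k02, k20, k00, k22, ff, ee, E_mul_F_same, Kinv_comm 2 0, ← K_Kinv_comm 0 2,
    R _ k02, R _ k20, R _ k00, R _ k22, R _ ff, R _ ee, R _ (E_mul_F_same _)]
  abel

theorem serre_left (i : Fin 3) (hi : i ≠ 1) :
    B i * (B i * Bzero) - (q + q⁻¹) • (B i * (Bzero * B i)) + Bzero * (B i * B i) = 0 := by
  fin_cases i
  · refine coideal_serre_left q_ne_zero (E_mul_F_ne (by decide)) (E_mul_F_ne (by decide))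
      (E_mul_F_ne (by decide)) ?_ ?_ ?_ ?_ ?_ ?_ (Kinv_comm _ _)
      (F_serre (by simp [Adjacent, Fin.ext_iff])) (E_serre (by simp [Adjacent, Fin.ext_iff]))
    all_goals first | (rw [Kinv_mul_F]; rfl) | (rw [Kinv_mul_E]; rfl) |
      (rw [Kinv_mul_E]; simp [wt, Fin.ext_iff])
  · exact absurd rfl hi
  · refine coideal_serre_left q_ne_zero (E_mul_F_ne (by decide)) (E_mul_F_ne (by decide))
      (E_mul_F_ne (by decide)) ?_ ?_ ?_ ?_ ?_ ?_ (Kinv_comm _ _)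
      (F_serre (by simp [Adjacent, Fin.ext_iff])) (E_serre (by simp [Adjacent, Fin.ext_iff]))
    all_goals first | (rw [Kinv_mul_F]; rfl) | (rw [Kinv_mul_E]; rfl) |
      (rw [Kinv_mul_E]; simp [wt, Fin.ext_iff])

theorem serre_right (i : Fin 3) (hi : i ≠ 1) :
    Bzero * (Bzero * B i) - (q + q⁻¹) • (Bzero * (B i * Bzero)) + B i * (Bzero * Bzero) = B i := by
  fin_cases i
  · refine coideal_serre_right (K := K 1) q_ne_zero q_sq_sub_one_ne_zero (E_mul_F_ne (by decide))
      (E_mul_F_ne (by decide)) (E_mul_F_same _) (K_mul_Kinv _)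
      ?_ ?_ ?_ ?_ ?_ ?_ ?_ ?_ (Kinv_comm _ _) (K_Kinv_comm _ _)
      (F_serre (by simp [Adjacent, Fin.ext_iff])) (E_serre (by simp [Adjacent, Fin.ext_iff]))
    all_goals first | (rw [Kinv_mul_F]; rfl) | (rw [Kinv_mul_E]; rfl) | (rw [K_mul_F]; rfl) |
      (rw [K_mul_E]; rfl)
  · exact absurd rfl hi
  · refine coideal_serre_right (K := K 1) q_ne_zero q_sq_sub_one_ne_zero (E_mul_F_ne (by decide))
      (E_mul_F_ne (by decide)) (E_mul_F_same _) (K_mul_Kinv _)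
      ?_ ?_ ?_ ?_ ?_ ?_ ?_ ?_ (Kinv_comm _ _) (K_Kinv_comm _ _)
      (F_serre (by simp [Adjacent, Fin.ext_iff])) (E_serre (by simp [Adjacent, Fin.ext_iff]))
    all_goals first | (rw [Kinv_mul_F]; rfl) | (rw [Kinv_mul_E]; rfl) | (rw [K_mul_F]; rfl) |
      (rw [K_mul_E]; rfl)

end UqGL

open UqGL in
theorem Dd_mul_DdInv : Dd * DdInv = 1 := Subtype.ext (D_DhatInv_aux 2)

open UqGL in
theorem DdInv_mul_Dd : DdInv * Dd = 1 := Subtype.ext (DhatInv_mul_Dhat 2)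

open UqGL in
theorem D1_mul_D1Inv : D1 * D1Inv = 1 := Subtype.ext (D_DhatInv_aux 3)

open UqGL in
theorem D1Inv_mul_D1 : D1Inv * D1 = 1 := Subtype.ext (DhatInv_mul_Dhat 3)

theorem Dd_mul_Bm1 : Dd * Bm1 = q ^ (-1 : ℤ) • (Bm1 * Dd) :=
  Subtype.ext (UqGL.Dhat_mul_B 2 2 (-1) rfl rfl)

theorem D1_mul_Bm1 : D1 * Bm1 = q ^ (1 : ℤ) • (Bm1 * D1) :=
  Subtype.ext (UqGL.Dhat_mul_B 3 2 1 rfl rfl)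

theorem Dd_mul_B0 : Dd * B0 = B0 * Dd := Subtype.ext (UqGL.Dhat_mul_Bzero 2 rfl)

theorem D1_mul_B0 : D1 * B0 = B0 * D1 := Subtype.ext (UqGL.Dhat_mul_Bzero 3 rfl)

/-- `K̂ = D̂_♦ D̂_1⁻¹`. -/
def Kh : Uq' := Dd * D1Inv

/-- `K̂⁻¹ = D̂_♦⁻¹ D̂_1`. -/
def KhInv : Uq' := DdInv * D1

theorem D1Inv_mul {n : ℤ} {x : Uq'} (h : D1 * x = q ^ n • (x * D1)) :
    D1Inv * x = q ^ (-n) • (x * D1Inv) :=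
  inv_mul_of_mul D1_mul_D1Inv D1Inv_mul_D1 h

theorem DdInv_mul {n : ℤ} {x : Uq'} (h : Dd * x = q ^ n • (x * Dd)) :
    DdInv * x = q ^ (-n) • (x * DdInv) :=
  inv_mul_of_mul Dd_mul_DdInv DdInv_mul_Dd h

/-- The entries `B₀_X` and `B₀_Y` restate the inhomogeneous Serre relation quadratic in B_0, and
`Y_Bₘ` restates the homogeneous one quadratic in B_{-1}. -/
theorem coidealRelations : CoidealRelations q B1 Bm1 B0 Kh KhInv X Y Z where
  K_Bₘ := by
    rw [Kh, mul_assoc, D1Inv_mul D1_mul_Bm1, mul_smul_comm, ← mul_assoc, Dd_mul_Bm1, smul_mul_assoc,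
      smul_smul, ← zpow_add₀ q_ne_zero, mul_assoc, ← zpow_natCast, ← zpow_neg]; rfl
  K'_Bₘ := by
    rw [KhInv, mul_assoc, D1_mul_Bm1, mul_smul_comm, ← mul_assoc, DdInv_mul Dd_mul_Bm1,
      smul_mul_assoc, smul_smul, ← zpow_add₀ q_ne_zero, mul_assoc, ← zpow_natCast]; rfl
  K_B₀ := by
    have h := D1Inv_mul (n := 0) (x := B0) (by simpa using D1_mul_B0)
    rw [neg_zero, zpow_zero, one_smul] at h
    rw [Kh, mul_assoc, h, ← mul_assoc, Dd_mul_B0, mul_assoc]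
  K'_B₀ := by
    have h := DdInv_mul (n := 0) (x := B0) (by simpa using Dd_mul_B0)
    rw [neg_zero, zpow_zero, one_smul] at h
    rw [KhInv, mul_assoc, D1_mul_B0, ← mul_assoc, h, mul_assoc]
  B₁_Bₘ := Subtype.ext UqGL.B_commutator
  B₀_B₁ := by simp [X, qComm]
  B₀_Bₘ := by simp [Y, qComm]
  B₁_Y := by simp [Z, qComm]
  B₀_X := by
    have h : B0 * (B0 * B1) - (q + q⁻¹) • (B0 * (B1 * B0)) + B1 * (B0 * B0) = B1 :=
      Subtype.ext (UqGL.serre_right 0 (by decide))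
    have h0 := q_ne_zero
    refine Eq.trans ?_ (congrArg (fun t => q • (X * B0) + t) h)
    simp only [X, qComm, mul_sub, sub_mul, mul_smul_comm, smul_mul_assoc, mul_assoc, smul_sub,
      smul_smul, mul_inv_cancel₀ h0, one_smul, add_smul]
    abel
  B₀_Y := by
    have h : B0 * (B0 * Bm1) - (q + q⁻¹) • (B0 * (Bm1 * B0)) + Bm1 * (B0 * B0) = Bm1 :=
      Subtype.ext (UqGL.serre_right 2 (by decide))
    have h0 := q_ne_zero
    refine Eq.trans ?_ (congrArg (fun t => q • (Y * B0) + t) h)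
    simp only [Y, qComm, mul_sub, sub_mul, mul_smul_comm, smul_mul_assoc, mul_assoc, smul_sub,
      smul_smul, mul_inv_cancel₀ h0, one_smul, add_smul]
    abel
  Y_Bₘ := by
    have h : Bm1 * (Bm1 * B0) - (q + q⁻¹) • (Bm1 * (B0 * Bm1)) + B0 * (Bm1 * Bm1) = 0 :=
      Subtype.ext (UqGL.serre_left 2 (by decide))
    have h0 := q_ne_zero
    rw [← sub_eq_zero, ← h]
    simp only [Y, qComm, mul_sub, sub_mul, mul_smul_comm, smul_mul_assoc, mul_assoc, smul_sub,
      smul_smul, mul_inv_cancel₀ h0, one_smul, add_smul]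
    abel

/-- Induction over the generators of `U_q'`. -/
theorem uq'_induction {P : Uq' → Prop} (hB1 : P B1) (hBm1 : P Bm1) (hB0 : P B0) (hDd : P Dd)
    (hDdInv : P DdInv) (hD1 : P D1) (hD1Inv : P D1Inv) (hc : ∀ c : Cq, P (algebraMap Cq Uq' c))
    (hadd : ∀ x y, P x → P y → P (x + y)) (hmul : ∀ x y, P x → P y → P (x * y)) (x : Uq') :
    P x := by
  obtain ⟨x, hx⟩ := x
  -- D̂_j = D̂_{-j}, so the four indices give only two torus elements and their inverses.
  have e2 : UqGL.Dhat 1 = UqGL.Dhat 2 := UqGL.D_comm 1 2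
  have e3 : UqGL.Dhat 0 = UqGL.Dhat 3 := UqGL.D_comm 0 3
  have e2' : UqGL.DhatInv 1 = UqGL.DhatInv 2 := UqGL.Dinv_comm 2 1
  have e3' : UqGL.DhatInv 0 = UqGL.DhatInv 3 := UqGL.Dinv_comm 3 0
  refine Algebra.adjoin_induction (p := fun x hx => P ⟨x, hx⟩) ?_ (fun c => hc c)
    (fun x y hx hy h1 h2 => hadd ⟨x, hx⟩ ⟨y, hy⟩ h1 h2)
    (fun x y hx hy h1 h2 => hmul ⟨x, hx⟩ ⟨y, hy⟩ h1 h2) hx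
  have key : ∀ (x : UqGL) (y : Uq'), P y → y.1 = x → ∀ hx, P ⟨x, hx⟩ := by
    rintro x y hy rfl hx; exact hy
  rintro x (((rfl | rfl | rfl) | ⟨j, rfl⟩) | ⟨j, rfl⟩)
  · exact hB1
  · exact hBm1
  · exact hB0
  · fin_cases j
    · exact key _ D1 hD1 e3.symm _
    · exact key _ Dd hDd e2.symm _
    · exact hDd
    · exact hD1
  · fin_cases j
    · exact key _ D1Inv hD1Inv e3'.symm _
    · exact key _ DdInv hDdInv e2'.symm _
    · exact hDdInv
    · exact hD1Inv

/-! ### Lowering and raising operators on weight vectors. -/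

namespace CoidealRelations

variable {𝕜 A : Type*} [Field 𝕜] [Ring A] [Algebra 𝕜 A] {q : 𝕜} {B₁ Bₘ B₀ K K' X Y Z : A}

/-- The magical operators commute. -/
theorem lower_comm (h : CoidealRelations q B₁ Bₘ B₀ K K' X Y Z) (h0 : q ≠ 0) {c : 𝕜} (hc : c ≠ 0) :
    (Bₘ + (-(q * c)⁻¹) • Y) * (Bₘ + c • Y) = (Bₘ + (q⁻¹ * c) • Y) * (Bₘ + (-c⁻¹) • Y) := by
  simp only [mul_add, add_mul, smul_mul_assoc, mul_smul_comm, smul_add, smul_smul, h.Y_Bₘ]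
  match_scalars <;> field_simp
  ring

variable {M : Type*} [AddCommGroup M] [Module 𝕜 M] [Module A M] [IsScalarTower 𝕜 A M]

theorem smul_smul_of_mul {x y z : A} (h : x * y = z) (m : M) : x • y • m = z • m := by
  rw [smul_smul, h]

theorem smul_comm_alg (x : A) (c : 𝕜) (m : M) : x • c • m = c • x • m := by
  rw [smul_comm]

variable {m : M} {k c z : 𝕜}

/-- B₀ maps Bₘ m to Y m + q⁻¹β Bₘ m and Y m to qβ Y m + Bₘ m, where β = [c;0]. The coefficient
vector (1, c) is an eigenvector of this matrix; replacing c by -c⁻¹ gives the other one. -/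
theorem B₀_lower (h : CoidealRelations q B₁ Bₘ B₀ K K' X Y Z) (h0 : q ≠ 0) (h1 : q ^ 2 - 1 ≠ 0)
    (hc : c ≠ 0) (hB₀ : B₀ • m = ((c - c⁻¹) / (q - q⁻¹)) • m) :
    B₀ • (Bₘ + c • Y) • m = ((q * c - (q * c)⁻¹) / (q - q⁻¹)) • (Bₘ + c • Y) • m := by
  have h2 : q - q⁻¹ ≠ 0 := by
    intro h3; apply h1; linear_combination q * h3 + mul_inv_cancel₀ h0
  simp only [add_smul, smul_add, smul_assoc, smul_comm_alg (𝕜 := 𝕜) (A := A), smul_smul_of_mul h.B₀_Bₘ,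
    smul_smul_of_mul h.B₀_Y, mul_smul, hB₀]
  generalize Bₘ • B₁ • m = m₁, Bₘ • X • m = m₂, Y • B₁ • m = m₃, Y • X • m = m₄, Bₘ • m = m₅,
    Y • m = m₆
  match_scalars <;> field_simp <;> ring

theorem Z_lower (h : CoidealRelations q B₁ Bₘ B₀ K K' X Y Z) (h0 : q ≠ 0) (h1 : q ^ 2 - 1 ≠ 0)
    (h2 : q ^ 2 + 1 ≠ 0) (hc : c ≠ 0) (hB₀ : B₀ • m = ((c - c⁻¹) / (q - q⁻¹)) • m)
    (hK' : K' • m = k⁻¹ • m) (hZ : Z • m = z • m) :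
    Z • (Bₘ + c • Y) • m = (q * z - (q ^ 2 + 1) * k⁻¹ * c) • (Bₘ + c • Y) • m := by
  have h3 : q - q⁻¹ ≠ 0 := by
    intro h3; apply h1; linear_combination q * h3 + mul_inv_cancel₀ h0
  simp only [add_smul, smul_add, smul_assoc, smul_comm_alg (𝕜 := 𝕜) (A := A), smul_smul_of_mul (h.Z_Bₘ h0 h1),
    smul_smul_of_mul (h.Z_Y h0 h1 h2), mul_smul, sub_smul, hB₀, hK', hZ]
  generalize Bₘ • B₁ • m = m₁, Bₘ • X • m = m₂, Y • B₁ • m = m₃, Y • X • m = m₄, Bₘ • m = m₅,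
    Y • m = m₆
  match_scalars <;> field_simp <;> ring

/-- For this pairing of parameters the scalar terms coming from K, K' and Z cancel, so the raising
operator passes through the lowering operator without a remainder. -/
theorem raise_lower (h : CoidealRelations q B₁ Bₘ B₀ K K' X Y Z) (h0 : q ≠ 0) (h1 : q ^ 2 - 1 ≠ 0)
    (h2 : q ^ 2 + 1 ≠ 0) (hc : c ≠ 0) (hB₀ : B₀ • m = ((c - c⁻¹) / (q - q⁻¹)) • m)
    (hK : K • m = k • m) (hK' : K' • m = k⁻¹ • m) (hZ : Z • m = z • m) :
    (B₁ + (q * c) • X) • (Bₘ + c • Y) • m = (Bₘ + (q * c) • Y) • (B₁ + c • X) • m := by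
  have h3 : q - q⁻¹ ≠ 0 := by
    intro h3; apply h1; linear_combination q * h3 + mul_inv_cancel₀ h0
  simp only [add_smul, smul_add, smul_assoc, smul_comm_alg (𝕜 := 𝕜) (A := A), smul_smul_of_mul h.B₁_Bₘ,
    smul_smul_of_mul h.B₁_Y, smul_smul_of_mul h.X_Bₘ,
    smul_smul_of_mul (h.X_Y h0 h2), mul_smul, sub_smul, smul_sub, hB₀, hK, hK', hZ]
  generalize Bₘ • B₁ • m = m₁, Bₘ • X • m = m₂, Y • B₁ • m = m₃, Y • X • m = m₄, Bₘ • m = m₅,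
    Y • m = m₆
  match_scalars <;> field_simp <;> ring

/-- For the opposite parameter a scalar remainder survives. The assumption c² + 1 ≠ 0 makes B₁ + cX
and B₁ - c⁻¹X independent, so that the reordered terms can be expressed through them; this is where
goodness becomes essential. -/
theorem raise_lower' (h : CoidealRelations q B₁ Bₘ B₀ K K' X Y Z) (h0 : q ≠ 0)
    (h1 : q ^ 2 - 1 ≠ 0) (h2 : q ^ 2 + 1 ≠ 0) (hc : c ≠ 0) (hc' : c ^ 2 + 1 ≠ 0)
    (hB₀ : B₀ • m = ((c - c⁻¹) / (q - q⁻¹)) • m)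
    (hK : K • m = k • m) (hK' : K' • m = k⁻¹ • m) (hZ : Z • m = z • m) :
    (B₁ + (-(q * c)⁻¹) • X) • (Bₘ + c • Y) • m =
      ((c ^ 2 + (q ^ 2)⁻¹) / (c ^ 2 + 1)) • (Bₘ + (q⁻¹ * c) • Y) • (B₁ + (-c⁻¹) • X) • m
      + ((1 - (q ^ 2)⁻¹) / (c ^ 2 + 1)) • (Bₘ + (-(q * c)⁻¹) • Y) • (B₁ + c • X) • m
      + ((1 + (q ^ 2)⁻¹ * (c ^ 2)⁻¹) * ((k - k⁻¹) / (q - q⁻¹) + z * c)) • m := by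
  have h3 : q - q⁻¹ ≠ 0 := by
    intro h3; apply h1; linear_combination q * h3 + mul_inv_cancel₀ h0
  simp only [add_smul, smul_add, smul_assoc, smul_comm_alg (𝕜 := 𝕜) (A := A), smul_smul_of_mul h.B₁_Bₘ,
    smul_smul_of_mul h.B₁_Y, smul_smul_of_mul h.X_Bₘ,
    smul_smul_of_mul (h.X_Y h0 h2), mul_smul, sub_smul, smul_sub, hB₀, hK, hK', hZ]
  generalize Bₘ • B₁ • m = m₁, Bₘ • X • m = m₂, Y • B₁ • m = m₃, Y • X • m = m₄, Bₘ • m = m₅,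
    Y • m = m₆
  match_scalars <;> field_simp <;> ring

end CoidealRelations

/-! ### Goodness, the symmetry c ↦ -c⁻¹, and weight vectors. -/

section

theorem qBr_zero (c : Cq) : qBr c 0 = (c - c⁻¹) / (q - q⁻¹) := by simp [qBr]

theorem qBr_eq (c : Cq) (n : ℤ) : qBr c n = qBr (q ^ n * c) 0 := by
  simp [qBr, mul_comm]

theorem inv_neg_inv {𝕜 : Type*} [Field 𝕜] (c : 𝕜) : (-c⁻¹)⁻¹ = -c := by simp

/-- For n = 0 this says that c and -c⁻¹ describe the same B_0-eigenvalue. Since F_+(c) = F_-(-c⁻¹),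
every result on F_- yields one on F_+. -/
theorem qBr_neg_inv (c : Cq) (n : ℤ) : qBr (-c⁻¹) n = qBr c (-n) := by
  rw [qBr, qBr, neg_neg, inv_neg_inv]; ring

theorem eq_or_of_qBr_eq {x y : Cq} (hx : x ≠ 0) (hy : y ≠ 0) (h : qBr x 0 = qBr y 0) :
    x = y ∨ x * y = -1 := by
  rw [qBr_zero, qBr_zero, div_left_inj' q_sub_inv_ne_zero] at h
  have h1 : (x - y) * (x * y + 1) = 0 := by
    field_simp at h
    linear_combination h
  rcases mul_eq_zero.1 h1 with h2 | h2
  · exact Or.inl (sub_eq_zero.1 h2)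
  · exact Or.inr (eq_neg_of_add_eq_zero_left h2)

theorem q_zpow_inj {m n : ℤ} (h : q ^ m = q ^ n) : m = n := by
  by_contra hne
  apply q_zpow_ne_one (n := m - n) (sub_ne_zero.2 hne)
  rw [zpow_sub₀ q_ne_zero, h, div_self (zpow_ne_zero _ q_ne_zero)]

theorem q_zpow_ne_zero (n : ℤ) : q ^ n ≠ 0 := zpow_ne_zero _ q_ne_zero

theorem iota_sq : iota ^ 2 = -1 := by
  rw [iota, ← map_pow, Complex.I_sq, map_neg, map_one]

/-- Since ι² = -1, x² + 1 = (x - ι)(x + ι). This is the form in which goodness is used below. -/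
theorem IsGood.sq_add_one_ne_zero {μ : Cq} (h : IsGood μ) (l : ℤ) : (q ^ l * μ) ^ 2 + 1 ≠ 0 := by
  intro h1
  have h2 : (q ^ l * μ - iota) * (q ^ l * μ + iota) = 0 := by linear_combination h1 - iota_sq
  have h3 := h.2 (-l)
  have h4 : q ^ (-l) * q ^ l = 1 := by rw [← zpow_add₀ q_ne_zero]; simp
  rcases mul_eq_zero.1 h2 with h5 | h5
  · exact h3.1 (by linear_combination q ^ (-l) * h5 - μ * h4)
  · exact h3.2 (by linear_combination q ^ (-l) * h5 - μ * h4)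

theorem IsGood.neg_inv {μ : Cq} (h : IsGood μ) : IsGood (-μ⁻¹) := by
  have key (l : ℤ) : (-μ⁻¹) ^ 2 ≠ (q ^ l * iota) ^ 2 := by
    intro h1
    apply h.sq_add_one_ne_zero l
    have h0 := h.1
    have h2 : (-μ⁻¹) ^ 2 * μ ^ 2 = 1 := by field_simp
    linear_combination μ ^ 2 * h1 + (q ^ l) ^ 2 * μ ^ 2 * iota_sq - h2
  refine ⟨neg_ne_zero.2 (inv_ne_zero h.1), fun l => ⟨fun h1 => key l (by rw [h1]), fun h1 =>
    key l (by rw [h1, neg_sq])⟩⟩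

/-- Equal values force q^m = q^n or q^{m+n} μ² = -1. Goodness excludes the latter only for even m +
n, where it reads (q^l μ)² = -1; hence the parity assumption. -/
theorem IsGood.qBr_inj {μ : Cq} (h : IsGood μ) {m n l : ℤ} (hmn : m + n = 2 * l)
    (he : qBr μ m = qBr μ n) : m = n := by
  rw [qBr_eq, qBr_eq μ n] at he
  rcases eq_or_of_qBr_eq (mul_ne_zero (q_zpow_ne_zero m) h.1) (mul_ne_zero (q_zpow_ne_zero n) h.1)
    he with h1 | h1
  · exact q_zpow_inj (mul_right_cancel₀ h.1 h1)
  · refine absurd ?_ (h.sq_add_one_ne_zero l)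
    have h2 : q ^ m * q ^ n = q ^ l * q ^ l := by
      rw [← zpow_add₀ q_ne_zero, ← zpow_add₀ q_ne_zero, hmn, two_mul]
    linear_combination h1 - μ ^ 2 * h2

theorem Fplus_eq (η : Cq) : Fplus η = Fminus (-η⁻¹) := by
  rw [Fplus, Fminus, neg_smul, sub_eq_add_neg]

theorem FplusPow_eq (η : Cq) (a : ℕ) : FplusPow η a = FminusPow (-η⁻¹) a := by
  induction a with
  | zero => rfl
  | succ a ih => rw [FplusPow, FminusPow, ih, Fplus_eq, mul_inv, zpow_neg, inv_inv, mul_neg]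

theorem Fplus_mul_Fminus {c : Cq} (hc : c ≠ 0) :
    Fplus (q * c) * Fminus c = Fminus (q⁻¹ * c) * Fplus c := by
  rw [Fplus_eq, Fplus_eq]
  exact coidealRelations.lower_comm q_ne_zero hc

theorem FplusPow_mul_Fminus {c : Cq} (hc : c ≠ 0) (a : ℕ) :
    FplusPow (q * c) a * Fminus c = Fminus (q ^ (-(a : ℤ)) * c) * FplusPow c a := by
  induction a with
  | zero => simp [FplusPow]
  | succ a ih =>
    have h := Fplus_mul_Fminus (mul_ne_zero (q_zpow_ne_zero (-a)) hc)
    have e : q ^ (-((a + 1 : ℕ) : ℤ)) * c = q⁻¹ * (q ^ (-(a : ℤ)) * c) := by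
      rw [Nat.cast_add, neg_add_rev, zpow_add₀ q_ne_zero]; simp [mul_assoc]
    rw [FplusPow, FplusPow, mul_assoc, ih, ← mul_assoc, mul_left_comm, h, e, mul_assoc]

theorem FplusPow_mul_FminusPow {c : Cq} (hc : c ≠ 0) (a b : ℕ) :
    FplusPow (q ^ (b : ℤ) * c) a * FminusPow c b
      = FminusPow (q ^ (-(a : ℤ)) * c) b * FplusPow c a := by
  induction b with
  | zero => simp [FminusPow]
  | succ b ih =>
    have h := FplusPow_mul_Fminus (mul_ne_zero (q_zpow_ne_zero b) hc) a
    have e : q ^ ((b + 1 : ℕ) : ℤ) * c = q * (q ^ (b : ℤ) * c) := by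
      rw [Nat.cast_add, add_comm, zpow_add₀ q_ne_zero]; simp [mul_assoc]
    rw [FminusPow, FminusPow, e, ← mul_assoc, h, mul_assoc, ih, ← mul_assoc, mul_left_comm]

variable {M : Type*} [AddCommGroup M] [Module Cq M] [Module Uq' M]

/-- `m` is annihilated by `D̂_♦ - q^d`, `D̂_1 - q^{d₁}`, `B₀ - [c;0]` and `Z - z`. -/
structure IsWt (d d₁ : ℤ) (c z : Cq) (m : M) : Prop where
  Dd : Dd • m = q ^ d • m
  D1 : D1 • m = q ^ d₁ • m
  B0 : B0 • m = qBr c 0 • m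
  Z : Z • m = z • m

theorem IsWt.neg_inv {d d₁ : ℤ} {c z : Cq} {m : M} (h : IsWt d d₁ c z m) :
    IsWt d d₁ (-c⁻¹) z m :=
  ⟨h.Dd, h.D1, by rw [h.B0, qBr_neg_inv, neg_zero], h.Z⟩

variable [IsScalarTower Cq Uq' M]

theorem smul_comm_uq' (x : Uq') (c : Cq) (m : M) : x • c • m = c • x • m := by
  rw [smul_comm]

theorem inv_smul_of_smul {x x' : Uq'} (h : x' * x = 1) {m : M} {c : Cq} (hc : c ≠ 0)
    (hx : x • m = c • m) : x' • m = c⁻¹ • m := by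
  have h1 : x' • x • m = m := by rw [smul_smul, h, one_smul]
  rw [hx, smul_comm_uq'] at h1
  rw [eq_inv_smul_iff₀ hc, h1]

theorem smul_smul_of_mul_eq {x y : Uq'} {m : M} {c c' : Cq} (h : x * y = c • (y * x))
    (hx : x • m = c' • m) : x • y • m = (c * c') • y • m := by
  rw [smul_smul, h, smul_assoc, mul_smul, hx, smul_comm_uq', smul_smul]

namespace IsWt

variable {d d₁ : ℤ} {c z : Cq} {m : M}

theorem DdInv_smul (h : IsWt d d₁ c z m) : DdInv • m = (q ^ d)⁻¹ • m :=
  inv_smul_of_smul DdInv_mul_Dd (q_zpow_ne_zero d) h.Dd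

theorem D1Inv_smul (h : IsWt d d₁ c z m) : D1Inv • m = (q ^ d₁)⁻¹ • m :=
  inv_smul_of_smul D1Inv_mul_D1 (q_zpow_ne_zero d₁) h.D1

theorem Kh_smul (h : IsWt d d₁ c z m) : Kh • m = q ^ (d - d₁) • m := by
  rw [Kh, mul_smul, h.D1Inv_smul, smul_comm_uq', h.Dd, smul_smul, zpow_sub₀ q_ne_zero, mul_comm,
    div_eq_mul_inv]

theorem KhInv_smul (h : IsWt d d₁ c z m) : KhInv • m = (q ^ (d - d₁))⁻¹ • m := by
  rw [KhInv, mul_smul, h.D1, smul_comm_uq', h.DdInv_smul, smul_smul, zpow_sub₀ q_ne_zero, inv_div,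
    div_eq_mul_inv]

theorem const_smul (h : IsWt d d₁ c z m) (a : Cq) : IsWt d d₁ c z (a • m) :=
  ⟨by rw [smul_comm_uq', h.Dd, smul_comm], by rw [smul_comm_uq', h.D1, smul_comm],
    by rw [smul_comm_uq', h.B0, smul_comm], by rw [smul_comm_uq', h.Z, smul_comm]⟩

theorem smul_Fminus (h : IsWt d d₁ c z m) (hc : c ≠ 0) :
    IsWt (d - 1) (d₁ + 1) (q * c) (q * z - (q ^ 2 + 1) * (q ^ (d - d₁))⁻¹ * c) (Fminus c • m) := by
  have hB0 := h.B0
  rw [qBr_zero] at hB0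
  have hY1 : QSP.Dd * QSP.Y = q ^ (-1 : ℤ) • (QSP.Y * QSP.Dd) := by
    simp only [QSP.Y, qComm, mul_sub, sub_mul, mul_smul_comm, smul_mul_assoc, ← mul_assoc,
      Dd_mul_B0, Dd_mul_Bm1]
    simp only [mul_assoc, Dd_mul_B0, Dd_mul_Bm1, mul_smul_comm, smul_sub]
    congr 1
    rw [smul_comm]
  have hY2 : QSP.D1 * QSP.Y = q ^ (1 : ℤ) • (QSP.Y * QSP.D1) := by
    simp only [QSP.Y, qComm, mul_sub, sub_mul, mul_smul_comm, smul_mul_assoc, ← mul_assoc,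
      D1_mul_B0, D1_mul_Bm1]
    simp only [mul_assoc, D1_mul_B0, D1_mul_Bm1, mul_smul_comm, smul_sub]
    congr 1
    rw [smul_comm]
  refine ⟨?_, ?_, ?_, ?_⟩
  · rw [smul_smul_of_mul_eq (c := q ^ (-1 : ℤ)) _ h.Dd, ← zpow_add₀ q_ne_zero,
      sub_eq_neg_add]
    rw [Fminus, mul_add, add_mul, mul_smul_comm, Dd_mul_Bm1, hY1, smul_add, smul_mul_assoc,
      smul_comm c]
  · rw [smul_smul_of_mul_eq (c := q ^ (1 : ℤ)) _ h.D1, ← zpow_add₀ q_ne_zero, add_comm]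
    rw [Fminus, mul_add, add_mul, mul_smul_comm, D1_mul_Bm1, hY2, smul_add, smul_mul_assoc,
      smul_comm c]
  · rw [qBr_zero]
    exact coidealRelations.B₀_lower q_ne_zero q_sq_sub_one_ne_zero hc hB0
  · exact coidealRelations.Z_lower q_ne_zero q_sq_sub_one_ne_zero q_sq_add_one_ne_zero hc hB0
      h.KhInv_smul h.Z

/-- One lowering step changes the Z-weight by z ↦ qz - (q² + 1)k⁻¹c, where k becomes q⁻²k and c
becomes qc. The closed form is the resulting geometric sum in q². -/
theorem smul_FminusPow (h : IsWt d d₁ c z m) (hc : c ≠ 0) (b : ℕ) :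
    IsWt (d - b) (d₁ + b) (q ^ (b : ℤ) * c) (q ^ b * z - (q ^ 2 + 1) * (q ^ (d - d₁))⁻¹ * c *
      (q ^ b * q⁻¹) * ((q ^ b) ^ 2 - 1) / (q ^ 2 - 1)) (FminusPow c b • m) := by
  induction b with
  | zero => simpa [FminusPow] using h
  | succ b ih =>
    have h1 := ih.smul_Fminus (mul_ne_zero (q_zpow_ne_zero b) hc)
    rw [FminusPow, mul_smul]
    convert h1 using 1
    · push_cast; ring
    · push_cast; ring
    · push_cast; rw [zpow_add₀ q_ne_zero]; simp; ring
    · have e : q ^ (d - b - (d₁ + b)) = q ^ (d - d₁) * ((q ^ b) ^ 2)⁻¹ := by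
        rw [show d - b - (d₁ + b) = (d - d₁) + -((b * 2 : ℕ) : ℤ) by push_cast; ring,
          zpow_add₀ q_ne_zero, zpow_neg, zpow_natCast, pow_mul]
      have h2 := q_sq_sub_one_ne_zero
      have h3 := q_ne_zero
      have h4 : q ^ b ≠ 0 := pow_ne_zero _ h3
      have h5 := q_zpow_ne_zero (d - d₁)
      rw [e, zpow_natCast, pow_succ]
      generalize q ^ b = Q at *
      generalize q ^ (d - d₁) = k at *
      field_simp
      ring

end IsWt

end

/-! ### Raising coefficients along F_-^b v. -/

section

/-- The coefficient of `F_-^{b-1} v` in the raising of `F_-^b v`, as a function of `Q = q ^ b` and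
`k = q ^ κ`. -/
def raiseCoeff {𝕜 : Type*} [Field 𝕜] (q k μ ζ Q : 𝕜) : 𝕜 :=
  (Q ^ 2 * μ ^ 2 + 1) * (Q ^ 2)⁻¹ * (μ ^ 2)⁻¹ * ((Q - Q⁻¹) / (q - q⁻¹)) *
    ((k * q * Q⁻¹ - k⁻¹ * Q * q⁻¹) / (q - q⁻¹) + Q * q⁻¹ * ζ * μ
      - Q ^ 2 * (q ^ 2)⁻¹ * k⁻¹ * μ ^ 2 * ((Q * q⁻¹ - Q⁻¹ * q) / (q - q⁻¹)))

/-- The right-hand side is what `smul_Eop_Fminus'` produces at F_-^b v: c = Qμ, K̂ acts by kQ⁻², and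
the bracket multiplying Qμ is the Z-weight from `smul_FminusPow`. -/
theorem raiseCoeff_succ {𝕜 : Type*} [Field 𝕜] {q k μ ζ Q : 𝕜} (h0 : q ≠ 0) (h1 : q ^ 2 - 1 ≠ 0)
    (hk : k ≠ 0) (hμ : μ ≠ 0) (hQ : Q ≠ 0) (hc : (Q * μ) ^ 2 + 1 ≠ 0) :
    raiseCoeff q k μ ζ (Q * q) =
      ((Q * μ) ^ 2 + (q ^ 2)⁻¹) / ((Q * μ) ^ 2 + 1) * raiseCoeff q k μ ζ Q
      + (1 + (q ^ 2)⁻¹ * ((Q * μ) ^ 2)⁻¹) * ((k * (Q ^ 2)⁻¹ - (k * (Q ^ 2)⁻¹)⁻¹) / (q - q⁻¹)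
        + (Q * ζ - (q ^ 2 + 1) * k⁻¹ * μ * (Q * q⁻¹) * (Q ^ 2 - 1) / (q ^ 2 - 1)) * (Q * μ)) := by
  have h3 : q - q⁻¹ ≠ 0 := by
    intro h3; apply h1; linear_combination q * h3 + mul_inv_cancel₀ h0
  have hc' : Q ^ 2 * μ ^ 2 + 1 ≠ 0 := by rwa [← mul_pow]
  rw [raiseCoeff, raiseCoeff]
  field_simp
  ring

/-- For `ζ = [μ;κ - 2 * i] - q^{-κ} [μ;0]` the coefficient factors; here `I = q ^ i`. -/
theorem raiseCoeff_eq {𝕜 : Type*} [Field 𝕜] {q k μ ζ Q I : 𝕜} (h0 : q ≠ 0) (h1 : q ^ 2 - 1 ≠ 0)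
    (hk : k ≠ 0) (hμ : μ ≠ 0) (hQ : Q ≠ 0) (hI : I ≠ 0)
    (hζ : ζ = (k * (I ^ 2)⁻¹ * μ - (k * (I ^ 2)⁻¹ * μ)⁻¹) / (q - q⁻¹)
      - k⁻¹ * ((μ - μ⁻¹) / (q - q⁻¹))) :
    raiseCoeff q k μ ζ Q = ((Q * μ) ^ 2 + 1) * (Q ^ 2)⁻¹ * (μ ^ 2)⁻¹ * ((Q - Q⁻¹) / (q - q⁻¹)) *
      (I * (((Q * q⁻¹ * I⁻¹) * μ) ^ 2 + 1) *
        ((k * I⁻¹ * Q⁻¹ * q - (k * I⁻¹ * Q⁻¹ * q)⁻¹) / (q - q⁻¹))) := by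
  have h3 : q - q⁻¹ ≠ 0 := by
    intro h3; apply h1; linear_combination q * h3 + mul_inv_cancel₀ h0
  rw [raiseCoeff, hζ]
  field_simp
  ring

/-- Vanishing of the coefficient determines `ζ`. -/
theorem eq_of_raiseCoeff_eq_zero {𝕜 : Type*} [Field 𝕜] {q k μ ζ Q : 𝕜} (h0 : q ≠ 0)
    (h1 : q ^ 2 - 1 ≠ 0) (hk : k ≠ 0) (hμ : μ ≠ 0) (hQ : Q ≠ 0) (hQ' : Q - Q⁻¹ ≠ 0)
    (hc : (Q * μ) ^ 2 + 1 ≠ 0) (h : raiseCoeff q k μ ζ Q = 0) :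
    ζ = (Q ^ 2 * (q ^ 2)⁻¹ * k⁻¹ * μ - (Q ^ 2 * (q ^ 2)⁻¹ * k⁻¹ * μ)⁻¹) / (q - q⁻¹)
      - k⁻¹ * ((μ - μ⁻¹) / (q - q⁻¹)) := by
  have h3 : q - q⁻¹ ≠ 0 := by
    intro h3; apply h1; linear_combination q * h3 + mul_inv_cancel₀ h0
  have hc' : Q ^ 2 * μ ^ 2 + 1 ≠ 0 := by rwa [← mul_pow]
  rw [raiseCoeff] at h
  have h4 : (Q ^ 2 * μ ^ 2 + 1) * (Q ^ 2)⁻¹ * (μ ^ 2)⁻¹ * ((Q - Q⁻¹) / (q - q⁻¹)) ≠ 0 := by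
    simp only [ne_eq, mul_eq_zero, div_eq_zero_iff, inv_eq_zero, pow_eq_zero_iff, not_or, hc', hQ, hμ, hQ', h3]
    simp [hQ, hμ]
  have h5 := (mul_eq_zero.1 h).resolve_left h4
  have h6 : ζ = (q * Q⁻¹ * μ⁻¹) * (Q ^ 2 * (q ^ 2)⁻¹ * k⁻¹ * μ ^ 2 *
      ((Q * q⁻¹ - Q⁻¹ * q) / (q - q⁻¹)) - (k * q * Q⁻¹ - k⁻¹ * Q * q⁻¹) / (q - q⁻¹)) := by
    have h7 : (q * Q⁻¹ * μ⁻¹) * (Q * q⁻¹ * ζ * μ) = ζ := by field_simp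
    linear_combination (q * Q⁻¹ * μ⁻¹) * h5 - h7
  rw [h6]
  field_simp
  ring

/-- The raising operator `B_1 + c X`. -/
def Eop (c : Cq) : Uq' := B1 + c • X

variable {M : Type*} [AddCommGroup M] [Module Cq M] [Module Uq' M]

/-- `v` satisfies the defining relations of the generator of `𝕄(d, d₁, [μ;0], ζ)`. -/
structure IsHW (d d₁ : ℤ) (μ ζ : Cq) (v : M) : Prop extends IsWt d d₁ μ ζ v where
  B1 : B1 • v = 0
  X : X • v = 0

variable {d d₁ : ℤ} {c z μ ζ : Cq} {m v : M}

theorem IsHW.neg_inv (h : IsHW d d₁ μ ζ v) : IsHW d d₁ (-μ⁻¹) ζ v :=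
  ⟨h.toIsWt.neg_inv, h.B1, h.X⟩

variable [IsScalarTower Cq Uq' M]

theorem IsWt.smul_Eop_Fminus (h : IsWt d d₁ c z m) (hc : c ≠ 0) :
    Eop (q * c) • Fminus c • m = Fminus (q * c) • Eop c • m := by
  have hB0 := h.B0
  rw [qBr_zero] at hB0
  exact coidealRelations.raise_lower q_ne_zero q_sq_sub_one_ne_zero q_sq_add_one_ne_zero hc hB0
    h.Kh_smul h.KhInv_smul h.Z

theorem IsWt.smul_Eop_Fminus' (h : IsWt d d₁ c z m) (hc : c ≠ 0) (hc' : c ^ 2 + 1 ≠ 0) :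
    Eop (-(q * c)⁻¹) • Fminus c • m =
      ((c ^ 2 + (q ^ 2)⁻¹) / (c ^ 2 + 1)) • Fminus (q⁻¹ * c) • Eop (-c⁻¹) • m
      + ((1 - (q ^ 2)⁻¹) / (c ^ 2 + 1)) • Fminus (-(q * c)⁻¹) • Eop c • m
      + ((1 + (q ^ 2)⁻¹ * (c ^ 2)⁻¹) *
          ((q ^ (d - d₁) - (q ^ (d - d₁))⁻¹) / (q - q⁻¹) + z * c)) • m := by
  have hB0 := h.B0
  rw [qBr_zero] at hB0
  exact coidealRelations.raise_lower' q_ne_zero q_sq_sub_one_ne_zero q_sq_add_one_ne_zero hc hc' hB0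
    h.Kh_smul h.KhInv_smul h.Z

/-- c² + 1 ≠ 0 means c ≠ -c⁻¹, so the two operators determine B_1 and X. -/
theorem B1_X_smul_eq_zero (hc : c ≠ 0) (hc' : c ^ 2 + 1 ≠ 0) (h1 : Eop c • m = 0)
    (h2 : Eop (-c⁻¹) • m = 0) : B1 • m = 0 ∧ X • m = 0 := by
  rw [Eop, add_smul, smul_assoc] at h1 h2
  have h3 : (c + c⁻¹) • X • m = 0 := by
    have : c • X • m - (-c⁻¹) • X • m = 0 := by
      rw [← add_sub_add_left_eq_sub _ _ (B1 • m), h1, h2, sub_zero]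
    rw [← sub_smul, sub_neg_eq_add] at this
    exact this
  have h4 : c + c⁻¹ ≠ 0 := by
    intro h; apply hc'; linear_combination c * h - mul_inv_cancel₀ hc
  have h5 := (smul_eq_zero_iff_right h4).1 h3
  rw [h5, smul_zero, add_zero] at h1
  exact ⟨h1, h5⟩

theorem q_zpow_succ_mul (b : ℕ) (c : Cq) :
    q ^ ((b + 1 : ℕ) : ℤ) * c = q * (q ^ (b : ℤ) * c) := by
  rw [Nat.cast_add, add_comm, zpow_add₀ q_ne_zero]; simp [mul_assoc]

namespace IsHW

theorem Eop_FminusPow (h : IsHW d d₁ μ ζ v) (hμ : μ ≠ 0) (b : ℕ) :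
    Eop (q ^ (b : ℤ) * μ) • FminusPow μ b • v = 0 := by
  induction b with
  | zero => simp [FminusPow, Eop, add_smul, smul_assoc, h.B1, h.X]
  | succ b ih =>
    rw [FminusPow, mul_smul, q_zpow_succ_mul,
      (h.toIsWt.smul_FminusPow hμ b).smul_Eop_Fminus (mul_ne_zero (q_zpow_ne_zero b) hμ), ih, smul_zero]

theorem Eop_FminusPow' (h : IsHW d d₁ μ ζ v) (hμ : IsGood μ) (b : ℕ) :
    Eop (-(q ^ ((b + 1 : ℕ) : ℤ) * μ)⁻¹) • FminusPow μ (b + 1) • v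
      = raiseCoeff q (q ^ (d - d₁)) μ ζ (q ^ (b + 1)) • FminusPow μ b • v := by
  have h0 := q_ne_zero
  have step (b : ℕ) (hx : Fminus (q⁻¹ * (q ^ (b : ℤ) * μ)) •
        Eop (-(q ^ (b : ℤ) * μ)⁻¹) • FminusPow μ b • v
        = raiseCoeff q (q ^ (d - d₁)) μ ζ (q ^ b) • FminusPow μ b • v) :
      Eop (-(q ^ ((b + 1 : ℕ) : ℤ) * μ)⁻¹) • FminusPow μ (b + 1) • v
        = raiseCoeff q (q ^ (d - d₁)) μ ζ (q ^ (b + 1)) • FminusPow μ b • v := by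
    have hc := mul_ne_zero (q_zpow_ne_zero b) hμ.1
    have e : q ^ (d - b - (d₁ + b)) = q ^ (d - d₁) * ((q ^ b) ^ 2)⁻¹ := by
      rw [show d - b - (d₁ + b) = (d - d₁) + -((b * 2 : ℕ) : ℤ) by push_cast; ring,
        zpow_add₀ q_ne_zero, zpow_neg, zpow_natCast, pow_mul]
    rw [q_zpow_succ_mul, FminusPow, mul_smul,
      (h.toIsWt.smul_FminusPow hμ.1 b).smul_Eop_Fminus' hc (hμ.sq_add_one_ne_zero b), hx,
      h.Eop_FminusPow hμ.1 b, smul_zero, smul_zero, add_zero, smul_smul, ← add_smul, e, pow_succ q b,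
      raiseCoeff_succ h0 q_sq_sub_one_ne_zero (q_zpow_ne_zero _) hμ.1 (pow_ne_zero b h0)
        (by simpa using hμ.sq_add_one_ne_zero b), zpow_natCast]
  induction b with
  | zero =>
    apply step
    -- At Q = q^0 = 1 the factor Q - Q⁻¹ of `raiseCoeff` vanishes, in agreement with B_1 v = X v =
    -- 0.
    simp [FminusPow, Eop, add_smul, smul_assoc, h.B1, h.X, raiseCoeff]
  | succ b ih =>
    apply step
    rw [ih, smul_comm_uq', FminusPow, mul_smul, q_zpow_succ_mul, inv_mul_cancel_left₀ h0]

end IsHW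

end

/-! ### The vectors F_+^a F_-^b v: separation and spanning. -/

section

variable {M : Type*} [AddCommGroup M] [Module Uq' M] {d d₁ : ℤ} {c z μ ζ : Cq} {m v : M}

theorem FFvec_eq (μ : Cq) (v : M) (a b : ℕ) :
    FFvec μ v a b = FminusPow (-(q ^ (b : ℤ) * μ)⁻¹) a • FminusPow μ b • v := by
  rw [FFvec, FplusPow_eq]

theorem Fminus_smul_FFvec (hμ : μ ≠ 0) (v : M) (a b : ℕ) :
    Fminus (q ^ ((b : ℤ) - a) * μ) • FFvec μ v a b = FFvec μ v a (b + 1) := by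
  have h := FplusPow_mul_Fminus (mul_ne_zero (q_zpow_ne_zero b) hμ) a
  rw [FFvec, FFvec, FminusPow, mul_smul, q_zpow_succ_mul, smul_smul (FplusPow _ _) (Fminus _), h,
    smul_smul, ← mul_assoc, ← zpow_add₀ q_ne_zero, neg_add_eq_sub]

theorem Fplus_smul_FFvec (μ : Cq) (v : M) (a b : ℕ) :
    Fplus (q ^ ((b : ℤ) - a) * μ) • FFvec μ v a b = FFvec μ v (a + 1) b := by
  rw [FFvec, FFvec, FplusPow, mul_smul, ← mul_assoc, ← zpow_add₀ q_ne_zero, neg_add_eq_sub]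

theorem FFvec_zero_zero (μ : Cq) (v : M) : FFvec μ v 0 0 = v := by
  simp [FFvec, FplusPow, FminusPow]

variable [Module Cq M]

/-- The span of the vectors `F_+^a F_-^b v`. -/
def lowerSpan (μ : Cq) (v : M) : Submodule Cq M :=
  Submodule.span Cq (Set.range fun p : ℕ × ℕ => FFvec μ v p.1 p.2)

theorem FFvec_mem_lowerSpan (μ : Cq) (v : M) (a b : ℕ) : FFvec μ v a b ∈ lowerSpan μ v :=
  Submodule.subset_span ⟨(a, b), rfl⟩

variable [IsScalarTower Cq Uq' M]

/-- Simultaneous eigenvectors with distinct eigenvalues can be separated by an operator. -/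
theorem exists_separating {ι : Type*} (w : ι → M) (y : ι)
    (h : ∀ x, x ≠ y → ∃ T : Uq', ∃ f : ι → Cq, (∀ z, T • w z = f z • w z) ∧ f x ≠ f y)
    (t : Finset ι) (hy : y ∉ t) :
    ∃ P : Uq', ∃ F : ι → Cq, (∀ z, P • w z = F z • w z) ∧ (∀ x ∈ t, F x = 0) ∧ F y ≠ 0 := by
  classical
  induction t using Finset.induction_on with
  | empty => exact ⟨1, fun _ => 1, by simp, by simp, one_ne_zero⟩
  | insert x t hx ih =>
    rw [Finset.mem_insert, not_or] at hy
    obtain ⟨P, F, h1, h2, h3⟩ := ih hy.2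
    obtain ⟨T, f, h4, h5⟩ := h x (Ne.symm hy.1)
    refine ⟨(T - algebraMap Cq Uq' (f x)) * P, fun z => (f z - f x) * F z, ?_, ?_, ?_⟩
    · intro z
      rw [mul_smul, h1, smul_comm_uq', sub_smul, h4, algebraMap_smul, ← sub_smul, smul_smul,
        mul_comm]
    · intro u hu
      rcases Finset.mem_insert.1 hu with rfl | hu
      · simp
      · simp [h2 u hu]
    · exact mul_ne_zero (sub_ne_zero.2 h5.symm) h3

/-- Nonzero simultaneous eigenvectors with distinct eigenvalues are linearly independent. -/
theorem linearIndependent_of_separating {ι : Type*} (w : ι → M) (hw : ∀ x, w x ≠ 0)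
    (h : ∀ y x, x ≠ y → ∃ T : Uq', ∃ f : ι → Cq, (∀ z, T • w z = f z • w z) ∧ f x ≠ f y) :
    LinearIndependent Cq w := by
  classical
  rw [linearIndependent_iff']
  intro s g hg y hy
  obtain ⟨P, F, h1, h2, h3⟩ := exists_separating w y (h y) (s.erase y) (Finset.notMem_erase y s)
  have h4 : P • ∑ x ∈ s, g x • w x = (g y * F y) • w y := by
    rw [Finset.smul_sum, Finset.sum_eq_single_of_mem y hy, smul_comm_uq', h1, smul_smul]
    intro x hx hxy
    rw [smul_comm_uq', h1, h2 x (Finset.mem_erase.2 ⟨hxy, hx⟩), zero_smul, smul_zero]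
  rw [hg, smul_zero] at h4
  have h5 := (smul_eq_zero.1 h4.symm).resolve_right (hw y)
  exact (mul_eq_zero.1 h5).resolve_right h3

/-- An element of the span of simultaneous eigenvectors whose coefficient at `y` is nonzero
generates a submodule containing the vector with index `y`. -/
theorem mem_of_sum_mem {ι : Type*} (w : ι → M) (y : ι)
    (h : ∀ x, x ≠ y → ∃ T : Uq', ∃ f : ι → Cq, (∀ z, T • w z = f z • w z) ∧ f x ≠ f y)
    (N : Submodule Uq' M) (g : ι →₀ Cq) (hg : (g.sum fun x a => a • w x) ∈ N) (hy : g y ≠ 0) :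
    w y ∈ N := by
  classical
  obtain ⟨P, F, h1, h2, h3⟩ :=
    exists_separating w y h (g.support.erase y) (Finset.notMem_erase y _)
  have h4 : P • (g.sum fun x a => a • w x) = (g y * F y) • w y := by
    rw [Finsupp.sum, Finset.smul_sum, Finset.sum_eq_single_of_mem y (by simpa using hy),
      smul_comm_uq', h1, smul_smul]
    intro x hx hxy
    rw [smul_comm_uq', h1, h2 x (Finset.mem_erase.2 ⟨hxy, hx⟩), zero_smul, smul_zero]
  have h5 : (g y * F y)⁻¹ • P • (g.sum fun x a => a • w x) = w y := by
    rw [h4, smul_smul, inv_mul_cancel₀ (mul_ne_zero hy h3), one_smul]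
  rw [← h5, ← algebraMap_smul Uq' (g y * F y)⁻¹]
  exact N.smul_mem _ (N.smul_mem _ hg)

theorem IsWt.smul_FFvec (h : IsWt d d₁ μ ζ v) (hμ : μ ≠ 0) (a b : ℕ) :
    ∃ z, IsWt (d - b - a) (d₁ + b + a) (q ^ ((b : ℤ) - a) * μ) z (FFvec μ v a b) := by
  have h1 := (h.smul_FminusPow hμ b).neg_inv.smul_FminusPow
    (neg_ne_zero.2 (inv_ne_zero (mul_ne_zero (q_zpow_ne_zero b) hμ))) a
  rw [← FFvec_eq] at h1
  have h2 := h1.neg_inv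
  have e : -(q ^ (a : ℤ) * -(q ^ (b : ℤ) * μ)⁻¹)⁻¹ = q ^ ((b : ℤ) - a) * μ := by
    have ha := q_zpow_ne_zero a
    have hb := q_zpow_ne_zero b
    have key {𝕜 : Type} [Field 𝕜] (x y z : 𝕜) : -(x * -(y * z)⁻¹)⁻¹ = y / x * z := by
      rw [mul_neg, inv_neg, neg_neg, mul_inv, inv_inv, div_eq_mul_inv]; ring
    rw [key, zpow_sub₀ q_ne_zero]
  rw [e] at h2
  exact ⟨_, h2⟩

/-- D̂_♦ detects a + b. If this sum is fixed, the values b - a all have the same parity, so the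
B_0-eigenvalues [μ; b - a] are distinct by goodness. -/
theorem FFvec_separating (h : IsWt d d₁ μ ζ v) (hμ : IsGood μ) (y x : ℕ × ℕ) (hxy : x ≠ y) :
    ∃ T : Uq', ∃ f : ℕ × ℕ → Cq, (∀ p, T • FFvec μ v p.1 p.2 = f p • FFvec μ v p.1 p.2) ∧
      f x ≠ f y := by
  by_cases hs : x.1 + x.2 = y.1 + y.2
  · refine ⟨B0, fun p => qBr μ (p.2 - p.1), fun p => ?_, fun he => hxy ?_⟩
    · obtain ⟨z, hz⟩ := h.smul_FFvec hμ.1 p.1 p.2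
      rw [hz.B0, ← qBr_eq μ]
    · have := hμ.qBr_inj (l := x.2 - y.1) (by omega) he
      ext <;> omega
  · refine ⟨Dd, fun p => q ^ (d - p.2 - p.1), fun p => ?_, fun he => hs ?_⟩
    · obtain ⟨z, hz⟩ := h.smul_FFvec hμ.1 p.1 p.2
      rw [hz.Dd]
    · have := q_zpow_inj he
      omega

theorem IsWt.isWeightVector (h : IsWt d d₁ c z m) (hm : m ≠ 0) : IsWeightVector m := by
  refine ⟨hm, fun u hu => ?_⟩
  refine Algebra.adjoin_induction (p := fun u _ => ∃ c : Cq, u • m = c • m) ?_ ?_ ?_ ?_ hu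
  · rintro x (rfl | rfl | rfl | rfl | rfl | rfl)
    exacts [⟨_, h.Dd⟩, ⟨_, h.DdInv_smul⟩, ⟨_, h.D1⟩, ⟨_, h.D1Inv_smul⟩, ⟨_, h.B0⟩, ⟨_, h.Z⟩]
  · exact fun a => ⟨a, algebraMap_smul _ _ _⟩
  · rintro x y - - ⟨a, ha⟩ ⟨b, hb⟩
    exact ⟨a + b, by rw [add_smul, ha, hb, add_smul]⟩
  · rintro x y - - ⟨a, ha⟩ ⟨b, hb⟩
    exact ⟨b * a, by rw [mul_smul, hb, smul_comm_uq', ha, smul_smul]⟩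

theorem smul_mem_lowerSpan_of {x : Uq'} (h : ∀ a b, x • FFvec μ v a b ∈ lowerSpan μ v)
    (hm : m ∈ lowerSpan μ v) : x • m ∈ lowerSpan μ v := by
  induction hm using Submodule.span_induction with
  | mem w hw => obtain ⟨p, rfl⟩ := hw; exact h p.1 p.2
  | zero => rw [smul_zero]; exact zero_mem _
  | add y z _ _ hy hz => rw [smul_add]; exact add_mem hy hz
  | smul a y _ hy => rw [smul_comm_uq']; exact Submodule.smul_mem _ a hy

/-- At the current parameter c, both F_-(c) and F_+(c) lead to vectors of the family. Their
difference is (c + c⁻¹)Y, and c + c⁻¹ is invertible by goodness. -/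
theorem Bm1_Y_smul_FFvec_mem (hμ : IsGood μ) (v : M) (a b : ℕ) :
    Bm1 • FFvec μ v a b ∈ lowerSpan μ v ∧ Y • FFvec μ v a b ∈ lowerSpan μ v := by
  have h1 := Fminus_smul_FFvec hμ.1 v a b
  have h2 := Fplus_smul_FFvec μ v a b
  set c := q ^ ((b : ℤ) - a) * μ with hc
  have hc0 : c ≠ 0 := mul_ne_zero (q_zpow_ne_zero _) hμ.1
  have h4 : c + c⁻¹ ≠ 0 := by
    intro h; apply hμ.sq_add_one_ne_zero (b - a); linear_combination c * h - mul_inv_cancel₀ hc0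
  rw [Fminus, add_smul, smul_assoc] at h1
  rw [Fplus, sub_smul, smul_assoc] at h2
  have hY : Y • FFvec μ v a b = (c + c⁻¹)⁻¹ • (FFvec μ v a (b + 1) - FFvec μ v (a + 1) b) := by
    rw [eq_inv_smul_iff₀ h4, ← h1, ← h2, add_smul]
    abel
  have hY' : Y • FFvec μ v a b ∈ lowerSpan μ v := by
    rw [hY]
    exact Submodule.smul_mem _ _ (sub_mem (FFvec_mem_lowerSpan _ _ _ _)
      (FFvec_mem_lowerSpan _ _ _ _))
  refine ⟨?_, hY'⟩
  rw [← eq_sub_iff_add_eq] at h1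
  rw [h1]
  exact sub_mem (FFvec_mem_lowerSpan _ _ _ _) (Submodule.smul_mem _ _ hY')

/-- It suffices to treat generators. The torus, B_0 and Z act diagonally on the spanning vectors,
B_{-1} and Y preserve the span by the previous lemma, and B_1 is moved to the right until it reaches
v. -/
theorem smul_mem_lowerSpan (h : IsHW d d₁ μ ζ v) (hμ : IsGood μ) (x : Uq')
    (hm : m ∈ lowerSpan μ v) : x • m ∈ lowerSpan μ v := by
  have diag {x : Uq'} (hx : ∀ {d d₁ c z} {m : M}, IsWt d d₁ c z m → ∃ a : Cq, x • m = a • m)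
      {m : M} : m ∈ lowerSpan μ v → x • m ∈ lowerSpan μ v := by
    refine smul_mem_lowerSpan_of fun a b => ?_
    obtain ⟨z, hz⟩ := h.toIsWt.smul_FFvec hμ.1 a b
    obtain ⟨a, ha⟩ := hx hz
    rw [ha]
    exact Submodule.smul_mem _ _ (FFvec_mem_lowerSpan _ _ _ _)
  have hDd {m : M} := diag (x := Dd) (m := m) fun h => ⟨_, h.Dd⟩
  have hD1 {m : M} := diag (x := D1) (m := m) fun h => ⟨_, h.D1⟩
  have hDdI {m : M} := diag (x := DdInv) (m := m) fun h => ⟨_, h.DdInv_smul⟩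
  have hD1I {m : M} := diag (x := D1Inv) (m := m) fun h => ⟨_, h.D1Inv_smul⟩
  have hKh {m : M} := diag (x := Kh) (m := m) fun h => ⟨_, h.Kh_smul⟩
  have hKhI {m : M} := diag (x := KhInv) (m := m) fun h => ⟨_, h.KhInv_smul⟩
  have hB0 {m : M} := diag (x := B0) (m := m) fun h => ⟨_, h.B0⟩
  have hZ {m : M} := diag (x := Z) (m := m) fun h => ⟨_, h.Z⟩
  have hBm {m : M} : m ∈ lowerSpan μ v → Bm1 • m ∈ lowerSpan μ v :=
    smul_mem_lowerSpan_of fun a b => (Bm1_Y_smul_FFvec_mem hμ v a b).1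
  have hY {m : M} : m ∈ lowerSpan μ v → Y • m ∈ lowerSpan μ v :=
    smul_mem_lowerSpan_of fun a b => (Bm1_Y_smul_FFvec_mem hμ v a b).2
  have hs (c : Cq) {m : M} (hm : m ∈ lowerSpan μ v) : c • m ∈ lowerSpan μ v :=
    Submodule.smul_mem _ c hm
  -- This property passes from m to F_-(c) m: moving B_1 or X past B_{-1} and Y creates only terms
  -- built from operators known to preserve the span and from B_1 m, X m.
  let Q (m : M) : Prop := m ∈ lowerSpan μ v ∧ B1 • m ∈ lowerSpan μ v ∧ X • m ∈ lowerSpan μ v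
  have R := coidealRelations
  have step (c : Cq) {m : M} (hm : Q m) : Q (Fminus c • m) := by
    obtain ⟨h1, h2, h3⟩ := hm
    have h4 : (Kh - KhInv) • m ∈ lowerSpan μ v := by rw [sub_smul]; exact sub_mem (hKh h1) (hKhI h1)
    refine ⟨?_, ?_, ?_⟩
    · rw [Fminus, add_smul, smul_assoc]
      exact add_mem (hBm h1) (hs c (hY h1))
    · rw [Fminus, add_smul, smul_assoc, smul_add, smul_comm_uq', smul_smul, R.B₁_Bₘ,
        smul_smul B1 Y, R.B₁_Y, add_smul, add_smul, smul_assoc, smul_assoc, mul_smul, mul_smul]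
      exact add_mem (add_mem (hBm h2) (hs _ h4)) (hs _ (add_mem (hZ h1) (hs _ (hY h2))))
    · rw [Fminus, add_smul, smul_assoc, smul_add, smul_comm_uq', smul_smul, R.X_Bₘ,
        smul_smul X Y, R.X_Y q_ne_zero q_sq_add_one_ne_zero]
      simp only [add_smul, sub_smul, smul_assoc, mul_smul]
      rw [sub_smul] at h4
      exact add_mem (sub_mem (add_mem (add_mem (hs _ (hBm h3)) (by rw [← sub_smul]; exact hs _ (hY h2)))
        (by rw [← sub_smul]; exact hs _ (hs _ (hB0 h4)))) (hs _ (hZ h1)))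
        (hs _ (sub_mem (hY h3) (hs _ (hs _ h4))))
  have steps (c : Cq) {m : M} (hm : Q m) (b : ℕ) : Q (FminusPow c b • m) := by
    induction b with
    | zero => simpa [FminusPow] using hm
    | succ b ih => rw [FminusPow, mul_smul]; exact step _ ih
  have hv : Q v := by
    refine ⟨?_, ?_, ?_⟩
    · simpa [FFvec, FplusPow, FminusPow] using FFvec_mem_lowerSpan μ v 0 0
    · rw [h.B1]; exact zero_mem _
    · rw [h.X]; exact zero_mem _
  have hFF (a b : ℕ) : Q (FFvec μ v a b) := by
    rw [FFvec_eq]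
    exact steps _ (steps _ hv _) _
  have hB1 {m : M} : m ∈ lowerSpan μ v → B1 • m ∈ lowerSpan μ v :=
    smul_mem_lowerSpan_of fun a b => (hFF a b).2.1
  suffices H : ∀ m : M, m ∈ lowerSpan μ v → x • m ∈ lowerSpan μ v from H m hm
  refine uq'_induction (P := fun x => ∀ m : M, m ∈ lowerSpan μ v → x • m ∈ lowerSpan μ v)
    (fun m => hB1) (fun m => hBm) (fun m => hB0) (fun m => hDd) (fun m => hDdI) (fun m => hD1)
    (fun m => hD1I) ?_ ?_ ?_ x
  · intro c m hm
    rw [algebraMap_smul]; exact hs c hm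
  · intro x y hx hy m hm
    rw [add_smul]; exact add_mem (hx m hm) (hy m hm)
  · intro x y hx hy m hm
    rw [mul_smul]; exact hx _ (hy m hm)

theorem lowerSpan_eq_top (h : IsHW d d₁ μ ζ v) (hμ : IsGood μ)
    (hv : ∀ m : M, ∃ x : Uq', m = x • v) : lowerSpan μ v = ⊤ := by
  rw [eq_top_iff]
  rintro m -
  obtain ⟨x, rfl⟩ := hv m
  refine smul_mem_lowerSpan h hμ x ?_
  simpa only [FFvec_zero_zero] using FFvec_mem_lowerSpan μ v 0 0

end

/-! ### Necessity of the condition on ζ, and the structure of irreducible quotients. -/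

section

theorem q_zpow_sub_inv_eq_zero_iff {n : ℤ} : q ^ n - (q ^ n)⁻¹ = 0 ↔ n = 0 := by
  constructor
  · intro h
    rw [sub_eq_zero, ← zpow_neg] at h
    have := q_zpow_inj h
    omega
  · rintro rfl; simp

theorem IsGood.zpow_mul {μ : Cq} (h : IsGood μ) (n : ℤ) : IsGood (q ^ n * μ) := by
  refine ⟨mul_ne_zero (q_zpow_ne_zero n) h.1, fun l => ?_⟩
  have e (x : Cq) : q ^ n * μ = q ^ l * x → μ = q ^ (l - n) * x := by
    intro h1
    rw [zpow_sub₀ q_ne_zero, div_mul_eq_mul_div, ← h1, mul_div_cancel_left₀ _ (q_zpow_ne_zero n)]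
  refine ⟨fun h1 => (h.2 (l - n)).1 (e _ h1), fun h1 => (h.2 (l - n)).2 ?_⟩
  rw [← mul_neg]
  exact e _ (by rw [h1, mul_neg])

/-- The weight `ζ` in the condition for a finite dimensional irreducible quotient. -/
def zetaOf (κ : ℤ) (μ : Cq) (i : ℤ) : Cq := qBr μ (κ - 2 * i) - q ^ (-κ) * qBr μ 0

/-- The symmetry c ↦ -c⁻¹ exchanges i and κ - i, as it must, since it exchanges the two sides of the
rectangle. -/
theorem zetaOf_neg_inv (κ : ℤ) (μ : Cq) (i : ℤ) : zetaOf κ (-μ⁻¹) (κ - i) = zetaOf κ μ i := by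
  rw [zetaOf, zetaOf, qBr_neg_inv, qBr_neg_inv, neg_zero]
  congr 2
  ring

/-- In the factorization `raiseCoeff_eq` goodness makes the factors of the form x² + 1 nonzero, and
q is not a root of unity; only the quantum integer [κ - i - b] can vanish. -/
theorem raiseCoeff_eq_zero_iff {μ : Cq} (hμ : IsGood μ) (κ i : ℤ) (b : ℕ) :
    raiseCoeff q (q ^ κ) μ (zetaOf κ μ i) (q ^ (b + 1)) = 0 ↔ (b : ℤ) = κ - i := by
  have hζ : zetaOf κ μ i = (q ^ κ * ((q ^ i) ^ 2)⁻¹ * μ - (q ^ κ * ((q ^ i) ^ 2)⁻¹ * μ)⁻¹) /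
      (q - q⁻¹) - (q ^ κ)⁻¹ * ((μ - μ⁻¹) / (q - q⁻¹)) := by
    have e : q ^ (κ - 2 * i) = q ^ κ * ((q ^ i) ^ 2)⁻¹ := by
      rw [zpow_sub₀ q_ne_zero, mul_comm 2 i, zpow_mul, div_eq_mul_inv]; rfl
    rw [zetaOf, qBr_eq, qBr_zero, qBr_zero, e, zpow_neg]
  have e1 : q ^ (b + 1) * q⁻¹ * (q ^ i)⁻¹ * μ = q ^ ((b : ℤ) - i) * μ := by
    rw [pow_succ, mul_inv_cancel_right₀ q_ne_zero, zpow_sub₀ q_ne_zero, div_eq_mul_inv,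
      zpow_natCast]
  have e2 : q ^ κ * (q ^ i)⁻¹ * (q ^ (b + 1))⁻¹ * q = q ^ (κ - i - b) := by
    rw [zpow_sub₀ q_ne_zero, zpow_sub₀ q_ne_zero, zpow_natCast, pow_succ, mul_inv, mul_assoc,
      mul_assoc _ q⁻¹, inv_mul_cancel₀ q_ne_zero, mul_one, div_eq_mul_inv, div_eq_mul_inv]
  rw [raiseCoeff_eq q_ne_zero q_sq_sub_one_ne_zero (q_zpow_ne_zero κ) hμ.1
    (pow_ne_zero _ q_ne_zero) (q_zpow_ne_zero i) hζ, e1, e2]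
  have h1 := hμ.sq_add_one_ne_zero (b + 1 : ℕ)
  rw [zpow_natCast] at h1
  have h2 : q ^ (b + 1) ≠ 0 := pow_ne_zero _ q_ne_zero
  have h3 : q ^ (b + 1) - (q ^ (b + 1))⁻¹ ≠ 0 := by
    rw [← zpow_natCast, Ne, q_zpow_sub_inv_eq_zero_iff]; omega
  have h4 := hμ.sq_add_one_ne_zero (b - i)
  have h5 := q_sub_inv_ne_zero
  have h6 := q_zpow_ne_zero i
  rw [mul_eq_zero, or_iff_right (mul_ne_zero (mul_ne_zero (mul_ne_zero h1
    (inv_ne_zero (pow_ne_zero 2 h2))) (inv_ne_zero (pow_ne_zero 2 hμ.1))) (div_ne_zero h3 h5)),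
    mul_eq_zero, or_iff_right (mul_ne_zero h6 h4), div_eq_zero_iff, or_iff_left h5,
    q_zpow_sub_inv_eq_zero_iff]
  omega

variable {M : Type*} [AddCommGroup M] [Module Uq' M] {d d₁ : ℤ} {c z μ ζ : Cq} {m v : M}

theorem exists_smul_eq_of_isSimpleModule [IsSimpleModule Uq' M] (hv : v ≠ 0) (m : M) :
    ∃ x : Uq', m = x • v := by
  obtain ⟨x, hx⟩ := IsSimpleModule.toSpanSingleton_surjective Uq' hv m
  exact ⟨x, hx.symm⟩

theorem FminusPow_smul_eq_zero_of_le {b b' : ℕ} (h : FminusPow μ b • v = 0) (hb : b ≤ b') :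
    FminusPow μ b' • v = 0 := by
  induction b', hb using Nat.le_induction with
  | base => exact h
  | succ n _ ih => rw [FminusPow, mul_smul, ih, smul_zero]

variable [Module Cq M] [IsScalarTower Cq Uq' M]

/-- Nonzero vectors F_-^b v have distinct D̂_♦-weights, so in finite dimension there is a first
vanishing one, F_-^{B+1} v. Raising it gives a multiple of F_-^B v ≠ 0; the coefficient must vanish,
which determines ζ. -/
theorem IsHW.exists_eq_zetaOf_nat [FiniteDimensional Cq M] (h : IsHW d d₁ μ ζ v) (hv : v ≠ 0)
    (hμ : IsGood μ) : ∃ B : ℕ, ζ = zetaOf (d - d₁) μ (d - d₁ - B) := by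
  classical
  have hex : ∃ b, FminusPow μ b • v = 0 := by
    by_contra hne
    push Not at hne
    have hli : LinearIndependent Cq (fun b : ℕ => FminusPow μ b • v) := by
      refine linearIndependent_of_separating _ hne fun y x hxy => ?_
      refine ⟨Dd, fun b => q ^ (d - b), fun b => (h.toIsWt.smul_FminusPow hμ.1 b).Dd, fun he => ?_⟩
      have := q_zpow_inj he
      omega
    have := hli.finite_of_isNoetherian
    exact not_finite ℕ
  have h0 : Nat.find hex ≠ 0 := by
    intro h1
    have h2 := Nat.find_spec hex
    rw [h1] at h2
    exact hv (by simpa [FminusPow] using h2)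
  obtain ⟨B, hB⟩ := Nat.exists_eq_succ_of_ne_zero h0
  have h1 := Nat.find_spec hex
  rw [hB] at h1
  have h2 := Nat.find_min hex (m := B) (by omega)
  have h3 := h.Eop_FminusPow' hμ B
  rw [h1, smul_zero] at h3
  have h4 := (smul_eq_zero.1 h3.symm).resolve_right h2
  refine ⟨B, ?_⟩
  have hζ := eq_of_raiseCoeff_eq_zero q_ne_zero q_sq_sub_one_ne_zero (q_zpow_ne_zero (d - d₁)) hμ.1
    (pow_ne_zero _ q_ne_zero) (by rw [← zpow_natCast, Ne, q_zpow_sub_inv_eq_zero_iff]; omega)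
    (by simpa only [zpow_natCast] using hμ.sq_add_one_ne_zero (B + 1 : ℕ)) h4
  have e : (q ^ (B + 1)) ^ 2 * (q ^ 2)⁻¹ * (q ^ (d - d₁))⁻¹
      = q ^ ((d - d₁) - 2 * ((d - d₁) - B)) := by
    generalize d - d₁ = κ
    rw [show κ - 2 * (κ - B) = ((B * 2 : ℕ) : ℤ) - κ by push_cast; ring,
      zpow_sub₀ q_ne_zero _ κ, zpow_natCast, pow_mul, pow_succ q B, mul_pow,
      mul_inv_cancel_right₀ (pow_ne_zero _ q_ne_zero), div_eq_mul_inv]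
  rw [hζ, zetaOf, qBr_eq, qBr_zero, qBr_zero, e, zpow_neg]

/-- The weights of a highest weight vector in a finite dimensional module. -/
theorem IsHW.exists_eq_zetaOf [FiniteDimensional Cq M] (h : IsHW d d₁ μ ζ v) (hv : v ≠ 0)
    (hμ : IsGood μ) : ∃ i : ℕ, (i : ℤ) ≤ d - d₁ ∧ ζ = zetaOf (d - d₁) μ i := by
  obtain ⟨B, hB⟩ := h.exists_eq_zetaOf_nat hv hμ
  -- The same argument for -μ⁻¹, that is, for F_+. Comparing the two formulas for ζ gives A = κ - B,
  -- hence both bounds on i = A.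
  obtain ⟨A, hA⟩ := h.neg_inv.exists_eq_zetaOf_nat hv hμ.neg_inv
  rw [zetaOf_neg_inv] at hA
  have h1 : qBr μ (d - d₁ - 2 * (d - d₁ - B)) = qBr μ (d - d₁ - 2 * A) := by
    have := hB.symm.trans hA
    rw [zetaOf, zetaOf] at this
    exact sub_left_injective this
  have h2 := hμ.qBr_inj (l := B - A) (by ring) h1
  exact ⟨A, by omega, hA⟩

/-- A `T`-eigenvector in the span of eigenvectors with other eigenvalues is isolated by adjoining it
to the family and separating it from the rest. -/
theorem eq_zero_of_mem_span {ι : Type*} {w : ι → M} {T : Uq'} {a : Cq} {f : ι → Cq}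
    (hv : T • v = a • v) (hw : ∀ x, T • w x = f x • w x) (hf : ∀ x, f x ≠ a)
    (h : v ∈ Submodule.span Cq (Set.range w)) : v = 0 := by
  classical
  obtain ⟨g, hg⟩ := (Finsupp.mem_span_range_iff_exists_finsupp).1 h
  obtain ⟨P, F, h1, h2, h3⟩ := exists_separating (fun x : Option ι => x.elim v w) none
    (fun x hx => ⟨T, fun x => x.elim a f, by rintro (_ | x) <;> simp [hv, hw], by
      obtain ⟨y, rfl⟩ := Option.ne_none_iff_exists'.1 hx
      exact hf y⟩) (g.support.map Function.Embedding.some) (by simp)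
  have h4 : P • v = F none • v := h1 none
  have h5 : P • v = 0 := by
    rw [← hg, Finsupp.sum, Finset.smul_sum]
    refine Finset.sum_eq_zero fun x hx => ?_
    have h6 : P • w x = F (some x) • w x := h1 (some x)
    rw [smul_comm_uq', h6, h2 _ (by simpa using hx), zero_smul, smul_zero]
  rw [h5] at h4
  exact (smul_eq_zero.1 h4.symm).resolve_left h3

/-- In an irreducible module the singular vector `F_-^{κ-i+1} v` vanishes. -/
theorem IsHW.FminusPow_smul_eq_zero [IsSimpleModule Uq' M] {i : ℤ}
    (h : IsHW d d₁ μ (zetaOf (d - d₁) μ i) v) (hv : v ≠ 0) (hμ : IsGood μ) {B : ℕ}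
    (hB : (B : ℤ) = d - d₁ - i) : FminusPow μ (B + 1) • v = 0 := by
  by_contra hu
  have hc := (hμ.zpow_mul (B + 1 : ℕ))
  have h1 := h.Eop_FminusPow hμ.1 (B + 1)
  have h2 := h.Eop_FminusPow' hμ B
  rw [(raiseCoeff_eq_zero_iff hμ _ i B).2 hB, zero_smul] at h2
  -- Both raising combinations kill F_-^{B+1} v, so it is again a highest weight vector.
  obtain ⟨h3, h4⟩ := B1_X_smul_eq_zero hc.1 (hμ.sq_add_one_ne_zero _) h1 h2
  have h5 : IsHW _ _ _ _ (FminusPow μ (B + 1) • v) :=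
    ⟨h.toIsWt.smul_FminusPow hμ.1 (B + 1), h3, h4⟩
  -- By irreducibility its lowerings span the module. Their D̂_♦-exponents are at most d - (B + 1),
  -- so v, of exponent d, cannot lie in the span unless it is zero.
  have h6 := lowerSpan_eq_top h5 hc (exists_smul_eq_of_isSimpleModule hu)
  refine hv (eq_zero_of_mem_span (w := fun p : ℕ × ℕ => FFvec (q ^ ((B + 1 : ℕ) : ℤ) * μ)
    (FminusPow μ (B + 1) • v) p.1 p.2) (T := Dd) (f := fun p => q ^ (d - (B + 1 : ℕ) - p.2 - p.1))
    h.Dd (fun p => ?_) (fun p he => ?_) (by change v ∈ lowerSpan _ _; rw [h6]; trivial))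
  · obtain ⟨z, hz⟩ := h5.toIsWt.smul_FFvec hc.1 p.1 p.2
    exact hz.Dd
  · have := q_zpow_inj he
    push_cast at this
    omega

/-- The raising operator passes through each F_+ without a remainder, by `smul_Eop_Fminus` at the
parameter -c⁻¹. Hence the coefficient does not depend on a. -/
theorem IsHW.Eop_FFvec (h : IsHW d d₁ μ ζ v) (hμ : IsGood μ) (a b : ℕ) :
    Eop (-(q ^ (((b + 1 : ℕ) : ℤ) - a) * μ)⁻¹) • FFvec μ v a (b + 1)
      = raiseCoeff q (q ^ (d - d₁)) μ ζ (q ^ (b + 1)) • FFvec μ v a b := by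
  induction a with
  | zero => simpa [FFvec, FplusPow] using h.Eop_FminusPow' hμ b
  | succ a ih =>
    obtain ⟨z, hz⟩ := h.toIsWt.smul_FFvec hμ.1 a (b + 1)
    have hη : q ^ (((b + 1 : ℕ) : ℤ) - a) * μ ≠ 0 := mul_ne_zero (q_zpow_ne_zero _) hμ.1
    have e : q ^ (((b + 1 : ℕ) : ℤ) - a) * μ = q * (q ^ ((b : ℤ) - a) * μ) := by
      rw [show ((b + 1 : ℕ) : ℤ) - a = 1 + (b - a) by push_cast; ring, zpow_add₀ q_ne_zero,
        zpow_one, mul_assoc]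
    have e2 : -(q ^ ((b : ℤ) - a) * μ)⁻¹ = q * -(q ^ (((b + 1 : ℕ) : ℤ) - a) * μ)⁻¹ := by
      rw [e, mul_inv q, mul_neg, mul_inv_cancel_left₀ q_ne_zero]
    rw [← Fplus_smul_FFvec μ v a (b + 1), ← Fplus_smul_FFvec μ v a b, Fplus_eq, Fplus_eq,
      show ((b + 1 : ℕ) : ℤ) - (a + 1 : ℕ) = b - a by push_cast; ring, e2,
      hz.neg_inv.smul_Eop_Fminus (neg_ne_zero.2 (inv_ne_zero hη)), ih, smul_comm_uq']

theorem IsHW.FminusPow_smul_ne_zero {i : ℤ} (h : IsHW d d₁ μ (zetaOf (d - d₁) μ i) v) (hv : v ≠ 0)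
    (hμ : IsGood μ) {b : ℕ} (hb : (b : ℤ) ≤ d - d₁ - i) : FminusPow μ b • v ≠ 0 := by
  induction b with
  | zero => simpa [FminusPow] using hv
  | succ b ih =>
    intro h1
    have h2 := h.Eop_FminusPow' hμ b
    rw [h1, smul_zero] at h2
    rcases smul_eq_zero.1 h2.symm with h3 | h3
    · rw [raiseCoeff_eq_zero_iff hμ] at h3
      push_cast at hb
      omega
    · exact ih (by push_cast at hb; omega) h3

/-- The edge b = 0 is the case of F_-^a for -μ⁻¹. From there on, raising F_+^a F_-^{b+1} v gives a
nonzero multiple of F_+^a F_-^b v. -/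
theorem IsHW.FFvec_ne_zero {i : ℕ} (h : IsHW d d₁ μ (zetaOf (d - d₁) μ i) v) (hv : v ≠ 0)
    (hμ : IsGood μ) {a b : ℕ} (ha : a ≤ i) (hb : (b : ℤ) ≤ d - d₁ - i) : FFvec μ v a b ≠ 0 := by
  induction b with
  | zero =>
    have h1 := h.neg_inv
    rw [← zetaOf_neg_inv] at h1
    have h2 := h1.FminusPow_smul_ne_zero hv hμ.neg_inv (b := a) (by omega)
    rw [← FplusPow_eq] at h2
    simpa [FFvec, FminusPow] using h2
  | succ b ih =>
    intro h1
    have h2 := h.Eop_FFvec hμ a b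
    rw [h1, smul_zero] at h2
    rcases smul_eq_zero.1 h2.symm with h3 | h3
    · rw [raiseCoeff_eq_zero_iff hμ] at h3
      push_cast at hb
      omega
    · exact ih (by push_cast at hb; omega) h3

/-- In an irreducible module, `F_+^a F_-^b v = 0` outside the rectangle. -/
theorem IsHW.FFvec_eq_zero [IsSimpleModule Uq' M] {i : ℕ}
    (h : IsHW d d₁ μ (zetaOf (d - d₁) μ i) v) (hv : v ≠ 0) (hμ : IsGood μ)
    (hi : (i : ℤ) ≤ d - d₁) {a b : ℕ} (hab : ¬ (a ≤ i ∧ (b : ℤ) ≤ d - d₁ - i)) :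
    FFvec μ v a b = 0 := by
  by_cases ha : a ≤ i
  · obtain ⟨B, hB⟩ := Int.eq_ofNat_of_zero_le (a := d - d₁ - i) (by omega)
    have h1 := FminusPow_smul_eq_zero_of_le (b' := b) (h.FminusPow_smul_eq_zero hv hμ hB.symm)
      (by have := fun hb => hab ⟨ha, hb⟩; omega)
    rw [FFvec, h1, smul_zero]
  · have h1 := h.neg_inv
    rw [← zetaOf_neg_inv] at h1
    have h2 := FminusPow_smul_eq_zero_of_le (b' := a)
      (h1.FminusPow_smul_eq_zero hv hμ.neg_inv (B := i) (by ring)) (by omega)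
    rw [← FplusPow_eq] at h2
    -- Interchanging the two powers lets F_+^a act on v first, where it gives zero.
    rw [FFvec, smul_smul, FplusPow_mul_FminusPow hμ.1, mul_smul, h2, smul_zero]

theorem IsHW.isWeightBasis [IsSimpleModule Uq' M] {i : ℕ}
    (h : IsHW d d₁ μ (zetaOf (d - d₁) μ i) v) (hv : v ≠ 0) (hμ : IsGood μ)
    (hi : (i : ℤ) ≤ d - d₁) :
    IsWeightBasis fun p : {p : ℕ × ℕ // p.1 ≤ i ∧ (p.2 : ℤ) ≤ d - d₁ - i} =>
      FFvec μ v p.1.1 p.1.2 := by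
  refine ⟨?_, ?_, fun p => ?_⟩
  · refine linearIndependent_of_separating _ (fun p => h.FFvec_ne_zero hv hμ p.2.1 p.2.2)
      fun y x hxy => ?_
    obtain ⟨T, f, h1, h2⟩ := FFvec_separating h.toIsWt hμ y.1 x.1 (fun he => hxy (Subtype.ext he))
    exact ⟨T, fun p => f p.1, fun p => h1 p.1, h2⟩
  · rw [eq_top_iff, ← lowerSpan_eq_top h hμ (exists_smul_eq_of_isSimpleModule hv), lowerSpan,
      Submodule.span_le]
    rintro _ ⟨p, rfl⟩
    by_cases hp : p.1 ≤ i ∧ (p.2 : ℤ) ≤ d - d₁ - i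
    · exact Submodule.subset_span ⟨⟨p, hp⟩, rfl⟩
    · change FFvec μ v p.1 p.2 ∈ _
      rw [h.FFvec_eq_zero hv hμ hi hp]
      exact zero_mem _
  · obtain ⟨z, hz⟩ := h.toIsWt.smul_FFvec hμ.1 p.1.1 p.1.2
    exact hz.isWeightVector (h.FFvec_ne_zero hv hμ p.2.1 p.2.2)

/-- A module generated by a highest weight vector has at most one maximal submodule. -/
theorem IsHW.maximal_unique (h : IsHW d d₁ μ ζ v) (hμ : IsGood μ)
    (hv : ∀ m : M, ∃ x : Uq', m = x • v) {N₁ N₂ : Submodule Uq' M} (h₁ : IsCoatom N₁)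
    (h₂ : IsCoatom N₂) : N₁ = N₂ := by
  have hsep := FFvec_separating h.toIsWt hμ (0, 0)
  have hmem (N : Submodule Uq' M) (hN : N ≠ ⊤) : v ∉ N := fun hvN => hN <| by
    rw [eq_top_iff]
    rintro m -
    obtain ⟨x, rfl⟩ := hv m
    exact N.smul_mem x hvN
  -- This holds for every expression of an element of N in the spanning family; linear independence
  -- of the family is not needed.
  have key (N : Submodule Uq' M) (hN : N ≠ ⊤) (g : ℕ × ℕ →₀ Cq)
      (hg : (g.sum fun x a => a • FFvec μ v x.1 x.2) ∈ N) : g (0, 0) = 0 := by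
    by_contra h0
    have := mem_of_sum_mem (fun p : ℕ × ℕ => FFvec μ v p.1 p.2) (0, 0) hsep N g hg h0
    rw [FFvec_zero_zero] at this
    exact hmem N hN this
  have hrep (m : M) : ∃ g : ℕ × ℕ →₀ Cq, (g.sum fun x a => a • FFvec μ v x.1 x.2) = m := by
    refine (Finsupp.mem_span_range_iff_exists_finsupp).1 ?_
    change m ∈ lowerSpan μ v
    rw [lowerSpan_eq_top h hμ hv]
    trivial
  by_contra hne
  have hsup : N₁ ⊔ N₂ = ⊤ := h₁.2 _ (left_lt_sup.2 fun hle =>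
    hne (((h₂.le_iff.1 hle).resolve_left h₁.1)))
  obtain ⟨n₁, hn₁, n₂, hn₂, hsum⟩ := Submodule.mem_sup.1 (hsup ▸ Submodule.mem_top : v ∈ N₁ ⊔ N₂)
  obtain ⟨g₁, rfl⟩ := hrep n₁
  obtain ⟨g₂, rfl⟩ := hrep n₂
  have e₁ := key _ h₁.1 g₁ hn₁
  have e₂ := key _ h₂.1 g₂ hn₂
  -- The combination g₁ + g₂ - δ represents n₁ + n₂ - v = 0, so its coefficient at (0, 0) must
  -- vanish, but that coefficient is -1.
  have h3 : (g₁ + g₂ - Finsupp.single (0, 0) 1 : ℕ × ℕ →₀ Cq) (0, 0) = 0 := by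
    refine key N₁ h₁.1 _ ?_
    rw [Finsupp.sum_sub_index (by intros; exact sub_smul _ _ _),
      Finsupp.sum_add_index' (by simp) (by intros; exact add_smul _ _ _), hsum,
      Finsupp.sum_single_index (by simp), one_smul, FFvec_zero_zero, sub_self]
    exact zero_mem _
  simp [e₁, e₂] at h3

end

/-! ### The coproduct, through pairs of commuting homomorphisms. -/

section TensorSerre

variable {𝕜 : Type*} [Field 𝕜] {R : Type*} [Ring R] [Algebra 𝕜 R] {q : 𝕜} {a b a' b' : R}

/-- The Serre relation for the sum of two `q`-commuting solutions. -/
theorem serre_add (h0 : q ≠ 0) (h1 : b * a = q ^ 2 • (a * b))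
    (h3 : b * a' = q⁻¹ • (a' * b)) (h4 : b' * a = q⁻¹ • (a * b'))
    (ha : a * (a * a') - (q + q⁻¹) • (a * (a' * a)) + a' * (a * a) = 0)
    (hb : b * (b * b') - (q + q⁻¹) • (b * (b' * b)) + b' * (b * b) = 0) :
    (a + b) * ((a + b) * (a' + b')) - (q + q⁻¹) • ((a + b) * ((a' + b') * (a + b)))
      + (a' + b') * ((a + b) * (a + b)) = 0 := by
  have S {x y : R} {z : R} (c : R) (hxy : x * y = z) : x * (y * c) = z * c := by
    rw [← mul_assoc, hxy]
  simp only [mul_add, add_mul, mul_assoc, smul_mul_assoc, mul_smul_comm, smul_smul, smul_add,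
    h1, h3, h4, S _ h1, S _ h3, S _ h4]
  linear_combination (norm := skip) ha + hb
  match_scalars <;> field_simp <;> ring

end TensorSerre

namespace UqGL

theorem algHom_serre_E {R : Type*} [Ring R] [Algebra Cq R] (φ : UqGL →ₐ[Cq] R) {i j : Fin 3}
    (h : Adjacent i j) : φ (E i) * (φ (E i) * φ (E j)) - (q + q⁻¹) • (φ (E i) * (φ (E j) * φ (E i)))
      + φ (E j) * (φ (E i) * φ (E i)) = 0 := by
  simpa only [map_add, map_sub, map_smul, map_mul, map_zero] using congrArg φ (E_serre h)

theorem algHom_serre_F {R : Type*} [Ring R] [Algebra Cq R] (φ : UqGL →ₐ[Cq] R) {i j : Fin 3}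
    (h : Adjacent i j) : φ (F i) * (φ (F i) * φ (F j)) - (q + q⁻¹) • (φ (F i) * (φ (F j) * φ (F i)))
      + φ (F j) * (φ (F i) * φ (F i)) = 0 := by
  simpa only [map_add, map_sub, map_smul, map_mul, map_zero] using congrArg φ (F_serre h)

theorem D_K_comm (j : Fin 4) (i : Fin 3) : D j * K i = K i * D j :=
  Commute.mul_right (D_comm j _) (D_Dinv_comm i.succ j).symm

/-- The values of the tensor product of two commuting homomorphisms on generators, given by the
coproduct `E ↦ E ⊗ 1 + K ⊗ E`, `F ↦ 1 ⊗ F + F ⊗ K⁻¹`, `D ↦ D ⊗ D`. -/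
def tensorGen {R : Type*} [Ring R] [Algebra Cq R] (φ ψ : UqGL →ₐ[Cq] R) : Gen → R
  | .E i => φ (E i) + φ (K i) * ψ (E i)
  | .F i => ψ (F i) + φ (F i) * ψ (Kinv i)
  | .D j => φ (D j) * ψ (D j)
  | .Dinv j => φ (Dinv j) * ψ (Dinv j)

variable {R : Type*} [Ring R] [Algebra Cq R]

theorem tensorGen_rel (φ ψ : UqGL →ₐ[Cq] R) (hc : ∀ x y, ψ y * φ x = φ x * ψ y)
    {x y : FreeAlgebra Cq Gen} (h : GLRel x y) :
    FreeAlgebra.lift Cq (tensorGen φ ψ) x = FreeAlgebra.lift Cq (tensorGen φ ψ) y := by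
  have hc' (x y : UqGL) (z : R) : ψ y * (φ x * z) = φ x * (ψ y * z) := by
    rw [← mul_assoc, hc, mul_assoc]
  have S {x y z : R} (c : R) (hxy : x * y = z) : x * (y * c) = z * c := by rw [← mul_assoc, hxy]
  have hm (χ : UqGL →ₐ[Cq] R) {x y : UqGL} {a : Cq} (h : x * y = a • (y * x)) :
      χ x * χ y = a • (χ y * χ x) := by rw [← map_mul, h, map_smul, map_mul]
  have hK (i : Fin 3) : FreeAlgebra.lift Cq (tensorGen φ ψ) (Gen.K i) = φ (K i) * ψ (K i) := by
    simp only [map_mul, FreeAlgebra.lift_ι_apply, tensorGen, K, mul_assoc, hc', hc]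
  have hKinv (i : Fin 3) :
      FreeAlgebra.lift Cq (tensorGen φ ψ) (Gen.Kinv i) = φ (Kinv i) * ψ (Kinv i) := by
    simp only [map_mul, FreeAlgebra.lift_ι_apply, tensorGen, Kinv, mul_assoc, hc', hc]
  have hE (i j : Fin 3) : φ (K i) * ψ (E i) * φ (E j)
      = q ^ (wt j i.castSucc - wt j i.succ) • (φ (E j) * (φ (K i) * ψ (E i))) := by
    rw [mul_assoc, hc, ← mul_assoc, hm φ (K_mul_E i j), smul_mul_assoc, mul_assoc]
  have hF (i j : Fin 3) : φ (F i) * ψ (Kinv i) * ψ (F j)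
      = q ^ (wt j i.castSucc - wt j i.succ) • (ψ (F j) * (φ (F i) * ψ (Kinv i))) := by
    rw [mul_assoc, hm ψ (Kinv_mul_F i j), mul_smul_comm, hc']
  have hwt (i j : Fin 3) (h : Adjacent i j) : wt j i.castSucc - wt j i.succ = -1 := by
    revert h; fin_cases i <;> fin_cases j <;> simp [Adjacent, wt, Fin.ext_iff]
  have hwt' (i j : Fin 3) (h : Adjacent i j) : wt i j.castSucc - wt i j.succ = -1 := by
    revert h; fin_cases i <;> fin_cases j <;> simp [Adjacent, wt, Fin.ext_iff]
  have hwt2 (i : Fin 3) : wt i i.castSucc - wt i i.succ = (2 : ℕ) := by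
    fin_cases i <;> simp [wt, Fin.ext_iff]
  have hwt0 (i j : Fin 3) (h : ¬ Adjacent i j) (hij : i ≠ j) :
      wt j i.castSucc - wt j i.succ = 0 := by
    revert h hij; fin_cases i <;> fin_cases j <;> simp [Adjacent, wt, Fin.ext_iff]
  have hwt0' (i j : Fin 3) (h : ¬ Adjacent i j) (hij : i ≠ j) :
      wt i j.castSucc - wt i j.succ = 0 := by
    revert h hij; fin_cases i <;> fin_cases j <;> simp [Adjacent, wt, Fin.ext_iff]
  have hsymm (i j : Fin 3) : wt i j.succ - wt i j.castSucc = wt j i.succ - wt j i.castSucc := by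
    fin_cases i <;> fin_cases j <;> simp [wt, Fin.ext_iff]
  have hDD (j : Fin 4) : φ (D j) * ψ (D j) * (φ (Dinv j) * ψ (Dinv j)) = 1 := by
    rw [mul_assoc, hc', ← map_mul ψ, D_mul_Dinv, map_one, mul_one, ← map_mul, D_mul_Dinv, map_one]
  -- The mixed products of K ⊗ E and F ⊗ K⁻¹ cancel: reordering K F and reordering K⁻¹E give the
  -- same power of q, by symmetry of the Cartan matrix.
  have hEF (i j : Fin 3) : (φ (E i) + φ (K i) * ψ (E i)) * (ψ (F j) + φ (F j) * ψ (Kinv j))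
      - (ψ (F j) + φ (F j) * ψ (Kinv j)) * (φ (E i) + φ (K i) * ψ (E i))
      = (φ (E i) * φ (F j) - φ (F j) * φ (E i)) * ψ (Kinv j)
        + φ (K i) * (ψ (E i) * ψ (F j) - ψ (F j) * ψ (E i)) := by
    simp only [mul_add, add_mul, mul_assoc, hc', hc, sub_mul, mul_sub, hm φ (K_mul_F i j),
      hm ψ (Kinv_mul_E j i), S _ (hm φ (K_mul_F i j)), mul_smul_comm, smul_mul_assoc, hsymm i j]
    abel
  cases h with
  | D_mul_Dinv j =>
    simp only [map_mul, map_one, FreeAlgebra.lift_ι_apply, tensorGen, mul_assoc, hc']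
    rw [← map_mul ψ, D_mul_Dinv, map_one, mul_one, ← map_mul, D_mul_Dinv, map_one]
  | Dinv_mul_D j =>
    simp only [map_mul, map_one, FreeAlgebra.lift_ι_apply, tensorGen, mul_assoc, hc']
    rw [← map_mul ψ, Dinv_mul_D, map_one, mul_one, ← map_mul, Dinv_mul_D, map_one]
  | D_comm j k =>
    simp only [map_mul, map_one, FreeAlgebra.lift_ι_apply, tensorGen, mul_assoc, hc']
    rw [← map_mul ψ, D_comm, map_mul, ← mul_assoc, ← map_mul φ, D_comm, map_mul, mul_assoc]
  | D_E i j =>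
    simp only [map_mul, map_smul, FreeAlgebra.lift_ι_apply, tensorGen]
    rw [show φ (D j) * ψ (D j) * (φ (E i) + φ (K i) * ψ (E i))
        = q ^ wt i j • ((φ (E i) + φ (K i) * ψ (E i)) * (φ (D j) * ψ (D j))) by
      simp only [mul_add, add_mul, mul_assoc, hc', hc, hm _ (D_mul_E i j), S _ (hm _ (D_mul_E i j)),
        mul_smul_comm, smul_mul_assoc, smul_add]
      rw [← mul_assoc (φ (D j)) (φ (K i)), ← map_mul φ (D j), D_K_comm, map_mul, mul_assoc],
      smul_mul_assoc, mul_assoc, hDD, mul_one]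
  | D_F i j =>
    simp only [map_mul, map_smul, FreeAlgebra.lift_ι_apply, tensorGen]
    rw [show φ (D j) * ψ (D j) * (ψ (F i) + φ (F i) * ψ (Kinv i))
        = q ^ (-wt i j) • ((ψ (F i) + φ (F i) * ψ (Kinv i)) * (φ (D j) * ψ (D j))) by
      simp only [mul_add, add_mul, mul_assoc, hc', hc, hm _ (D_mul_F i j), S _ (hm _ (D_mul_F i j)),
        mul_smul_comm, smul_mul_assoc, smul_add]
      rw [← map_mul ψ (D j), D_Kinv_comm, map_mul],
      smul_mul_assoc, mul_assoc, hDD, mul_one]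
  | E_F_same i =>
    have h1 (χ : UqGL →ₐ[Cq] R) : χ (E i) * χ (F i)
        = χ (F i) * χ (E i) + (q - q⁻¹)⁻¹ • (χ (K i) - χ (Kinv i)) := by
      rw [← map_mul, E_mul_F_same]; simp only [map_add, map_mul, map_smul, map_sub]
    rw [map_smul, map_sub _ (Gen.K i), hK, hKinv]
    simp only [map_mul, map_sub, FreeAlgebra.lift_ι_apply, tensorGen]
    rw [hEF, h1, h1]
    simp only [add_sub_cancel_left, smul_mul_assoc, mul_smul_comm, ← smul_add, sub_mul, mul_sub]
    congr 1
    abel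
  | E_F_ne i i' h =>
    have h1 (χ : UqGL →ₐ[Cq] R) : χ (E i) * χ (F i') = χ (F i') * χ (E i) := by
      rw [← map_mul, E_mul_F_ne h, map_mul]
    simp only [map_mul, map_zero, map_sub, FreeAlgebra.lift_ι_apply, tensorGen]
    rw [hEF, h1, h1, sub_self, sub_self, zero_mul, mul_zero, add_zero]
  | E_comm i i' h =>
    rcases eq_or_ne i i' with rfl | hne
    · rfl
    have h1 (χ : UqGL →ₐ[Cq] R) : χ (E i) * χ (E i') = χ (E i') * χ (E i) := by
      rw [← map_mul, E_comm h, map_mul]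
    have h2 := hE i i'
    have h3 := hE i' i
    rw [hwt0 _ _ h hne, zpow_zero, one_smul] at h2
    rw [hwt0' _ _ h hne, zpow_zero, one_smul] at h3
    simp only [map_mul, FreeAlgebra.lift_ι_apply, tensorGen, mul_add, add_mul]
    rw [h1 φ, h2, h3, show φ (K i) * ψ (E i) * (φ (K i') * ψ (E i'))
      = φ (K i') * ψ (E i') * (φ (K i) * ψ (E i)) by
        simp only [mul_assoc, hc', h1 ψ]
        rw [← mul_assoc, ← mul_assoc (φ (K i')), ← map_mul, ← map_mul, K_comm, map_mul]]
    abel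
  | F_comm i i' h =>
    rcases eq_or_ne i i' with rfl | hne
    · rfl
    have h1 (χ : UqGL →ₐ[Cq] R) : χ (F i) * χ (F i') = χ (F i') * χ (F i) := by
      rw [← map_mul, F_comm h, map_mul]
    have h2 := hF i i'
    have h3 := hF i' i
    rw [hwt0 _ _ h hne, zpow_zero, one_smul] at h2
    rw [hwt0' _ _ h hne, zpow_zero, one_smul] at h3
    simp only [map_mul, FreeAlgebra.lift_ι_apply, tensorGen, mul_add, add_mul]
    rw [h1 ψ, h2, h3, show φ (F i) * ψ (Kinv i) * (φ (F i') * ψ (Kinv i'))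
      = φ (F i') * ψ (Kinv i') * (φ (F i) * ψ (Kinv i)) by
        simp only [mul_assoc, hc']
        rw [← mul_assoc, ← mul_assoc (φ (F i')), h1 φ, ← map_mul ψ, ← map_mul ψ, Kinv_comm]]
    abel
  | E_serre i i' h =>
    rw [qInt_two]
    simp only [map_mul, map_add, map_sub, map_smul, map_pow, map_zero, FreeAlgebra.lift_ι_apply,
      tensorGen, sq, mul_assoc]
    have key : ∀ j j' : Fin 3, wt j' j.castSucc - wt j' j.succ = -1 → φ (K j) * ψ (E j) * φ (E j')
      = q⁻¹ • (φ (E j') * (φ (K j) * ψ (E j))) := fun j j' hj => by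
        rw [hE, hj, zpow_neg, zpow_one]
    refine serre_add q_ne_zero (by rw [hE, hwt2, zpow_natCast])
      (key _ _ (hwt _ _ h)) (key _ _ (hwt' _ _ h)) (algHom_serre_E φ h) ?_
    -- The K's commute, so the Serre relation of the elements K ⊗ E is a fixed product of K's
    -- tensored with the Serre relation of the E's.
    have e (a b c : Fin 3) : φ (K a) * ψ (E a) * (φ (K b) * ψ (E b) * (φ (K c) * ψ (E c)))
        = φ (K a * (K b * K c)) * (ψ (E a) * (ψ (E b) * ψ (E c))) := by
      simp only [map_mul, mul_assoc, hc']
    rw [e, e, e, show K i * (K i' * K i) = K i * (K i * K i') by rw [K_comm i' i],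
      show K i' * (K i * K i) = K i * (K i * K i') by
        rw [← mul_assoc, K_comm i' i, mul_assoc, K_comm i' i],
      ← mul_smul_comm, ← mul_sub, ← mul_add, algHom_serre_E ψ h, mul_zero]
  | F_serre i i' h =>
    rw [qInt_two]
    simp only [map_mul, map_add, map_sub, map_smul, map_pow, map_zero, FreeAlgebra.lift_ι_apply,
      tensorGen, sq, mul_assoc]
    have key : ∀ j j' : Fin 3, wt j' j.castSucc - wt j' j.succ = -1 →
        φ (F j) * ψ (Kinv j) * ψ (F j') = q⁻¹ • (ψ (F j') * (φ (F j) * ψ (Kinv j))) :=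
      fun j j' hj => by rw [hF, hj, zpow_neg, zpow_one]
    refine serre_add q_ne_zero (by rw [hF, hwt2, zpow_natCast])
      (key _ _ (hwt _ _ h)) (key _ _ (hwt' _ _ h)) (algHom_serre_F ψ h) ?_
    have e (a b c : Fin 3) : φ (F a) * ψ (Kinv a) * (φ (F b) * ψ (Kinv b) * (φ (F c) * ψ (Kinv c)))
        = φ (F a) * (φ (F b) * φ (F c)) * ψ (Kinv a * (Kinv b * Kinv c)) := by
      simp only [map_mul, mul_assoc, hc']
    rw [e, e, e, show Kinv i * (Kinv i' * Kinv i) = Kinv i * (Kinv i * Kinv i') by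
        rw [Kinv_comm i' i],
      show Kinv i' * (Kinv i * Kinv i) = Kinv i * (Kinv i * Kinv i') by
        rw [← mul_assoc, Kinv_comm i' i, mul_assoc, Kinv_comm i' i],
      ← smul_mul_assoc, ← sub_mul, ← add_mul, algHom_serre_F φ h, zero_mul]

/-- The tensor product of two commuting homomorphisms. -/
def tensorHom (φ ψ : UqGL →ₐ[Cq] R) (hc : ∀ x y, ψ y * φ x = φ x * ψ y) : UqGL →ₐ[Cq] R :=
  RingQuot.liftAlgHom Cq ⟨FreeAlgebra.lift Cq (tensorGen φ ψ), fun _ _ h => tensorGen_rel φ ψ hc h⟩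

theorem tensorHom_gen (φ ψ : UqGL →ₐ[Cq] R) (hc : ∀ x y, ψ y * φ x = φ x * ψ y) (g : Gen) :
    tensorHom φ ψ hc (gen g) = tensorGen φ ψ g := by
  rw [tensorHom, gen]
  erw [RingQuot.liftAlgHom_mkAlgHom_apply]
  exact FreeAlgebra.lift_ι_apply _ _

end UqGL

/-! ### The vector representation and the coaction on U_q'. -/

section

namespace UqGL

open Matrix

/-- The values of the vector representation on generators. -/
def vecGen : Gen → Matrix (Fin 4) (Fin 4) Cq
  | .E i => Matrix.single i.castSucc i.succ 1
  | .F i => Matrix.single i.succ i.castSucc 1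
  | .D j => Matrix.diagonal fun k => if k = j then q else 1
  | .Dinv j => Matrix.diagonal fun k => if k = j then q⁻¹ else 1

theorem vecGen_rel {x y : FreeAlgebra Cq Gen} (h : GLRel x y) :
    FreeAlgebra.lift Cq vecGen x = FreeAlgebra.lift Cq vecGen y := by
  have h0 := q_ne_zero
  have h1 := q_sub_inv_ne_zero
  cases h with
  | D_mul_Dinv j =>
    simp only [map_mul, map_one, FreeAlgebra.lift_ι_apply, vecGen, diagonal_mul_diagonal]
    rw [← diagonal_one]
    congr 1; ext k; split_ifs <;> simp [h0]
  | Dinv_mul_D j =>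
    simp only [map_mul, map_one, FreeAlgebra.lift_ι_apply, vecGen, diagonal_mul_diagonal]
    rw [← diagonal_one]
    congr 1; ext k; split_ifs <;> simp [h0]
  | D_comm j k =>
    simp only [map_mul, map_one, FreeAlgebra.lift_ι_apply, vecGen, diagonal_mul_diagonal]
    congr 1; ext k; exact mul_comm _ _
  | D_E i j =>
    simp only [map_mul, map_smul, FreeAlgebra.lift_ι_apply, vecGen]
    ext a b
    simp only [mul_diagonal, diagonal_mul, Matrix.smul_apply, single_apply, wt, smul_eq_mul]
    by_cases hh : i.castSucc = a ∧ i.succ = b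
    · obtain ⟨rfl, rfl⟩ := hh
      have : i.castSucc ≠ i.succ := (Fin.castSucc_lt_succ (i := i)).ne
      split_ifs <;> simp_all
    · simp [hh]
  | D_F i j =>
    simp only [map_mul, map_smul, FreeAlgebra.lift_ι_apply, vecGen]
    ext a b
    simp only [mul_diagonal, diagonal_mul, Matrix.smul_apply, single_apply, wt, smul_eq_mul]
    by_cases hh : i.succ = a ∧ i.castSucc = b
    · obtain ⟨rfl, rfl⟩ := hh
      have : i.castSucc ≠ i.succ := (Fin.castSucc_lt_succ (i := i)).ne
      split_ifs <;> simp_all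
    · simp [hh]
  | E_F_same i =>
    simp only [map_mul, map_smul, map_sub, FreeAlgebra.lift_ι_apply, vecGen,
      diagonal_mul_diagonal, single_mul_single_same, mul_one]
    have : i.castSucc ≠ i.succ := (Fin.castSucc_lt_succ (i := i)).ne
    ext a b
    simp only [Matrix.smul_apply, Matrix.sub_apply, single_apply, diagonal_apply, smul_eq_mul]
    rcases eq_or_ne a b with rfl | hab
    · rcases eq_or_ne i.castSucc a with rfl | h2
      · simp [this, this.symm, h1]
      · rcases eq_or_ne i.succ a with rfl | h3
        · simp [this, this.symm]
          rw [← neg_sub q q⁻¹, mul_neg, inv_mul_cancel₀ h1]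
        · simp [h2, h3, h2.symm, h3.symm]
    · have h2 : ¬ (i.castSucc = a ∧ i.castSucc = b) := fun h => hab (h.1.symm.trans h.2)
      have h3 : ¬ (i.succ = a ∧ i.succ = b) := fun h => hab (h.1.symm.trans h.2)
      simp [hab, h2, h3]
  | E_F_ne i i' h =>
    simp only [map_mul, map_smul, map_sub, map_zero, FreeAlgebra.lift_ι_apply, vecGen]
    rw [single_mul_single_of_ne, single_mul_single_of_ne, sub_self]
    · simpa using h.symm
    · simpa using h
  | E_comm i i' h =>
    rw [Adjacent, not_or] at h
    simp only [map_mul, FreeAlgebra.lift_ι_apply, vecGen]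
    rw [single_mul_single_of_ne _ _ _ _ h.1, single_mul_single_of_ne _ _ _ _ h.2]
  | F_comm i i' h =>
    rw [Adjacent, not_or] at h
    simp only [map_mul, FreeAlgebra.lift_ι_apply, vecGen]
    rw [single_mul_single_of_ne _ _ _ _ (Ne.symm h.2),
      single_mul_single_of_ne _ _ _ _ (Ne.symm h.1)]
  | E_serre i i' h =>
    have h2 : i.succ ≠ i.castSucc := (Fin.castSucc_lt_succ (i := i)).ne'
    have h3 : vecGen (.E i) * vecGen (.E i') * vecGen (.E i) = 0 := by
      rcases eq_or_ne i.succ i'.castSucc with h4 | h4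
      · have h5 : i'.succ ≠ i.castSucc := by
          intro h5; simp only [Fin.ext_iff, Fin.val_succ, Fin.val_castSucc] at h4 h5; omega
        rw [mul_assoc, vecGen, vecGen, single_mul_single_of_ne _ _ _ _ h5, mul_zero]
      · rw [vecGen, vecGen, single_mul_single_of_ne _ _ _ _ h4, zero_mul]
    simp only [map_mul, map_add, map_sub, map_pow, map_smul, map_zero, FreeAlgebra.lift_ι_apply, h3]
    rw [sq, vecGen, single_mul_single_of_ne _ _ _ _ h2]
    simp
  | F_serre i i' h =>
    have h2 : i.castSucc ≠ i.succ := (Fin.castSucc_lt_succ (i := i)).ne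
    have h3 : vecGen (.F i) * vecGen (.F i') * vecGen (.F i) = 0 := by
      rcases eq_or_ne i.castSucc i'.succ with h4 | h4
      · have h5 : i'.castSucc ≠ i.succ := by
          intro h5; simp only [Fin.ext_iff, Fin.val_succ, Fin.val_castSucc] at h4 h5; omega
        rw [mul_assoc, vecGen, vecGen, single_mul_single_of_ne _ _ _ _ h5, mul_zero]
      · rw [vecGen, vecGen, single_mul_single_of_ne _ _ _ _ h4, zero_mul]
    simp only [map_mul, map_add, map_sub, map_pow, map_smul, map_zero, FreeAlgebra.lift_ι_apply, h3]
    rw [sq, vecGen, single_mul_single_of_ne _ _ _ _ h2]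
    simp

/-- The vector representation of `U_q(𝔤𝔩₄)`. -/
def vecRep : UqGL →ₐ[Cq] Matrix (Fin 4) (Fin 4) Cq :=
  RingQuot.liftAlgHom Cq ⟨FreeAlgebra.lift Cq vecGen, fun _ _ h => vecGen_rel h⟩

theorem vecRep_gen (g : Gen) : vecRep (gen g) = vecGen g := by
  rw [vecRep, gen]
  erw [RingQuot.liftAlgHom_mkAlgHom_apply]
  exact FreeAlgebra.lift_ι_apply _ _

theorem vecRep_Kinv (i : Fin 3) : vecRep (Kinv i) = Matrix.diagonal fun k =>
    (if k = i.castSucc then q⁻¹ else 1) * (if k = i.succ then q else 1) := by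
  rw [Kinv, map_mul, D, Dinv, vecRep_gen, vecRep_gen, vecGen, vecGen, diagonal_mul_diagonal]

/-- Diagonal matrices with entries in `U_q(𝔤𝔩₄)`. -/
abbrev scalarHom : UqGL →ₐ[Cq] Matrix (Fin 4) (Fin 4) UqGL := Matrix.scalarAlgHom (Fin 4) Cq

/-- The vector representation as matrices with entries in `U_q(𝔤𝔩₄)`. -/
abbrev vecHom : UqGL →ₐ[Cq] Matrix (Fin 4) (Fin 4) UqGL :=
  (Algebra.ofId Cq UqGL).mapMatrix.comp vecRep

theorem scalarHom_mul_vecHom (x y : UqGL) (i j : Fin 4) :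
    (scalarHom x * vecHom y) i j = vecRep y i j • x := by
  rw [Algebra.smul_def, Algebra.commutes]
  simp [scalarHom, vecHom, Matrix.diagonal_mul, Algebra.ofId_apply]

theorem vecHom_mul_scalarHom (x y : UqGL) : vecHom y * scalarHom x = scalarHom x * vecHom y := by
  ext i j
  rw [scalarHom_mul_vecHom, Algebra.smul_def]
  simp [scalarHom, vecHom, Matrix.mul_diagonal, Algebra.ofId_apply]

/-- The coproduct of `U_q(𝔤𝔩₄)`, with the vector representation applied to the second factor. -/
def vecCoprod : UqGL →ₐ[Cq] Matrix (Fin 4) (Fin 4) UqGL :=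
  tensorHom scalarHom vecHom vecHom_mul_scalarHom

theorem scalarHom_one_mul_vecHom (x : UqGL) : vecHom x = scalarHom 1 * vecHom x := by
  rw [map_one, one_mul]

theorem vecCoprod_Kinv (i : Fin 3) :
    vecCoprod (Kinv i) = scalarHom (Kinv i) * vecHom (Kinv i) := by
  rw [Kinv, map_mul, D, Dinv, vecCoprod, tensorHom_gen, tensorHom_gen, tensorGen, tensorGen,
    ← mul_assoc, mul_assoc (scalarHom _), vecHom_mul_scalarHom, map_mul, map_mul]
  simp only [mul_assoc, D, Dinv]

theorem vecCoprod_E_mul_Kinv (i k : Fin 3) : vecCoprod (E i * Kinv k)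
    = scalarHom (E i * Kinv k) * vecHom (Kinv k)
      + scalarHom (K i * Kinv k) * vecHom (E i * Kinv k) := by
  rw [map_mul, vecCoprod_Kinv, E, vecCoprod, tensorHom_gen, tensorGen, add_mul]
  congr 1
  · rw [map_mul, mul_assoc]; rfl
  · rw [map_mul, map_mul, mul_assoc, ← mul_assoc (vecHom _), vecHom_mul_scalarHom]
    simp only [mul_assoc, E]

theorem vecCoprod_F (i : Fin 3) :
    vecCoprod (F i) = vecHom (F i) + scalarHom (F i) * vecHom (Kinv i) := by
  rw [F, vecCoprod, tensorHom_gen, tensorGen]; rfl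

/-- The coproducts of F_i and of E_{-i}K_i⁻¹ both contain a term with second factor K_i⁻¹; these two
combine to B_i ⊗ K_i⁻¹. -/
theorem vecCoprod_B (i : Fin 3) (a b : Fin 4) : vecCoprod (B i) a b
    = vecRep (Kinv i) a b • B i + vecRep (F i) a b • 1
      + vecRep (E i.rev * Kinv i) a b • (K i.rev * Kinv i) := by
  rw [B, map_add, vecCoprod_E_mul_Kinv, vecCoprod_F, scalarHom_one_mul_vecHom (F i)]
  simp only [Matrix.add_apply, scalarHom_mul_vecHom, smul_add]
  abel

theorem vecCoprod_Bzero (a b : Fin 4) : vecCoprod Bzero a b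
    = vecRep (Kinv 1) a b • Bzero + (vecRep (F 1) a b + q⁻¹ * vecRep (E 1 * Kinv 1) a b) • 1 := by
  rw [Bzero, map_add, map_smul, vecCoprod_E_mul_Kinv, vecCoprod_F, scalarHom_one_mul_vecHom (F 1),
    K_mul_Kinv]
  simp only [Matrix.add_apply, Matrix.smul_apply, scalarHom_mul_vecHom, smul_add, add_smul,
    mul_smul]
  rw [smul_comm q⁻¹ (vecRep (Kinv 1) a b)]
  abel

theorem vecCoprod_Dhat (j : Fin 4) (a b : Fin 4) :
    vecCoprod (Dhat j) a b = vecRep (Dhat j) a b • Dhat j := by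
  rw [← scalarHom_mul_vecHom, Dhat, map_mul, D, D, vecCoprod, tensorHom_gen, tensorHom_gen,
    tensorGen, tensorGen, mul_assoc, ← mul_assoc (vecHom _), vecHom_mul_scalarHom, map_mul, map_mul]
  simp only [mul_assoc, D]

theorem vecCoprod_DhatInv (j : Fin 4) (a b : Fin 4) :
    vecCoprod (DhatInv j) a b = vecRep (DhatInv j) a b • DhatInv j := by
  rw [← scalarHom_mul_vecHom, DhatInv, map_mul, Dinv, Dinv, vecCoprod, tensorHom_gen, tensorHom_gen,
    tensorGen, tensorGen, mul_assoc, ← mul_assoc (vecHom _), vecHom_mul_scalarHom, map_mul, map_mul]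
  simp only [mul_assoc, Dinv]

theorem vecRep_Dhat (j : Fin 4) : vecRep (Dhat j) = Matrix.diagonal fun k =>
    (if k = j then q else 1) * (if k = j.rev then q else 1) := by
  rw [Dhat, map_mul, D, D, vecRep_gen, vecRep_gen, vecGen, vecGen, diagonal_mul_diagonal]

theorem D_Dinv_comm_mul (i j k : Fin 4) : Dinv i * Dinv j * D k = D k * (Dinv i * Dinv j) := by
  rw [mul_assoc, D_Dinv_comm, ← mul_assoc, D_Dinv_comm, mul_assoc]

theorem K_rev_mul_Kinv_zero : K (Fin.rev 0) * Kinv 0 = (Kh : UqGL) := by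
  change D 2 * Dinv 3 * (Dinv 0 * D 1) = D 2 * D 1 * (Dinv 0 * Dinv 3)
  rw [mul_assoc, mul_assoc, ← mul_assoc (Dinv 3), Dinv_comm 3 0, D_Dinv_comm_mul]

theorem K_rev_mul_Kinv_two : K (Fin.rev 2) * Kinv 2 = (KhInv : UqGL) := by
  change D 0 * Dinv 1 * (Dinv 2 * D 3) = Dinv 1 * Dinv 2 * (D 3 * D 0)
  rw [D_comm 3 0, ← mul_assoc (Dinv 1 * Dinv 2), D_Dinv_comm_mul]
  simp only [mul_assoc]

end UqGL

open UqGL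

/-- The coideal property: the first tensor factors B_i, B_0, K_{-i}K_i⁻¹, D̂_j^{±1} and 1 all lie in
U_q'. This is what lets U_q' act on W ⊗ V for a module W over U_q' only. -/
theorem vecCoprod_mem (x : Uq') (a b : Fin 4) : vecCoprod x a b ∈ Uq' := by
  induction x using uq'_induction generalizing a b with
  | hB1 =>
    rw [B1, vecCoprod_B, K_rev_mul_Kinv_zero]
    exact add_mem (add_mem (Uq'.smul_mem B1.2 _) (Uq'.smul_mem (one_mem _) _)) (Uq'.smul_mem Kh.2 _)
  | hBm1 =>
    rw [Bm1, vecCoprod_B, K_rev_mul_Kinv_two]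
    exact add_mem (add_mem (Uq'.smul_mem Bm1.2 _) (Uq'.smul_mem (one_mem _) _))
      (Uq'.smul_mem KhInv.2 _)
  | hB0 =>
    rw [B0, vecCoprod_Bzero]
    exact add_mem (Uq'.smul_mem B0.2 _) (Uq'.smul_mem (one_mem _) _)
  | hDd => rw [Dd, vecCoprod_Dhat]; exact Uq'.smul_mem Dd.2 _
  | hD1 => rw [D1, vecCoprod_Dhat]; exact Uq'.smul_mem D1.2 _
  | hDdInv => rw [DdInv, vecCoprod_DhatInv]; exact Uq'.smul_mem DdInv.2 _
  | hD1Inv => rw [D1Inv, vecCoprod_DhatInv]; exact Uq'.smul_mem D1Inv.2 _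
  | hc c =>
    rw [show ((algebraMap Cq Uq' c : Uq') : UqGL) = algebraMap Cq UqGL c from rfl, AlgHom.commutes,
      Matrix.algebraMap_matrix_apply]
    split_ifs
    · exact Uq'.algebraMap_mem c
    · exact zero_mem _
  | hadd x y hx hy =>
    rw [Subalgebra.coe_add, map_add, Matrix.add_apply]
    exact add_mem (hx _ _) (hy _ _)
  | hmul x y hx hy =>
    rw [Subalgebra.coe_mul, map_mul, Matrix.mul_apply]
    exact sum_mem fun c _ => mul_mem (hx _ _) (hy _ _)

/-- The coaction of the vector representation on `U_q'`. -/
def coact : Uq' →ₐ[Cq] Matrix (Fin 4) (Fin 4) Uq' where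
  toFun x := Matrix.of fun a b => ⟨vecCoprod x a b, vecCoprod_mem x a b⟩
  map_one' := by
    ext a b
    rcases eq_or_ne a b with rfl | h
    · simp
    · simp [h]
  map_mul' x y := by
    ext a b
    simp [Matrix.mul_apply]
  map_zero' := by ext a b; simp
  map_add' x y := by ext a b; simp
  commutes' c := by
    ext a b
    rw [Matrix.algebraMap_matrix_apply]
    simp only [Matrix.of_apply]
    rw [show ((algebraMap Cq Uq' c : Uq') : UqGL) = algebraMap Cq UqGL c from rfl, AlgHom.commutes,
      Matrix.algebraMap_matrix_apply]
    split_ifs <;> rfl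

theorem coact_apply (x : Uq') (a b : Fin 4) : (coact x a b : UqGL) = vecCoprod x a b := rfl

end

/-! ### Tensor products with the vector representation. -/

section

/-- The tensor product of a `U_q'`-module with the vector representation of `U_q(𝔤𝔩₄)`. -/
def Tens (W : Type*) : Type _ := Fin 4 → W

namespace Tens

variable {W : Type*} [AddCommGroup W]

/-- An element of `Tens W` from its components. -/
def mk (a b c d : W) : Tens W := ![a, b, c, d]

instance : AddCommGroup (Tens W) := inferInstanceAs (AddCommGroup (Fin 4 → W))

instance [Module Cq W] : Module Cq (Tens W) := inferInstanceAs (Module Cq (Fin 4 → W))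

theorem mk_add (a b c d a' b' c' d' : W) :
    mk a b c d + mk a' b' c' d' = mk (a + a') (b + b') (c + c') (d + d') := by
  funext i; fin_cases i <;> rfl

theorem smul_mk [Module Cq W] (x : Cq) (a b c d : W) :
    x • mk a b c d = mk (x • a) (x • b) (x • c) (x • d) := by
  funext i; fin_cases i <;> rfl

theorem mk_zero : (mk 0 0 0 0 : Tens W) = 0 := by
  funext i; fin_cases i <;> rfl

theorem mk_inj {V : Type*} {a b c d a' b' c' d' : V} (h : mk a b c d = mk a' b' c' d') :
    a = a' ∧ b = b' ∧ c = c' ∧ d = d' :=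
  ⟨congrFun h 0, congrFun h 1, congrFun h 2, congrFun h 3⟩

instance [Module Cq W] [FiniteDimensional Cq W] : FiniteDimensional Cq (Tens W) :=
  inferInstanceAs (FiniteDimensional Cq (Fin 4 → W))

variable [Module Uq' W]

instance : Module Uq' (Tens W) where
  smul x f := fun i => ∑ j, coact x i j • f j
  one_smul f := funext fun i => by
    change ∑ j, coact 1 i j • f j = f i
    simp only [map_one, Matrix.one_apply, ite_smul, one_smul, zero_smul]
    exact (Finset.sum_ite_eq _ _ _).trans (if_pos (Finset.mem_univ _))
  mul_smul x y f := funext fun i => by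
    change ∑ j, coact (x * y) i j • f j = ∑ j, coact x i j • ∑ k, coact y j k • f k
    simp only [map_mul, Matrix.mul_apply, Finset.sum_smul, Finset.smul_sum, smul_smul]
    exact Finset.sum_comm
  smul_zero x := funext fun i => by
    change ∑ j, coact x i j • (0 : W) = 0
    simp
  smul_add x f g := funext fun i => by
    change ∑ j, coact x i j • (f j + g j) = ∑ j, coact x i j • f j + ∑ j, coact x i j • g j
    simp [Finset.sum_add_distrib]
  add_smul x y f := funext fun i => by
    change ∑ j, coact (x + y) i j • f j = ∑ j, coact x i j • f j + ∑ j, coact y i j • f j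
    simp [Finset.sum_add_distrib, add_smul]
  zero_smul f := funext fun i => by
    change ∑ j, coact 0 i j • f j = 0
    simp

theorem smul_apply (x : Uq') (f : Tens W) (i : Fin 4) : (x • f) i = ∑ j, coact x i j • f j := rfl

variable [Module Cq W] [IsScalarTower Cq Uq' W]

instance : IsScalarTower Cq Uq' (Tens W) where
  smul_assoc c x f := funext fun i => by
    change ∑ j, coact (c • x) i j • f j = c • ∑ j, coact x i j • f j
    simp [Finset.smul_sum]

end Tens

open UqGL

theorem coact_B1 (a b : Fin 4) : coact B1 a b = vecRep (Kinv 0) a b • B1 + vecRep (F 0) a b • 1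
    + vecRep (E 2 * Kinv 0) a b • Kh := by
  apply Subtype.ext
  rw [coact_apply, B1, vecCoprod_B, K_rev_mul_Kinv_zero]; rfl

theorem coact_Bm1 (a b : Fin 4) : coact Bm1 a b = vecRep (Kinv 2) a b • Bm1 + vecRep (F 2) a b • 1
    + vecRep (E 0 * Kinv 2) a b • KhInv := by
  apply Subtype.ext
  rw [coact_apply, Bm1, vecCoprod_B, K_rev_mul_Kinv_two]; rfl

theorem coact_B0 (a b : Fin 4) : coact B0 a b = vecRep (Kinv 1) a b • B0
    + (vecRep (F 1) a b + q⁻¹ * vecRep (E 1 * Kinv 1) a b) • 1 := by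
  apply Subtype.ext
  rw [coact_apply, B0, vecCoprod_Bzero]; rfl

theorem coact_Dd (a b : Fin 4) : coact Dd a b = vecRep (Dhat 2) a b • Dd := by
  apply Subtype.ext
  rw [coact_apply, Dd, vecCoprod_Dhat]; rfl

theorem coact_D1 (a b : Fin 4) : coact D1 a b = vecRep (Dhat 3) a b • D1 := by
  apply Subtype.ext
  rw [coact_apply, D1, vecCoprod_Dhat]; rfl

namespace Tens

theorem vecRep_F (i : Fin 3) : vecRep (F i) = Matrix.single i.succ i.castSucc 1 := vecRep_gen _

theorem vecRep_E (i : Fin 3) : vecRep (E i) = Matrix.single i.castSucc i.succ 1 := vecRep_gen _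

variable {W : Type*} [AddCommGroup W] [Module Uq' W] [Module Cq W] [IsScalarTower Cq Uq' W]

theorem B1_smul (a b c d : W) : B1 • mk a b c d
    = mk (q⁻¹ • B1 • a) (a + q • B1 • b) (B1 • c + Kh • d) (B1 • d) := by
  funext i
  rw [smul_apply, Fin.sum_univ_four]
  fin_cases i <;> simp [coact_B1, vecRep_Kinv, vecRep_E, vecRep_F, mk, Matrix.single_apply]

theorem Bm1_smul (a b c d : W) : Bm1 • mk a b c d
    = mk (Bm1 • a + KhInv • b) (Bm1 • b) (q⁻¹ • Bm1 • c) (c + q • Bm1 • d) := by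
  funext i
  rw [smul_apply, Fin.sum_univ_four]
  fin_cases i <;> simp [coact_Bm1, vecRep_Kinv, vecRep_E, vecRep_F, mk, Matrix.single_apply]

theorem B0_smul (a b c d : W) : B0 • mk a b c d
    = mk (B0 • a) (q⁻¹ • B0 • b + c) (b + q • B0 • c) (B0 • d) := by
  have := q_ne_zero
  funext i
  rw [smul_apply, Fin.sum_univ_four]
  fin_cases i <;> simp [coact_B0, vecRep_Kinv, vecRep_E, vecRep_F, mk, Matrix.single_apply, this]

theorem Dd_smul (a b c d : W) : Dd • mk a b c d
    = mk (Dd • a) (q • Dd • b) (q • Dd • c) (Dd • d) := by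
  funext i
  rw [smul_apply, Fin.sum_univ_four]
  fin_cases i <;> simp [coact_Dd, vecRep_Dhat, mk]

theorem D1_smul (a b c d : W) : D1 • mk a b c d
    = mk (q • D1 • a) (D1 • b) (D1 • c) (q • D1 • d) := by
  funext i
  rw [smul_apply, Fin.sum_univ_four]
  fin_cases i <;> simp [coact_D1, vecRep_Dhat, mk]

end Tens

end

/-! ### Highest weight vectors in tensor products. -/

section

variable {W : Type*} [AddCommGroup W] [Module Cq W] [Module Uq' W] [IsScalarTower Cq Uq' W]
  {d d₁ : ℤ} {c ζ : Cq} {v : W}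

theorem X_smul (m : W) : X • m = B0 • B1 • m - q⁻¹ • B1 • B0 • m := by
  rw [X, qComm, sub_smul, smul_assoc, mul_smul, mul_smul]

theorem Y_smul (m : W) : Y • m = B0 • Bm1 • m - q⁻¹ • Bm1 • B0 • m := by
  rw [Y, qComm, sub_smul, smul_assoc, mul_smul, mul_smul]

theorem Z_smul (m : W) : Z • m = B1 • Y • m - q⁻¹ • Y • B1 • m := by
  rw [Z, qComm, sub_smul, smul_assoc, mul_smul, mul_smul]

/-- Together with `c_mul_qBr_q_mul` this says that (1, c) is an eigenvector, of eigenvalue [qc;0],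
of the matrix by which B_0 acts on the two middle coordinates. It is the matrix met in `B₀_lower`.
-/
theorem qBr_q_mul (hc : c ≠ 0) : qBr (q * c) 0 = q⁻¹ * qBr c 0 + c := by
  have h1 := q_ne_zero
  have h2 := q_sub_inv_ne_zero
  rw [qBr_zero, qBr_zero, mul_inv, div_eq_iff h2, add_mul, mul_assoc, div_mul_cancel₀ _ h2]
  field_simp
  ring

theorem c_mul_qBr_q_mul (hc : c ≠ 0) : c * qBr (q * c) 0 = q * (c * qBr c 0) + 1 := by
  have h1 := q_ne_zero
  have h2 := q_sub_inv_ne_zero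
  apply mul_right_cancel₀ h2
  rw [qBr_zero, qBr_zero, mul_inv, mul_assoc, div_mul_cancel₀ _ h2, add_mul, mul_assoc, mul_assoc,
    div_mul_cancel₀ _ h2]
  field_simp
  ring

theorem Tens.B0_smul_middle (hB0 : B0 • v = qBr c 0 • v) (hc : c ≠ 0) :
    B0 • mk 0 v (c • v) 0 = qBr (q * c) 0 • mk 0 v (c • v) 0 := by
  rw [B0_smul, smul_mk, smul_zero, smul_zero, smul_comm_uq', hB0, smul_smul, ← add_smul,
    ← qBr_q_mul hc, smul_smul c, smul_smul q, smul_smul (qBr (q * c) 0), mul_comm (qBr (q * c) 0) c,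
    c_mul_qBr_q_mul hc, add_comm v, add_smul, one_smul]

theorem B1_smul_Bm1 (h : IsHW d d₁ c ζ v) :
    B1 • Bm1 • v = ((q - q⁻¹)⁻¹ * (q ^ (d - d₁) - (q ^ (d - d₁))⁻¹)) • v := by
  rw [smul_smul, coidealRelations.B₁_Bₘ, add_smul, mul_smul, h.B1, smul_zero, zero_add, smul_assoc,
    sub_smul, h.Kh_smul, h.KhInv_smul, ← sub_smul, smul_smul]

theorem B1_smul_B0_smul_Bm1 (h : IsHW d d₁ c ζ v) : B1 • B0 • Bm1 • v
    = (ζ + q⁻¹ * (qBr c 0 * ((q - q⁻¹)⁻¹ * (q ^ (d - d₁) - (q ^ (d - d₁))⁻¹)))) • v := by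
  have h1 := h.Z
  rw [Z_smul, h.B1, smul_zero, smul_zero, sub_zero, Y_smul, h.B0, smul_comm_uq', smul_sub,
    smul_comm_uq', smul_comm_uq', B1_smul_Bm1 h, sub_eq_iff_eq_add] at h1
  rw [h1, smul_smul, smul_smul, ← add_smul, mul_assoc]

/-- B_1 and X kill w = (0, v, cv, 0), so Z w = B_1 Y w, and its evaluation needs only B_1 B_{-1} v
and B_1 B_0 B_{-1} v. -/
theorem Tens.isHW (h : IsHW d d₁ c ζ v) (hc : c ≠ 0) :
    IsHW (d + 1) d₁ (q * c) (ζ - q ^ (-(d - d₁) - 1) * c⁻¹) (mk 0 v (c • v) 0) := by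
  have hq := q_ne_zero
  have hB0 : B0 • mk 0 v (c • v) 0 = qBr (q * c) 0 • mk 0 v (c • v) 0 := B0_smul_middle h.B0 hc
  have hB1 : B1 • mk 0 v (c • v) 0 = 0 := by
    rw [Tens.B1_smul, smul_comm_uq', h.B1]
    simp [mk_zero]
  refine ⟨⟨?_, ?_, hB0, ?_⟩, hB1, ?_⟩
  · rw [Dd_smul, smul_mk, smul_comm_uq', h.Dd, zpow_add_one₀ hq]
    simp only [smul_zero, smul_smul]
    congr 2 <;> ring
  · rw [D1_smul, smul_mk, smul_comm_uq', h.D1]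
    simp only [smul_zero, smul_smul]
    congr 2; ring
  · have hk : q ^ (-(d - d₁) - 1) = q⁻¹ * (q ^ (d - d₁))⁻¹ := by
      rw [sub_eq_add_neg, zpow_add₀ hq, zpow_neg, zpow_neg_one, mul_comm]
    have h1 := B1_smul_Bm1 h
    have h2 := B1_smul_B0_smul_Bm1 h
    rw [Z_smul, hB1, smul_zero, smul_zero, sub_zero, Y_smul, hB0, smul_comm_uq', smul_smul q⁻¹,
      sub_eq_add_neg, ← neg_smul, Tens.Bm1_smul, Tens.B0_smul, smul_mk, mk_add, Tens.B1_smul, smul_mk,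
      hk]
    have hq2 := q_sub_inv_ne_zero
    have hqq : q * q⁻¹ = 1 := mul_inv_cancel₀ hq
    have hcc : c * c⁻¹ = 1 := mul_inv_cancel₀ hc
    have hβ : qBr c 0 - q⁻¹ ^ 2 * qBr c 0 = q⁻¹ * (c - c⁻¹) := by
      have h3 : qBr c 0 * (q - q⁻¹) = c - c⁻¹ := by rw [qBr_zero, div_mul_cancel₀ _ hq2]
      linear_combination q⁻¹ * h3 - qBr c 0 * hqq
    have hs : (q - q⁻¹)⁻¹ * (q ^ (d - d₁) - (q ^ (d - d₁))⁻¹) * (1 - q⁻¹ ^ 2)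
        = q⁻¹ * (q ^ (d - d₁) - (q ^ (d - d₁))⁻¹) := by
      have h3 : (q - q⁻¹)⁻¹ * (q - q⁻¹) = 1 := inv_mul_cancel₀ hq2
      linear_combination q⁻¹ * (q ^ (d - d₁) - (q ^ (d - d₁))⁻¹) * h3
        - (q - q⁻¹)⁻¹ * (q ^ (d - d₁) - (q ^ (d - d₁))⁻¹) * hqq
    rw [qBr_q_mul hc]
    simp only [smul_zero, zero_add, add_zero, smul_comm_uq', smul_add, h1, h2, h.KhInv_smul, h.B0,
      h.Kh_smul, h.B1]
    generalize (q - q⁻¹)⁻¹ * (q ^ (d - d₁) - (q ^ (d - d₁))⁻¹) = s at *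
    generalize q ^ (d - d₁) = k at *
    generalize qBr c 0 = β at *
    simp only [smul_smul, ← add_smul]
    congr 2
    · linear_combination k⁻¹ * hβ + ζ * hqq
    · linear_combination (s * q⁻¹ * c + c * k) * hβ + hs
        + (-s * q⁻¹ ^ 2 - q⁻¹ * k + q⁻¹ * k⁻¹) * hcc + (c * ζ + s * q⁻¹ * c * β) * hqq
  · rw [X_smul, hB1, hB0, smul_comm_uq', hB1]; simp

end

/-! ### Spherical vectors and one-dimensional modules. -/

section Spherical

variable {W : Type*} [AddCommGroup W] [Module Cq W] [Module Uq' W]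

/-- `v` spans a one-dimensional module on which `B_{±1}` vanish, `D̂_♦` and `D̂_1` act by `q^d` and
`B_0` acts by `β`. -/
structure IsSpherical (d : ℤ) (β : Cq) (v : W) : Prop where
  B1_smul : B1 • v = 0
  Bm1_smul : Bm1 • v = 0
  B0_smul : B0 • v = β • v
  Dd_smul : Dd • v = q ^ d • v
  D1_smul : D1 • v = q ^ d • v

variable [IsScalarTower Cq Uq' W] {d : ℤ} {c : Cq} {v : W}

theorem IsSpherical.isHW {i : ℤ} (h : IsSpherical d (qBr c i) v) : IsHW d d (q ^ i * c) 0 v where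
  Dd := h.Dd_smul
  D1 := h.D1_smul
  B0 := by rw [h.B0_smul, qBr_eq]
  Z := by rw [Z_smul, h.B1_smul, Y_smul, h.Bm1_smul, h.B0_smul, smul_comm_uq', h.Bm1_smul]; simp
  B1 := h.B1_smul
  X := by rw [X_smul, h.B1_smul, h.B0_smul, smul_comm_uq', h.B1_smul]; simp

/-- In W ⊗ V the vectors f = (0, v, cv, 0) and g = B_{-1} f = (v, 0, 0, cv) span a two-dimensional
submodule. Tensored once more with V, it contains the displayed vector, on which the contributions
to B_1 and to B_{-1} cancel. -/
theorem IsSpherical.tens (h : IsSpherical d (qBr c 0) v) (hc : c ≠ 0) :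
    IsSpherical (d + 1) (qBr (q * c) 0)
      (Tens.mk (-q • Tens.mk 0 v (c • v) 0) (Tens.mk v 0 0 (c • v))
        (c • Tens.mk v 0 0 (c • v)) ((-q⁻¹ * c) • Tens.mk 0 v (c • v) 0)) := by
  have hq := q_ne_zero
  have hw : IsHW d d c 0 v := by simpa using h.isHW
  have hK : Kh • v = v := by simpa using hw.Kh_smul
  have hK' : KhInv • v = v := by simpa using hw.KhInv_smul
  have z1 : ∀ a : Cq, a • (0 : W) = 0 := smul_zero
  have f1 : B1 • Tens.mk 0 v (c • v) 0 = 0 := (Tens.isHW hw hc).B1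
  have f2 : Bm1 • Tens.mk 0 v (c • v) 0 = Tens.mk v 0 0 (c • v) := by
    rw [Tens.Bm1_smul]; simp [hK', h.Bm1_smul, smul_comm_uq']
  have f3 : B0 • Tens.mk 0 v (c • v) 0 = qBr (q * c) 0 • Tens.mk 0 v (c • v) 0 :=
    (Tens.isHW hw hc).B0
  have f4 : Dd • Tens.mk 0 v (c • v) 0 = q ^ (d + 1) • Tens.mk 0 v (c • v) 0 :=
    (Tens.isHW hw hc).Dd
  have f5 : D1 • Tens.mk 0 v (c • v) 0 = q ^ d • Tens.mk 0 v (c • v) 0 := (Tens.isHW hw hc).D1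
  have f6 : Kh • Tens.mk 0 v (c • v) 0 = q • Tens.mk 0 v (c • v) 0 := by
    simpa using (Tens.isHW hw hc).Kh_smul
  have g1 : B1 • Tens.mk v 0 0 (c • v) = Tens.mk 0 v (c • v) 0 := by
    rw [Tens.B1_smul]; simp [hK, h.B1_smul, smul_comm_uq']
  have g2 : Bm1 • Tens.mk v 0 0 (c • v) = 0 := by
    rw [Tens.Bm1_smul]; simp [h.Bm1_smul, smul_comm_uq', Tens.mk_zero]
  have g3 : B0 • Tens.mk v 0 0 (c • v) = qBr c 0 • Tens.mk v 0 0 (c • v) := by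
    rw [Tens.B0_smul, Tens.smul_mk]; simp [h.B0_smul, smul_comm_uq', smul_comm c]
  have g4 : Dd • Tens.mk v 0 0 (c • v) = q ^ d • Tens.mk v 0 0 (c • v) := by
    rw [Tens.Dd_smul, Tens.smul_mk]; simp [h.Dd_smul, smul_comm_uq', smul_comm c]
  have g5 : D1 • Tens.mk v 0 0 (c • v) = q ^ (d + 1) • Tens.mk v 0 0 (c • v) := by
    rw [Tens.D1_smul, Tens.smul_mk, zpow_add_one₀ hq, mul_comm]
    simp [h.D1_smul, smul_comm_uq', smul_comm c, mul_smul, smul_comm q c]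
  have g6 : KhInv • Tens.mk v 0 0 (c • v) = q • Tens.mk v 0 0 (c • v) := by
    rw [KhInv, mul_smul, g5, smul_comm_uq', inv_smul_of_smul DdInv_mul_Dd (q_zpow_ne_zero d) g4,
      smul_smul, zpow_add_one₀ hq, mul_comm, ← mul_assoc, inv_mul_cancel₀ (q_zpow_ne_zero d),
      one_mul]
  generalize Tens.mk 0 v (c • v) 0 = f at *
  generalize Tens.mk v 0 0 (c • v) = g at *
  have hqq : q⁻¹ * q = 1 := inv_mul_cancel₀ hq
  have hqq' : q * q⁻¹ = 1 := mul_inv_cancel₀ hq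
  constructor
  · rw [Tens.B1_smul]
    simp only [smul_comm_uq', f1, g1, f6, smul_zero, smul_smul, zero_add, ← add_smul]
    rw [show c + -q⁻¹ * c * q = 0 by linear_combination (-c) * hqq, neg_add_cancel, zero_smul,
      Tens.mk_zero]
  · rw [Tens.Bm1_smul]
    simp only [smul_comm_uq', f2, g2, g6, smul_zero, smul_smul, add_zero, ← add_smul]
    rw [show c + q * (-q⁻¹ * c) = 0 by linear_combination (-c) * hqq, neg_add_cancel, zero_smul,
      Tens.mk_zero]
  · rw [Tens.B0_smul, Tens.smul_mk]
    simp only [smul_comm_uq', f3, g3, smul_smul, ← add_smul]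
    rw [mul_comm (-q), mul_comm (-q⁻¹ * c), ← qBr_q_mul hc]
    congr 2
    rw [← one_smul Cq g, smul_smul, smul_smul, ← add_smul]
    congr 1
    linear_combination - c_mul_qBr_q_mul hc
  · rw [Tens.Dd_smul, Tens.smul_mk]
    simp only [smul_comm_uq', f4, g4, smul_smul, ← add_smul]
    rw [zpow_add_one₀ hq]
    congr 2 <;> ring
  · rw [Tens.D1_smul, Tens.smul_mk]
    simp only [smul_comm_uq', f5, g5, smul_smul, ← add_smul]
    rw [zpow_add_one₀ hq]
    congr 2 <;> ring

end Spherical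

/-! ### Characters -/

/-- The one-dimensional module given by a character of `U_q'`. -/
def CharMod (_ : Uq' →ₐ[Cq] Cq) : Type := Cq

namespace CharMod

variable (χ : Uq' →ₐ[Cq] Cq)

instance : AddCommGroup (CharMod χ) := inferInstanceAs (AddCommGroup Cq)

instance : Module Cq (CharMod χ) := inferInstanceAs (Module Cq Cq)

instance : FiniteDimensional Cq (CharMod χ) := inferInstanceAs (FiniteDimensional Cq Cq)

instance : Module Uq' (CharMod χ) := Module.compHom Cq χ.toRingHom

/-- The generator of `CharMod χ`. -/
def one : CharMod χ := (1 : Cq)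

variable {χ}

theorem smul_def (x : Uq') (v : CharMod χ) : x • v = χ x • v := rfl

instance : IsScalarTower Cq Uq' (CharMod χ) where
  smul_assoc c x v := by rw [smul_def, smul_def, map_smul, smul_assoc]

theorem one_ne_zero : one χ ≠ 0 := (_root_.one_ne_zero : (1 : Cq) ≠ 0)

end CharMod

namespace UqGL

/-- The values on generators of the one-dimensional representation of `U_q(𝔤𝔩₄)` of weight
`(m, m, m, m)`. -/
def detGen (m : ℤ) : Gen → Cq
  | .E _ => 0
  | .F _ => 0
  | .D _ => q ^ m
  | .Dinv _ => q ^ (-m)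

theorem detGen_rel (m : ℤ) {x y : FreeAlgebra Cq Gen} (h : GLRel x y) :
    FreeAlgebra.lift Cq (detGen m) x = FreeAlgebra.lift Cq (detGen m) y := by
  have h1 : q ^ m * q ^ (-m) = 1 := by rw [← zpow_add₀ q_ne_zero, add_neg_cancel, zpow_zero]
  have h2 : q ^ (-m) * q ^ m = 1 := by rw [mul_comm, h1]
  cases h <;> simp only [map_mul, map_one, map_add, map_sub, map_smul, map_zero, map_pow,
    FreeAlgebra.lift_ι_apply, detGen, h1, h2, mul_zero, zero_mul, smul_zero, sub_self, add_zero, sq]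

/-- The one-dimensional representation of `U_q(𝔤𝔩₄)` of weight `(m, m, m, m)`. -/
def det (m : ℤ) : UqGL →ₐ[Cq] Cq :=
  RingQuot.liftAlgHom Cq ⟨FreeAlgebra.lift Cq (detGen m), fun _ _ h => detGen_rel m h⟩

theorem det_gen (m : ℤ) (g : Gen) : det m (gen g) = detGen m g := by
  rw [det, gen]
  erw [RingQuot.liftAlgHom_mkAlgHom_apply]
  exact FreeAlgebra.lift_ι_apply _ _

end UqGL

open UqGL in
theorem isSpherical_det (m : ℤ) :
    IsSpherical (2 * m) (qBr 1 0) (CharMod.one ((det m).comp Uq'.val)) := by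
  have hE (i : Fin 3) : det m (E i) = 0 := det_gen _ _
  have hF (i : Fin 3) : det m (F i) = 0 := det_gen _ _
  have hD (j : Fin 4) : det m (D j) = q ^ m := det_gen _ _
  have hB (i : Fin 3) : det m (B i) = 0 := by rw [B, map_add, map_mul, hE, hF, zero_mul, add_zero]
  have hDhat (j : Fin 4) : det m (Dhat j) = q ^ (2 * m) := by
    rw [Dhat, map_mul, hD, hD, ← zpow_add₀ q_ne_zero, two_mul]
  constructor
  · rw [CharMod.smul_def, AlgHom.comp_apply, show det m (Uq'.val B1) = 0 from hB 0, zero_smul]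
  · rw [CharMod.smul_def, AlgHom.comp_apply, show det m (Uq'.val Bm1) = 0 from hB 2, zero_smul]
  · rw [CharMod.smul_def, AlgHom.comp_apply, show det m (Uq'.val B0) = det m Bzero from rfl, Bzero,
      map_add, map_smul, map_mul, hE, hF]
    simp [qBr]
  · rw [CharMod.smul_def, AlgHom.comp_apply, show det m (Uq'.val Dd) = _ from hDhat 2]
  · rw [CharMod.smul_def, AlgHom.comp_apply, show det m (Uq'.val D1) = _ from hDhat 3]

/-! ### Characters by interpolation, and modules for all admissible weights. -/

section

open Polynomial

/-- There is a `U_q'`-module with a nonzero spherical vector of type `(d, β)`. -/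
def ExistsSpherical (d : ℤ) (β : Cq) : Prop :=
  ∃ (W : Type) (_ : AddCommGroup W) (_ : Module Cq W) (_ : Module Uq' W)
    (_ : IsScalarTower Cq Uq' W) (v : W), v ≠ 0 ∧ IsSpherical d β v

theorem ExistsSpherical.succ {d : ℤ} {c : Cq} (hc : c ≠ 0) (h : ExistsSpherical d (qBr c 0)) :
    ExistsSpherical (d + 1) (qBr (q * c) 0) := by
  obtain ⟨W, _, _, _, _, v, hv, h⟩ := h
  refine ⟨Tens (Tens W), inferInstance, inferInstance, inferInstance, inferInstance, _,
    fun h0 => hv ?_, h.tens hc⟩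
  rw [← Tens.mk_zero] at h0
  have h1 := (Tens.mk_inj h0).2.1
  rw [← Tens.mk_zero] at h1
  exact (Tens.mk_inj h1).1

theorem existsSpherical_natCast (m : ℤ) (n : ℕ) :
    ExistsSpherical (2 * m + n) (qBr (q ^ (n : ℤ)) 0) := by
  induction n with
  | zero =>
    simpa using ⟨_, inferInstance, inferInstance, inferInstance, inferInstance, _,
      CharMod.one_ne_zero, isSpherical_det m⟩
  | succ n ih =>
    have h := ih.succ (q_zpow_ne_zero n)
    rwa [← zpow_one_add₀ q_ne_zero, add_comm (1 : ℤ), add_assoc] at h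

theorem qBr_q_zpow_injective : Function.Injective fun n : ℕ => qBr (q ^ (n : ℤ)) 0 := by
  intro n n' h
  rcases eq_or_of_qBr_eq (q_zpow_ne_zero n) (q_zpow_ne_zero n') h with h1 | h1
  · exact_mod_cast q_zpow_inj h1
  · have h2 : q ^ (2 * ((n : ℤ) + n')) = q ^ (0 : ℤ) := by
      rw [two_mul, zpow_add₀ q_ne_zero, zpow_add₀ q_ne_zero, h1]; simp
    have h3 := q_zpow_inj h2
    omega

theorem infinite_existsSpherical (d : ℤ) : {β | ExistsSpherical d β}.Infinite := by
  -- Lowering the determinant power by t lowers d by 2t, which 2t additional spherical steps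
  -- compensate while changing the B_0-eigenvalue.
  obtain ⟨m, e, he⟩ : ∃ (m : ℤ) (e : ℕ), d = 2 * m + e :=
    ⟨d / 2, (d % 2).toNat, by omega⟩
  refine Set.infinite_of_injective_forall_mem (f := fun t : ℕ => qBr (q ^ ((e + 2 * t : ℕ) : ℤ)) 0)
    (fun t t' h => ?_) fun t => ?_
  · have h1 := qBr_q_zpow_injective h
    omega
  · have h := existsSpherical_natCast (m - t) (e + 2 * t)
    rwa [show 2 * (m - t) + ((e + 2 * t : ℕ) : ℤ) = d by push_cast; rw [he]; ring] at h

/-- The action on spherical vectors is polynomial in the eigenvalue of `B_0`. -/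
theorem exists_polynomial (d : ℤ) (x : Uq') : ∃ p : Cq[X], ∀ (W : Type) [AddCommGroup W]
    [Module Cq W] [Module Uq' W] [IsScalarTower Cq Uq' W] (v : W) (β : Cq), IsSpherical d β v →
      x • v = p.eval β • v := by
  induction x using uq'_induction with
  | hB1 => exact ⟨0, fun W _ _ _ _ v β h => by rw [h.B1_smul]; simp⟩
  | hBm1 => exact ⟨0, fun W _ _ _ _ v β h => by rw [h.Bm1_smul]; simp⟩
  | hB0 => exact ⟨Polynomial.X, fun W _ _ _ _ v β h => by rw [h.B0_smul]; simp⟩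
  | hDd => exact ⟨C (q ^ d), fun W _ _ _ _ v β h => by rw [h.Dd_smul]; simp⟩
  | hD1 => exact ⟨C (q ^ d), fun W _ _ _ _ v β h => by rw [h.D1_smul]; simp⟩
  | hDdInv =>
    exact ⟨C (q ^ d)⁻¹, fun W _ _ _ _ v β h => by
      rw [inv_smul_of_smul DdInv_mul_Dd (q_zpow_ne_zero d) h.Dd_smul, eval_C]⟩
  | hD1Inv =>
    exact ⟨C (q ^ d)⁻¹, fun W _ _ _ _ v β h => by
      rw [inv_smul_of_smul D1Inv_mul_D1 (q_zpow_ne_zero d) h.D1_smul, eval_C]⟩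
  | hc c => exact ⟨C c, fun W _ _ _ _ v β h => by rw [algebraMap_smul, eval_C]⟩
  | hadd x y hx hy =>
    obtain ⟨p, hp⟩ := hx
    obtain ⟨r, hr⟩ := hy
    exact ⟨p + r, fun W _ _ _ _ v β h => by
      rw [add_smul, hp W v β h, hr W v β h, eval_add, add_smul]⟩
  | hmul x y hx hy =>
    obtain ⟨p, hp⟩ := hx
    obtain ⟨r, hr⟩ := hy
    exact ⟨p * r, fun W _ _ _ _ v β h => by
      rw [mul_smul, hr W v β h, smul_comm_uq', hp W v β h, smul_smul, eval_mul, mul_comm]⟩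

/-- The polynomial by which an element of `U_q'` acts on spherical vectors. -/
def sphericalPoly (d : ℤ) (x : Uq') : Cq[X] := (exists_polynomial d x).choose

theorem smul_eq_sphericalPoly {d : ℤ} (x : Uq') {W : Type} [AddCommGroup W] [Module Cq W]
    [Module Uq' W] [IsScalarTower Cq Uq' W] {v : W} {β : Cq} (h : IsSpherical d β v) :
    x • v = (sphericalPoly d x).eval β • v :=
  (exists_polynomial d x).choose_spec W v β h

/-- Nonzero spherical vectors exist for infinitely many β, so a polynomial giving the action is
unique. Additivity and multiplicativity of the character at every β follow, although U_q' is known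
only as a subalgebra and not by a presentation. -/
theorem sphericalPoly_eq {d : ℤ} {x : Uq'} {p : Cq[X]}
    (hp : ∀ (W : Type) [AddCommGroup W] [Module Cq W] [Module Uq' W] [IsScalarTower Cq Uq' W]
      (v : W) (β : Cq), IsSpherical d β v → x • v = p.eval β • v) : sphericalPoly d x = p := by
  refine eq_of_infinite_eval_eq _ _ ((infinite_existsSpherical d).mono ?_)
  rintro β ⟨W, _, _, _, _, v, hv, h⟩
  have h1 := hp W v β h
  rw [smul_eq_sphericalPoly x h] at h1
  exact smul_left_injective Cq hv h1

/-- The character of `U_q'` annihilating `B_{±1}` with `B_0 ↦ β` and `D̂_♦, D̂_1 ↦ q^d`. -/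
def sphericalChar (d : ℤ) (β : Cq) : Uq' →ₐ[Cq] Cq where
  toFun x := (sphericalPoly d x).eval β
  map_one' := by
    rw [sphericalPoly_eq (p := 1) fun W _ _ _ _ v β h => by simp]; simp
  map_zero' := by
    rw [sphericalPoly_eq (p := 0) fun W _ _ _ _ v β h => by simp]; simp
  map_add' x y := by
    rw [sphericalPoly_eq (p := sphericalPoly d x + sphericalPoly d y) fun W _ _ _ _ v β h => by
      rw [add_smul, smul_eq_sphericalPoly x h, smul_eq_sphericalPoly y h, eval_add, add_smul],
      eval_add]
  map_mul' x y := by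
    rw [sphericalPoly_eq (p := sphericalPoly d x * sphericalPoly d y) fun W _ _ _ _ v β h => by
      rw [mul_smul, smul_eq_sphericalPoly y h, smul_comm_uq', smul_eq_sphericalPoly x h, eval_mul,
        smul_smul, mul_comm], eval_mul]
  commutes' c := by
    rw [sphericalPoly_eq (p := C c) fun W _ _ _ _ v β h => by rw [algebraMap_smul, eval_C],
      eval_C]; rfl

theorem isSpherical_sphericalChar (d : ℤ) (β : Cq) :
    IsSpherical d β (CharMod.one (sphericalChar d β)) := by
  have key (x : Uq') (p : Cq[X]) (hp : ∀ (W : Type) [AddCommGroup W] [Module Cq W] [Module Uq' W]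
      [IsScalarTower Cq Uq' W] (v : W) (β : Cq), IsSpherical d β v → x • v = p.eval β • v) :
      x • CharMod.one (sphericalChar d β) = p.eval β • CharMod.one (sphericalChar d β) := by
    rw [← sphericalPoly_eq hp]; rfl
  constructor
  · simpa using key B1 0 fun W _ _ _ _ v β h => by rw [h.B1_smul]; simp
  · simpa using key Bm1 0 fun W _ _ _ _ v β h => by rw [h.Bm1_smul]; simp
  · simpa using key B0 Polynomial.X fun W _ _ _ _ v β h => by rw [h.B0_smul]; simp
  · simpa using key Dd (C (q ^ d)) fun W _ _ _ _ v β h => by rw [h.Dd_smul]; simp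
  · simpa using key D1 (C (q ^ d)) fun W _ _ _ _ v β h => by rw [h.D1_smul]; simp

/-- There is a finite-dimensional `U_q'`-module with a nonzero highest weight vector of the given
weight. -/
def ExistsHW (d d₁ : ℤ) (μ ζ : Cq) : Prop :=
  ∃ (W : Type) (_ : AddCommGroup W) (_ : Module Cq W) (_ : Module Uq' W)
    (_ : IsScalarTower Cq Uq' W) (_ : FiniteDimensional Cq W) (v : W), v ≠ 0 ∧ IsHW d d₁ μ ζ v

/-- The Z-weight produced by `Tens.isHW` is the admissible one for (κ + 1, i + 1) and parameter qc.
-/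
theorem zetaOf_q_mul {c : Cq} (hc : c ≠ 0) (κ i : ℤ) :
    zetaOf κ c i - q ^ (-κ - 1) * c⁻¹ = zetaOf (κ + 1) (q * c) (i + 1) := by
  have e : qBr c (κ - 2 * i) = qBr (q * c) (κ + 1 - 2 * (i + 1)) := by
    rw [qBr_eq, qBr_eq (q * c), ← mul_assoc, ← zpow_add_one₀ q_ne_zero]
    congr 3; ring
  have h := qBr_q_mul hc
  have h0 := q_ne_zero
  have h2 := c_mul_qBr_q_mul hc
  have h3 : q ^ (-κ) = q * q ^ (-κ - 1) := by
    rw [← zpow_one_add₀ h0]; congr 1; ring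
  have h4 : qBr (q * c) 0 = q * qBr c 0 + c⁻¹ := by
    apply mul_left_cancel₀ hc
    rw [h2]; field_simp
  rw [zetaOf, zetaOf, e, h3, h4, show -(κ + 1) = -κ - 1 by ring]
  ring

theorem ExistsHW.plus {d d₁ i : ℤ} {c : Cq} (hc : c ≠ 0)
    (h : ExistsHW d d₁ c (zetaOf (d - d₁) c i)) :
    ExistsHW (d + 1) d₁ (q * c) (zetaOf (d + 1 - d₁) (q * c) (i + 1)) := by
  obtain ⟨W, _, _, _, _, _, v, hv, h⟩ := h
  have h1 := Tens.isHW h hc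
  rw [zetaOf_q_mul hc, show d - d₁ + 1 = d + 1 - d₁ by ring] at h1
  refine ⟨Tens W, inferInstance, inferInstance, inferInstance, inferInstance, inferInstance, _,
    fun h0 => hv ?_, h1⟩
  rw [← Tens.mk_zero] at h0
  exact (Tens.mk_inj h0).2.1

theorem ExistsHW.neg_inv {d d₁ : ℤ} {c ζ : Cq} (h : ExistsHW d d₁ c ζ) :
    ExistsHW d d₁ (-c⁻¹) ζ := by
  obtain ⟨W, _, _, _, _, _, v, hv, h⟩ := h
  exact ⟨W, inferInstance, inferInstance, inferInstance, inferInstance, inferInstance, v, hv,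
    h.neg_inv⟩

theorem ExistsHW.minus {d d₁ i : ℤ} {c : Cq} (hc : c ≠ 0)
    (h : ExistsHW d d₁ c (zetaOf (d - d₁) c i)) :
    ExistsHW (d + 1) d₁ (q⁻¹ * c) (zetaOf (d + 1 - d₁) (q⁻¹ * c) i) := by
  -- Conjugating the step `plus` by the symmetry replaces i by κ - i before and after it, so κ grows
  -- while i stays.
  rw [← zetaOf_neg_inv] at h
  have hc' : -c⁻¹ ≠ 0 := neg_ne_zero.2 (inv_ne_zero hc)
  have h1 := (h.neg_inv.plus hc').neg_inv
  have e : -(q * -c⁻¹)⁻¹ = q⁻¹ * c := by rw [mul_inv, inv_neg_inv, mul_neg, neg_neg]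
  rwa [e, ← zetaOf_neg_inv, e, show d + 1 - d₁ - (d - d₁ - i + 1) = i by ring] at h1

/-- Start from a character, where κ = 0, then take j steps `minus` and i steps `plus`; the parameter
is multiplied by q^{i-j}. -/
theorem existsHW (d₁ : ℤ) {μ : Cq} (hμ : μ ≠ 0) (i j : ℕ) :
    ExistsHW (d₁ + (i + j)) d₁ (q ^ ((i : ℤ) - j) * μ)
      (zetaOf (d₁ + (i + j) - d₁) (q ^ ((i : ℤ) - j) * μ) i) := by
  induction i with
  | succ i ih =>
    have h := ih.plus (mul_ne_zero (q_zpow_ne_zero _) hμ)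
    rw [← mul_assoc, ← zpow_one_add₀ q_ne_zero] at h
    push_cast
    rwa [show d₁ + ((i : ℤ) + j) + 1 = d₁ + (i + 1 + j) by ring,
      show 1 + ((i : ℤ) - j) = i + 1 - j by ring] at h
  | zero =>
    induction j with
    | zero =>
      refine ⟨CharMod (sphericalChar d₁ (qBr μ 0)), inferInstance, inferInstance, inferInstance,
        inferInstance, inferInstance, _, CharMod.one_ne_zero, ?_⟩
      simpa [zetaOf] using (isSpherical_sphericalChar d₁ (qBr μ 0)).isHW
    | succ j ih =>
      have h := ih.minus (mul_ne_zero (q_zpow_ne_zero _) hμ)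
      rw [← mul_assoc, ← zpow_neg_one, ← zpow_add₀ q_ne_zero] at h
      push_cast at h ⊢
      rwa [show d₁ + (0 + (j : ℤ)) + 1 = d₁ + (0 + (j + 1)) by ring,
        show -1 + (0 - (j : ℤ)) = 0 - (j + 1) by ring] at h

/-- Finite-dimensional modules with highest weight vectors of all weights as in the classification
of the good irreducible modules. -/
theorem existsHW_zetaOf {d d₁ : ℤ} {μ : Cq} (hμ : μ ≠ 0) {i : ℕ} (hi : (i : ℤ) ≤ d - d₁) :
    ExistsHW d d₁ μ (zetaOf (d - d₁) μ i) := by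
  obtain ⟨j, hj⟩ := Int.le.dest hi
  -- The initial parameter q^{j-i}μ compensates the shift by q^{i-j}.
  have h := existsHW d₁ (mul_ne_zero (q_zpow_ne_zero (j - i)) hμ) i j
  rwa [← mul_assoc, ← zpow_add₀ q_ne_zero, show (i : ℤ) - j + (j - i) = 0 by ring, zpow_zero,
    one_mul, show d₁ + ((i : ℤ) + j) = d by rw [hj]; ring] at h

end

/-- The quotient by a submodule containing the kernel of a map to a finite-dimensional module is
finite-dimensional. -/
theorem finiteDimensional_quotient {k A M W : Type*} [Field k] [Ring A] [Algebra k A]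
    [AddCommGroup M] [Module k M] [Module A M] [IsScalarTower k A M] [AddCommGroup W] [Module k W]
    [Module A W] [IsScalarTower k A W] [FiniteDimensional k W] (f : M →ₗ[A] W) {N : Submodule A M}
    (h : LinearMap.ker f ≤ N) : FiniteDimensional k (M ⧸ N) := by
  have hi : Function.Injective ((LinearMap.ker f).liftQ f le_rfl) :=
    LinearMap.ker_eq_bot.1 (Submodule.ker_liftQ_eq_bot _ _ _ le_rfl)
  have : FiniteDimensional k (M ⧸ LinearMap.ker f) :=
    Module.Finite.of_injective (((LinearMap.ker f).liftQ f le_rfl).restrictScalars k) hi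
  exact Module.Finite.of_surjective ((Submodule.factor h).restrictScalars k)
    (Submodule.factor_surjective h)

/-! ### Quotients of cyclic modules. -/

section Quotients

variable {M : Type*} [AddCommGroup M] [Module Uq' M] {d d₁ : ℤ} {μ ζ : Cq} {v : M}

theorem mkQ_FFvec (N : Submodule Uq' M) (a b : ℕ) :
    N.mkQ (FFvec μ v a b) = FFvec μ (N.mkQ v) a b := by
  rw [FFvec, FFvec, map_smul, map_smul]

theorem mkQ_ne_zero (hv : ∀ m : M, ∃ x : Uq', m = x • v) {N : Submodule Uq' M} (hN : N ≠ ⊤) :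
    N.mkQ v ≠ 0 := fun h0 => hN <| by
  rw [Submodule.mkQ_apply, Submodule.Quotient.mk_eq_zero] at h0
  rw [eq_top_iff]
  rintro m -
  obtain ⟨x, rfl⟩ := hv m
  exact N.smul_mem x h0

variable [Module Cq M] [IsScalarTower Cq Uq' M]

theorem IsHW.const_smul (h : IsHW d d₁ μ ζ v) (c : Cq) : IsHW d d₁ μ ζ (c • v) :=
  ⟨h.toIsWt.const_smul c, by rw [smul_comm_uq', h.B1, smul_zero],
    by rw [smul_comm_uq', h.X, smul_zero]⟩

theorem IsHW.mkQ (h : IsHW d d₁ μ ζ v) (N : Submodule Uq' M) : IsHW d d₁ μ ζ (N.mkQ v) := by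
  have key (x : Uq') (c : Cq) (hx : x • v = c • v) : x • N.mkQ v = c • N.mkQ v := by
    rw [← map_smul, hx]; rfl
  exact ⟨⟨key _ _ h.Dd, key _ _ h.D1, key _ _ h.B0, key _ _ h.Z⟩,
    by rw [← map_smul, h.B1, map_zero], by rw [← map_smul, h.X, map_zero]⟩

theorem IsFDIrreducibleQuotient.isCoatom {N : Submodule Uq' M} (hN : IsFDIrreducibleQuotient N) :
    IsCoatom N :=
  isSimpleModule_iff_isCoatom.1 hN.1

theorem IsHW.exists_eq_zetaOf_of_quotient (h : IsHW d d₁ μ ζ v) (hμ : IsGood μ)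
    (hv : ∀ m : M, ∃ x : Uq', m = x • v) {N : Submodule Uq' M} (hN : IsFDIrreducibleQuotient N) :
    ∃ i : ℕ, (i : ℤ) ≤ d - d₁ ∧ ζ = zetaOf (d - d₁) μ i :=
  have := hN.2
  (h.mkQ N).exists_eq_zetaOf (mkQ_ne_zero hv hN.isCoatom.1) hμ

theorem IsHW.isWeightBasis_mkQ {i : ℕ} (h : IsHW d d₁ μ (zetaOf (d - d₁) μ i) v) (hμ : IsGood μ)
    (hi : (i : ℤ) ≤ d - d₁) (hv : ∀ m : M, ∃ x : Uq', m = x • v) {N : Submodule Uq' M}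
    (hN : IsFDIrreducibleQuotient N) {c : Cq} (hc : c ≠ 0) :
    IsWeightBasis fun p : {p : ℕ × ℕ // p.1 ≤ i ∧ (p.2 : ℤ) ≤ d - d₁ - i} =>
      N.mkQ (FFvec μ (c • v) p.1.1 p.1.2) := by
  have := hN.1
  simp only [mkQ_FFvec]
  refine ((h.const_smul c).mkQ N).isWeightBasis ?_ hμ hi
  change c • N.mkQ v ≠ 0
  exact smul_ne_zero hc (mkQ_ne_zero hv hN.isCoatom.1)

/-- A cyclic module with a nonzero map to a finite-dimensional module has a finite-dimensional
irreducible quotient. -/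
theorem exists_isFDIrreducibleQuotient_of_map (hv : ∀ m : M, ∃ x : Uq', m = x • v) {W : Type*}
    [AddCommGroup W] [Module Cq W] [Module Uq' W] [IsScalarTower Cq Uq' W]
    [FiniteDimensional Cq W] (f : M →ₗ[Uq'] W) (hf : f ≠ 0) :
    ∃ N : Submodule Uq' M, IsFDIrreducibleQuotient N := by
  have : Module.Finite Uq' M := Module.Finite.of_surjective (LinearMap.toSpanSingleton Uq' M v)
    fun m => by obtain ⟨x, rfl⟩ := hv m; exact ⟨x, rfl⟩
  -- A cyclic module is finitely generated, so the proper submodule ker f lies in a maximal one.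
  obtain ⟨N, hN, hfN⟩ := (eq_top_or_exists_le_coatom (LinearMap.ker f)).resolve_left
    fun h => hf (LinearMap.ker_eq_top.1 h)
  refine ⟨N, isSimpleModule_iff_isCoatom.2 hN, finiteDimensional_quotient f hfN⟩

end Quotients

/-! ### The Verma module and its universal property. -/

section Verma

variable (κd κ1 : ℤ) (β ζ : Cq)

/-- Shortcut for the `U_q'`-module structure of a cyclic module. -/
abbrev quotientModule (I : Submodule Uq' Uq') : Module Uq' (Uq' ⧸ I) := Submodule.Quotient.module I

/-- Shortcut for the scalar multiplication of a cyclic module. -/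
abbrev quotientSMul (I : Submodule Uq' Uq') : SMul Uq' (Uq' ⧸ I) :=
  (quotientModule I).toDistribMulAction.toSMul

attribute [local instance] quotientModule quotientSMul

theorem smul_vermaGen (x : Uq') :
    x • vermaGen κd κ1 β ζ = Submodule.Quotient.mk (p := vermaIdeal κd κ1 β ζ) x := by
  rw [vermaGen, ← Submodule.Quotient.mk_smul, smul_eq_mul, mul_one]

theorem exists_eq_smul_vermaGen (m : Verma κd κ1 β ζ) :
    ∃ x : Uq', m = x • vermaGen κd κ1 β ζ := by
  obtain ⟨x, rfl⟩ := Submodule.Quotient.mk_surjective _ m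
  exact ⟨x, (smul_vermaGen κd κ1 β ζ x).symm⟩

theorem smul_vermaGen_of_mem {x : Uq'} (hx : x ∈ vermaIdeal κd κ1 β ζ) :
    x • vermaGen κd κ1 β ζ = 0 := by
  rw [smul_vermaGen, Submodule.Quotient.mk_eq_zero]
  exact hx

theorem smul_vermaGen_of_sub_mem {x : Uq'} {c : Cq}
    (hx : x - algebraMap Cq Uq' c ∈ vermaIdeal κd κ1 β ζ) :
    x • vermaGen κd κ1 β ζ = c • vermaGen κd κ1 β ζ := by
  have h := smul_vermaGen_of_mem κd κ1 β ζ hx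
  rwa [sub_smul, algebraMap_smul, sub_eq_zero] at h

theorem isHW_vermaGen (μ : Cq) : IsHW κd κ1 μ ζ (vermaGen κd κ1 (qBr μ 0) ζ) where
  Dd := smul_vermaGen_of_sub_mem _ _ _ _ (Submodule.subset_span (by simp))
  D1 := smul_vermaGen_of_sub_mem _ _ _ _ (Submodule.subset_span (by simp))
  B0 := smul_vermaGen_of_sub_mem _ _ _ _ (Submodule.subset_span (by simp))
  Z := smul_vermaGen_of_sub_mem _ _ _ _ (Submodule.subset_span (by simp))
  B1 := smul_vermaGen_of_mem _ _ _ _ (Submodule.subset_span (by simp))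
  X := smul_vermaGen_of_mem _ _ _ _ (Submodule.subset_span (by simp))

/-- The universal property: a highest weight vector of matching weight receives a homomorphism from
the Verma module. -/
theorem vermaIdeal_le_ker {W : Type*} [AddCommGroup W] [Module Cq W] [Module Uq' W]
    [IsScalarTower Cq Uq' W] {μ : Cq} {w : W} (h : IsHW κd κ1 μ ζ w) :
    vermaIdeal κd κ1 (qBr μ 0) ζ ≤ LinearMap.ker (LinearMap.toSpanSingleton Uq' W w) := by
  have key (x : Uq') (c : Cq) (hx : x • w = c • w) : (x - algebraMap Cq Uq' c) • w = 0 := by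
    rw [sub_smul, algebraMap_smul, hx, sub_self]
  rw [vermaIdeal, Submodule.span_le]
  rintro x (rfl | rfl | rfl | rfl | rfl | rfl)
  · exact h.B1
  · exact h.X
  · exact key _ _ h.Dd
  · exact key _ _ h.D1
  · exact key _ _ h.B0
  · exact key _ _ h.Z

/-- A finite-dimensional module with a highest weight vector gives rise to a finite-dimensional
irreducible quotient of the Verma module. -/
theorem exists_isFDIrreducibleQuotient {μ : Cq} (h : ExistsHW κd κ1 μ ζ) :
    ∃ N : Submodule Uq' (Verma κd κ1 (qBr μ 0) ζ), IsFDIrreducibleQuotient N := by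
  obtain ⟨W, _, _, _, _, _, w, hw, h⟩ := h
  refine exists_isFDIrreducibleQuotient_of_map (exists_eq_smul_vermaGen κd κ1 (qBr μ 0) ζ)
    (Submodule.liftQ _ (LinearMap.toSpanSingleton Uq' W w) (vermaIdeal_le_ker κd κ1 ζ h))
    fun h0 => hw ?_
  have h1 := LinearMap.congr_fun h0 (vermaGen κd κ1 (qBr μ 0) ζ)
  rw [vermaGen, Submodule.liftQ_apply] at h1
  simpa using h1

end Verma

end QSP

end

theorem theorem4p15 (κd κ1 : ℤ) (μ ζ : QSP.Cq) (hμ : QSP.IsGood μ) :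
    ((∃ N : Submodule QSP.Uq' (QSP.Verma κd κ1 (QSP.qBr μ 0) ζ), QSP.IsFDIrreducibleQuotient N) ↔
      ∃ i : ℕ, (i : ℤ) ≤ κd - κ1 ∧
        ζ = QSP.qBr μ (κd - κ1 - 2 * i) - QSP.q ^ (-(κd - κ1)) * QSP.qBr μ 0) ∧
    ∀ i : ℕ, (i : ℤ) ≤ κd - κ1 →
      ζ = QSP.qBr μ (κd - κ1 - 2 * i) - QSP.q ^ (-(κd - κ1)) * QSP.qBr μ 0 →
      (∃! N : Submodule QSP.Uq' (QSP.Verma κd κ1 (QSP.qBr μ 0) ζ),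
        QSP.IsFDIrreducibleQuotient N) ∧
      ∀ N : Submodule QSP.Uq' (QSP.Verma κd κ1 (QSP.qBr μ 0) ζ),
        QSP.IsFDIrreducibleQuotient N →
        ∀ v : QSP.Verma κd κ1 (QSP.qBr μ 0) ζ, QSP.IsHighestWeightVector v →
          QSP.IsWeightBasis
            (fun p : {p : ℕ × ℕ // p.1 ≤ i ∧ (p.2 : ℤ) ≤ κd - κ1 - i} =>
              N.mkQ (QSP.FFvec μ v p.1.1 p.1.2)) := by
  have hgen := QSP.isHW_vermaGen κd κ1 ζ μ
  have hcyc := QSP.exists_eq_smul_vermaGen κd κ1 (QSP.qBr μ 0) ζ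
  have hex (i : ℕ) (hi : (i : ℤ) ≤ κd - κ1) (hζ : ζ = QSP.zetaOf (κd - κ1) μ i) :=
    QSP.exists_isFDIrreducibleQuotient κd κ1 ζ (hζ ▸ QSP.existsHW_zetaOf hμ.1 hi)
  refine ⟨⟨fun ⟨N, hN⟩ => hgen.exists_eq_zetaOf_of_quotient hμ hcyc hN,
    fun ⟨i, hi, hζ⟩ => hex i hi hζ⟩, fun i hi hζ => ⟨?_, ?_⟩⟩
  · obtain ⟨N, hN⟩ := hex i hi hζ
    exact ⟨N, hN, fun N' hN' => hgen.maximal_unique hμ hcyc hN'.isCoatom hN.isCoatom⟩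
  · rintro N hN v ⟨c, hc, rfl⟩
    subst hζ
    exact QSP.IsHW.isWeightBasis_mkQ (i := i) hgen hμ hi hcyc hN hc
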